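/- Work over a field $\mathbb K$ of characteristic $0$; let $\mathfrak g, V$ be vector spaces (of arbitrary dimension). **Pre-LieDer pairs.** $(\mathfrak g,\pi,D,\rho,\mu)$ is a pre-LieDer pair if $\pi:\mathfrak g\otimes\mathfrak g\to\mathfrak g$, $x\cdot y=\pi(x,y)$, is a pre-Lie product, i.e. $(x\cdot y)\cdot z-x\cdot(y\cdot z)=(y\cdot x)\cdot z-y\cdot(x\cdot z)$; the linear maps $\rho,\mu:\mathfrak g\to\mathfrak{gl}(V)$ form a representation, i.e. $\rho(x\cdot y-y\cdot x)=[\rho(x),\rho(y)]$ and $\mu(y)\mu(x)-\mu(x\cdot y)=\mu(y)\rho(x)-\rho(x)\mu(y)$; and $D:\mathfrak g\to V$ is a linear map with $D(x\cdot y)=\rho(x)D(y)+\mu(y)D(x)$. **The graded spaces.** Put $W=\mathfrak g\oplus V$ and $L=\bigoplus_{p\ge 0}C^{p+1}(W;W)$, $C^{p+1}(W;W)=\mathrm{Hom}(\wedge^{p}W\otimes W,W)$ in degree $p$, with the Matsushima–Nijenhuis bracket $[P,Q]=P\circ Q-(-1)^{pq}Q\circ P$ for $P,Q$ of degrees $p,q$,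 where $$\begin{aligned}(P\circ Q)(x_1,\dots,x_{p+q+1})={}&\sum_{\sigma\in \mathbb S_{(q,1,p-1)}}\mathrm{sgn}(\sigma)\,P\bigl(Q(x_{\sigma(1)},\dots,x_{\sigma(q)},x_{\sigma(q+1)}),x_{\sigma(q+2)},\dots,x_{\sigma(p+q)},x_{p+q+1}\bigr)\\&+(-1)^{pq}\sum_{\sigma\in \mathbb S_{(p,q)}}\mathrm{sgn}(\sigma)\,P\bigl(x_{\sigma(1)},\dots,x_{\sigma(p)},Q(x_{\sigma(p+1)},\dots,x_{\sigma(p+q)},x_{p+q+1})\bigr),\end{aligned}$$ the sums running over unshuffles (the first one is empty if $p=0$). A cochain of degree $p$ has bidegree $p-l\,|\,l$ if its value on arguments taken from $\mathfrak g$ and $V$, exactly $m$ of them from $V$, lies in $\mathfrak g$ for $m=l$, lies in $V$ for $m=l+1$, and is $0$ otherwise. Let $L'$ (resp. $\mathfrak h$) be the graded subspace of $L$ of all sums of cochains of bidegree $n|0$ (resp. $n|{-1}$), $n\ge 0$, and $P:L\to\mathfrak h$ the projection along the other bidegrees. On $s^{-1}L'\oplus\mathfrak h$, whose degree $i$ part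 is $(L')^{i+1}\oplus\mathfrak h^{i}$, let $$l_2(s^{-1}f,s^{-1}g)=(-1)^{|f|}s^{-1}[f,g],\qquad l_2(s^{-1}f,\theta)=P[f,\theta],\qquad l_2(\theta,\theta')=0$$ for homogeneous $f,g\in L'$, $\theta,\theta'\in\mathfrak h$, extended graded symmetrically, and $l_k=0$ for $k\ne 2$. For $\pi,\rho,\mu,D$ as above (linear maps, no identities assumed) let $\pi+\rho+\mu\in (L')^1$ be the cochain $(x+u,y+v)\mapsto \pi(x,y)+\rho(x)v+\mu(y)u$, and regard $D\in\mathfrak h^0$ as $x+u\mapsto D(x)$. **$L_\infty$-algebras.** An $L_\infty$-algebra is a $\mathbb Z$-graded vector space with graded symmetric multilinear maps $l_k$ ($k\ge1$) of degree $1$ such that $\sum_{i=1}^{n}\sum_{\sigma\in \mathbb S_{(i,n-i)}}\varepsilon(\sigma)\,l_{n-i+1}(l_i(x_{\sigma(1)},\dots,x_{\sigma(i)}),x_{\sigma(i+1)},\dots,x_{\sigma(n)})=0$ for all $n\ge 1$ and homogeneous $x_j$, with $\varepsilon$ the Koszul sign. A Maurer–Cartan element is an element $\alpha$ of degree $0$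 with $\sum_{k\ge1}\frac1{k!}l_k(\alpha,\dots,\alpha)=0$ (a finite sum here), and the brackets twisted by $\alpha$ are $l_k^{\alpha}(x_1,\dots,x_k)=\sum_{n\ge0}\frac1{n!}l_{k+n}(\alpha,\dots,\alpha,x_1,\dots,x_k)$. **Theorem.** Let $(\mathfrak g,\pi,D,\rho,\mu)$ be a pre-LieDer pair and $\alpha=(s^{-1}(\pi+\rho+\mu),D)$. Then $(s^{-1}L'\oplus\mathfrak h,\{l_k\})$ is an $L_\infty$-algebra with Maurer–Cartan element $\alpha$, and $(s^{-1}L'\oplus\mathfrak h,\{l_k^{\alpha}\}_{k\ge1})$ is an $L_\infty$-algebra with $$l_1^{\alpha}(a)=l_2(\alpha,a),\qquad l_2^{\alpha}(a_1,a_2)=l_2(a_1,a_2),\qquad l_k^{\alpha}=0\quad(k\ge3).$$ Every element of degree $0$ of $s^{-1}L'\oplus\mathfrak h$ is $(s^{-1}(\pi'+\rho'+\mu'),D')$ for unique linear maps $\pi':\mathfrak g\otimes\mathfrak g\to\mathfrak g$, $\rho',\mu':\mathfrak g\to\mathfrak{gl}(V)$, $D':\mathfrak g\to V$. For all such $\pi',\rho',\mu',D'$,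 the tuple $(\mathfrak g,\pi+\pi',D+D',\rho+\rho',\mu+\mu')$ is a pre-LieDer pair if and only if $(s^{-1}(\pi'+\rho'+\mu'),D')$ is a Maurer–Cartan element of $(s^{-1}L'\oplus\mathfrak h,\{l_k^{\alpha}\}_{k\ge1})$. -/

import Mathlib

open scoped DirectSum

namespace PreLieDer

/-! ### Pre-Lie algebras, representations, derivations -/

section Pairs

variable {K g V : Type*} [Field K] [AddCommGroup g] [Module K g] [AddCommGroup V] [Module K V]

/-- The bilinear product `π` is a (left) pre-Lie product on `g`. -/
def IsPreLie (π : g →ₗ[K] g →ₗ[K] g) : Prop :=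
  ∀ x y z : g, π (π x y) z - π x (π y z) = π (π y x) z - π y (π x z)

/-- `(V; ρ, μ)` is a representation of the pre-Lie algebra `(g, π)`: `ρ` is a representation of
the commutator Lie algebra, and `μ y ∘ μ x - μ (x · y) = μ y ∘ ρ x - ρ x ∘ μ y`. -/
structure IsRepresentation (π : g →ₗ[K] g →ₗ[K] g) (ρ μ : g →ₗ[K] (V →ₗ[K] V)) : Prop where
  lie : ∀ x y : g, ρ (π x y - π y x) = ρ x ∘ₗ ρ y - ρ y ∘ₗ ρ x
  right : ∀ x y : g, μ y ∘ₗ μ x - μ (π x y) = μ y ∘ₗ ρ x - ρ x ∘ₗ μ y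

/-- `(g, π, D, ρ, μ)` is a pre-LieDer pair: `(g, π)` is a pre-Lie algebra, `(V; ρ, μ)` is a
representation of it, and `D : g → V` is a derivation with respect to this representation. -/
structure IsPreLieDerPair (π : g →ₗ[K] g →ₗ[K] g) (D : g →ₗ[K] V)
    (ρ μ : g →ₗ[K] (V →ₗ[K] V)) : Prop where
  preLie : IsPreLie π
  rep : IsRepresentation π ρ μ
  derivation : ∀ x y : g, D (π x y) = ρ x (D y) + μ y (D x)

end Pairs

/-! ### Unshuffles -/

section Unshuffles

/-- Permutations of `Fin n` that are increasing on each of the blocks `{i | b i = c}`.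
If the blocks are consecutive intervals of lengths `i₁, …, iₖ`, these are the
`(i₁, …, iₖ)`-unshuffles. -/
def unshuffles {n : ℕ} (b : Fin n → ℕ) : Finset (Equiv.Perm (Fin n)) :=
  Finset.univ.filter fun σ => ∀ i j : Fin n, i < j → b i = b j → σ i < σ j

/-- The blocks of lengths `i, n - i`. -/
def blocks₂ (n i : ℕ) : Fin n → ℕ := fun a => if (a : ℕ) < i then 0 else 1

/-- The blocks of lengths `q, 1, n - q - 1`. -/
def blocks₃ (n q : ℕ) : Fin n → ℕ :=
  fun a => if (a : ℕ) < q then 0 else if (a : ℕ) = q then 1 else 2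

end Unshuffles

/-! ### `L∞`-algebras, Maurer–Cartan elements and twisting -/

section LInfinity

variable {K E : Type*} [Field K] [AddCommGroup E] [Module K E]

/-- The Koszul sign `ε(σ; x₁, …, xₙ)` of the reordering `x_{σ(1)}, …, x_{σ(n)}` of homogeneous
elements of degrees `d 1, …, d n`. -/
def koszulSign {n : ℕ} (d : Fin n → ℤ) (σ : Equiv.Perm (Fin n)) : ℤˣ :=
  ∏ i : Fin n, ∏ j : Fin n,
    if i < j ∧ σ j < σ i then Int.negOnePow (d (σ i) * d (σ j)) else 1

/-- `(E, {l k}_{k ≥ 1})` is an `L∞`-algebra, `E` being graded by the submodules `𝒜 i`, `i : ℤ`.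
All `l k` have degree `1` and are graded symmetric. The map `l 0` plays no role. -/
structure IsLInfinity (𝒜 : ℤ → Submodule K E)
    (l : (k : ℕ) → MultilinearMap K (fun _ : Fin k => E) E) : Prop where
  graded : DirectSum.IsInternal 𝒜
  degree_one : ∀ k : ℕ, 1 ≤ k → ∀ (d : Fin k → ℤ) (x : Fin k → E), (∀ i, x i ∈ 𝒜 (d i)) →
    l k x ∈ 𝒜 ((∑ i, d i) + 1)
  symm : ∀ n : ℕ, 1 ≤ n → ∀ (d : Fin n → ℤ) (x : Fin n → E), (∀ i, x i ∈ 𝒜 (d i)) →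
    ∀ σ : Equiv.Perm (Fin n), l n (x ∘ σ) = koszulSign d σ • l n x
  jacobi : ∀ n : ℕ, 1 ≤ n → ∀ (d : Fin n → ℤ) (x : Fin n → E), (∀ i, x i ∈ 𝒜 (d i)) →
    ∑ i : Fin n, ∑ σ ∈ unshuffles (blocks₂ n (i + 1)),
      koszulSign d σ •
        l (n - (i + 1) + 1)
          (Fin.cons (l (i + 1) fun a : Fin (i + 1) => x (σ ⟨a, by omega⟩))
            fun c : Fin (n - (i + 1)) => x (σ ⟨i + 1 + c, by omega⟩)) = 0

/-- `α` is a Maurer–Cartan element of `(E, {l k}_{k ≥ 1})`: it has degree `0`, only finitely many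
of the terms `l k (α, …, α)` are nonzero, and `∑_{k ≥ 1} (1 / k!) l k (α, …, α) = 0`. -/
def IsMaurerCartan (𝒜 : ℤ → Submodule K E)
    (l : (k : ℕ) → MultilinearMap K (fun _ : Fin k => E) E) (α : E) : Prop :=
  α ∈ 𝒜 0 ∧ {k : ℕ | l (k + 1) (fun _ => α) ≠ 0}.Finite ∧
    ∑ᶠ k : ℕ, (((k + 1).factorial : K)⁻¹) • l (k + 1) (fun _ => α) = 0

/-- `plug α n f` is the map `(x₁, …, xₖ) ↦ f (α, …, α, x₁, …, xₖ)` with `n` copies of `α`. -/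
def plug (α : E) {k : ℕ} : (n : ℕ) → MultilinearMap K (fun _ : Fin (k + n) => E) E →
    MultilinearMap K (fun _ : Fin k => E) E
  | 0, f => f
  | n + 1, f => plug α n (MultilinearMap.curryLeft (n := k + n) f α)

/-- The twisted brackets
`l_k^α (x₁, …, xₖ) = ∑_{n ≥ 0} (1 / n!) l_{k + n} (α, …, α, x₁, …, xₖ)`.
(Used only for families with `l k = 0` for all large `k`, so that the sum is finite.) -/
noncomputable def twist (l : (k : ℕ) → MultilinearMap K (fun _ : Fin k => E) E) (α : E) (k : ℕ) :
    MultilinearMap K (fun _ : Fin k => E) E :=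
  ∑ᶠ n : ℕ, ((n.factorial : K)⁻¹) • plug α n (l (k + n))

end LInfinity

/-! ### The Matsushima–Nijenhuis bracket -/

section MN

variable {K W M : Type*} [Field K] [AddCommGroup W] [Module K W] [AddCommGroup M] [Module K M]

/-- The unshuffle sum `x ↦ ∑_σ sgn(σ) F (x_{σ(1)}, …, x_{σ(n)})` changes sign under adjacent
transpositions of its arguments as soon as `F` is antisymmetric within the blocks. -/
theorem unshuffleSum_adjacent {n : ℕ} (b : Fin (n + 1) → ℕ)
    (F : MultilinearMap K (fun _ : Fin (n + 1) => W) M)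
    (hF : ∀ (x : Fin (n + 1) → W) (i j : Fin (n + 1)), i ≠ j → b i = b j →
      F (x ∘ Equiv.swap i j) = -F x) (k : Fin n) (x : Fin (n + 1) → W) :
    (∑ σ ∈ unshuffles b,
        Equiv.Perm.sign σ • F (fun a => x (Equiv.swap k.castSucc k.succ (σ a)))) =
      -∑ σ ∈ unshuffles b, Equiv.Perm.sign σ • F (fun a => x (σ a)) := by
  classical
  set s : Equiv.Perm (Fin (n + 1)) := Equiv.swap k.castSucc k.succ with hs
  have hne : k.castSucc ≠ k.succ := (Fin.castSucc_lt_succ (i := k)).ne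
  have hss : ∀ a, s (s a) = a := fun a => Equiv.swap_apply_self _ _ a
  let c : Equiv.Perm (Fin (n + 1)) → Prop := fun σ => b (σ.symm k.castSucc) = b (σ.symm k.succ)
  let φ : Equiv.Perm (Fin (n + 1)) → Equiv.Perm (Fin (n + 1)) := fun σ =>
    if c σ then σ else s * σ
  have hc : ∀ σ, c (s * σ) ↔ c σ := by
    intro σ
    have h1 : (s * σ).symm k.castSucc = σ.symm k.succ := by
      rw [Equiv.symm_apply_eq]; simp [hs]
    have h2 : (s * σ).symm k.succ = σ.symm k.castSucc := by
      rw [Equiv.symm_apply_eq]; simp [hs]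
    simp only [c, h1, h2]; exact eq_comm
  have hφφ : ∀ σ, φ (φ σ) = σ := by
    intro σ
    by_cases h : c σ
    · simp [φ, h]
    · have h' : ¬ c (s * σ) := fun q => h ((hc σ).1 q)
      simp only [φ, h, h', if_false]
      ext a; simp [hss]
  have hmem : ∀ σ ∈ unshuffles b, φ σ ∈ unshuffles b := by
    intro σ hσ
    by_cases h : c σ
    · simpa [φ, h] using hσ
    · simp only [φ, h, if_false]
      simp only [unshuffles, Finset.mem_filter, Finset.mem_univ, true_and] at hσ ⊢
      intro i j hij hb
      have hlt := hσ i j hij hb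
      have hnot : ¬ (σ i = k.castSucc ∧ σ j = k.succ) := by
        rintro ⟨h1, h2⟩
        apply h
        simp only [c, ← h1, ← h2, Equiv.symm_apply_apply]
        exact hb
      simp only [Equiv.Perm.mul_apply, hs, Equiv.swap_apply_def]
      simp only [Fin.ext_iff, Fin.lt_def, Fin.val_castSucc, Fin.val_succ] at hnot hlt ⊢
      split_ifs <;> simp <;> omega
  rw [← Finset.sum_neg_distrib]
  refine Finset.sum_nbij' φ φ hmem hmem (fun σ _ => hφφ σ) (fun σ _ => hφφ σ) ?_
  intro σ _
  by_cases h : c σ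
  · simp only [φ, h, if_true]
    have hne' : σ.symm k.castSucc ≠ σ.symm k.succ := fun q => hne (σ.symm.injective q)
    have := hF (fun a => x (σ a)) _ _ hne' h
    rw [← smul_neg, ← this]
    congr 2
    funext a
    simp only [Function.comp_apply, hs]
    congr 1
    simp only [Equiv.swap_apply_def, Equiv.eq_symm_apply]
    split_ifs <;> simp
  · simp only [φ, h, if_false, Equiv.Perm.sign_mul, Equiv.Perm.mul_apply]
    rw [hs, Equiv.Perm.sign_swap hne]
    simp

theorem unshuffleSum_perm {n : ℕ} (b : Fin n → ℕ) (F : MultilinearMap K (fun _ : Fin n => W) M)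
    (hF : ∀ (x : Fin n → W) (i j : Fin n), i ≠ j → b i = b j →
      F (x ∘ Equiv.swap i j) = -F x) (τ : Equiv.Perm (Fin n)) (x : Fin n → W) :
    (∑ σ ∈ unshuffles b, Equiv.Perm.sign σ • F (fun a => x (τ (σ a)))) =
      Equiv.Perm.sign τ • ∑ σ ∈ unshuffles b, Equiv.Perm.sign σ • F (fun a => x (σ a)) := by
  cases n with
  | zero => simp [Subsingleton.elim τ 1]
  | succ n =>
    have hτ : τ ∈ Submonoid.closure
        (Set.range fun i : Fin n => Equiv.swap i.castSucc i.succ) := by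
      rw [Equiv.Perm.mclosure_swap_castSucc_succ]; trivial
    induction hτ using Submonoid.closure_induction generalizing x with
    | mem τ h =>
      obtain ⟨k, rfl⟩ := h
      rw [Equiv.Perm.sign_swap (Fin.castSucc_lt_succ (i := k)).ne]
      simpa using unshuffleSum_adjacent b F hF k x
    | one => simp
    | mul τ₁ τ₂ _ _ h₁ h₂ =>
      have := h₂ (fun a => x (τ₁ a))
      simp only [Equiv.Perm.mul_apply, Equiv.Perm.sign_mul]
      rw [this, h₁ x, smul_smul, mul_comm]

/-- The alternating map `x ↦ ∑_σ sgn(σ) F (x_{σ(1)}, …, x_{σ(n)})`, the sum running over the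
unshuffles for `b`, where `F` is antisymmetric within the blocks of `b`. -/
def unshuffleSum [CharZero K] {n : ℕ} (b : Fin n → ℕ)
    (F : MultilinearMap K (fun _ : Fin n => W) M)
    (hF : ∀ (x : Fin n → W) (i j : Fin n), i ≠ j → b i = b j →
      F (x ∘ Equiv.swap i j) = -F x) : W [⋀^Fin n]→ₗ[K] M :=
  { ∑ σ ∈ unshuffles b, Equiv.Perm.sign σ • F.domDomCongr σ with
    map_eq_zero_of_eq' := by
      intro x i j hx hij
      have h := unshuffleSum_perm b F hF (Equiv.swap i j) x
      have hx' : ∀ a, x (Equiv.swap i j a) = x a := by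
        intro a
        rw [Equiv.swap_apply_def]
        split_ifs with h1 h2
        · rw [h1, hx]
        · rw [h2, hx]
        · rfl
      simp only [hx', Equiv.Perm.sign_swap hij, Units.neg_smul, one_smul] at h
      have h0 : (∑ σ ∈ unshuffles b, Equiv.Perm.sign σ • F (fun a => x (σ a))) = 0 := by
        have h2 : (2 : K) • (∑ σ ∈ unshuffles b,
            Equiv.Perm.sign σ • F (fun a => x (σ a))) = 0 := by
          rw [two_smul]; nth_rewrite 2 [h]; exact add_neg_cancel _
        exact (smul_eq_zero.1 h2).resolve_left two_ne_zero
      simpa using h0 }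

theorem unshuffleSum_apply [CharZero K] {n : ℕ} (b : Fin n → ℕ)
    (F : MultilinearMap K (fun _ : Fin n => W) M)
    (hF : ∀ (x : Fin n → W) (i j : Fin n), i ≠ j → b i = b j →
      F (x ∘ Equiv.swap i j) = -F x) (x : Fin n → W) :
    unshuffleSum b F hF x =
      ∑ σ ∈ unshuffles b, Equiv.Perm.sign σ • F (fun a => x (σ a)) := by
  change (∑ σ ∈ unshuffles b, Equiv.Perm.sign σ • F.domDomCongr σ) x = _
  simp

end MN

section Bracket

theorem update_comp_same {W : Type*} {m n : ℕ} (x : Fin n → W) (e : Fin m → Fin n)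
    (he : Function.Injective e) [DecidableEq (Fin n)] (a : Fin m) (v : W) :
    (fun t => Function.update x (e a) v (e t)) = Function.update (fun t => x (e t)) a v := by
  funext t
  by_cases h : t = a
  · subst h; simp
  · rw [Function.update_of_ne (fun k => h (he k)), Function.update_of_ne h]

theorem update_comp_other {W : Type*} {m n : ℕ} (x : Fin n → W) (e : Fin m → Fin n)
    [DecidableEq (Fin n)] (i : Fin n) (hi : ∀ t, e t ≠ i) (v : W) :
    (fun t => Function.update x i v (e t)) = fun t => x (e t) := by
  funext t
  exact Function.update_of_ne (hi t) _ _

theorem swap_comp_same {W : Type*} {m n : ℕ} (x : Fin n → W) (e : Fin m → Fin n)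
    (he : Function.Injective e) (a b : Fin m) :
    (fun t => x (Equiv.swap (e a) (e b) (e t))) = (fun t => x (e t)) ∘ Equiv.swap a b := by
  funext t
  simp only [Function.comp_apply, Equiv.swap_apply_def, he.eq_iff]
  split_ifs <;> rfl

theorem swap_comp_other {W : Type*} {m n : ℕ} (x : Fin n → W) (e : Fin m → Fin n) (i j : Fin n)
    (hi : ∀ t, e t ≠ i) (hj : ∀ t, e t ≠ j) :
    (fun t => x (Equiv.swap i j (e t))) = fun t => x (e t) := by
  funext t
  rw [Equiv.swap_apply_of_ne_of_ne (hi t) (hj t)]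

variable {K W : Type*} [Field K] [AddCommGroup W] [Module K W]

/-- `Coch K W p` is the space `C^{p+1}(W; W) = Hom(∧^p W ⊗ W, W)`, of degree `p`:
`F x w` is the value of the cochain `F` at `(x₁, …, x_p, w)`. -/
abbrev Coch (K W : Type*) [Field K] [AddCommGroup W] [Module K W] (p : ℕ) : Type _ :=
  W [⋀^Fin p]→ₗ[K] (W →ₗ[K] W)

theorem insertLeft_linear {p q n : ℕ} (h : q + 1 + p = n) (P : Coch K W (p + 1))
    (Q : Coch K W q) [DecidableEq (Fin n)] (x : Fin n → W) (i : Fin n) :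
    ∃ T : W →ₗ[K] (W →ₗ[K] W), ∀ v : W,
      P (Fin.cons (Q (fun t : Fin q => Function.update x i v ⟨t, by omega⟩)
          (Function.update x i v ⟨q, by omega⟩))
        fun t : Fin p => Function.update x i v ⟨q + 1 + t, by omega⟩) = T v := by
  subst h
  let e₁ : Fin q → Fin (q + 1 + p) := fun t => ⟨t, by omega⟩
  let e₂ : Fin (q + 1 + p) := ⟨q, by omega⟩
  let e₃ : Fin p → Fin (q + 1 + p) := fun t => ⟨q + 1 + t, by omega⟩
  have he₁ : Function.Injective e₁ := fun a b hab => by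
    simpa [e₁, Fin.ext_iff] using hab
  have he₃ : Function.Injective e₃ := fun a b hab => by
    simpa [e₃, Fin.ext_iff] using hab
  let C : (Fin p → W) → (W →ₗ[K] (W →ₗ[K] W)) := fun r =>
    P.toMultilinearMap.toLinearMap (Fin.cons 0 r) 0
  have hC : ∀ r v, P (Fin.cons v r) = C r v := by
    intro r v
    simp [C]
  by_cases h1 : (i : ℕ) < q
  · obtain ⟨a, rfl⟩ : ∃ a, i = e₁ a := ⟨⟨i, h1⟩, rfl⟩
    refine ⟨C (fun t => x (e₃ t)) ∘ₗ LinearMap.applyₗ (x e₂) ∘ₗ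
      Q.toMultilinearMap.toLinearMap (fun t => x (e₁ t)) a, fun v => ?_⟩
    have k1 := update_comp_same x e₁ he₁ a v
    have k2 : Function.update x (e₁ a) v e₂ = x e₂ :=
      Function.update_of_ne (by simp [e₁, e₂, Fin.ext_iff]; omega) _ _
    have k3 := update_comp_other x e₃ (e₁ a) (by intro t; simp [e₁, e₃, Fin.ext_iff]; omega) v
    change P (Fin.cons (Q (fun t => Function.update x _ v (e₁ t)) (Function.update x _ v e₂))
      fun t => Function.update x _ v (e₃ t)) = _
    rw [k1, k2, k3, hC]
    rfl
  · by_cases h2 : (i : ℕ) = q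
    · obtain rfl : i = e₂ := Fin.ext h2
      refine ⟨C (fun t => x (e₃ t)) ∘ₗ Q (fun t => x (e₁ t)), fun v => ?_⟩
      have k1 := update_comp_other x e₁ e₂ (by intro t; simp [e₁, e₂, Fin.ext_iff]; omega) v
      have k3 := update_comp_other x e₃ e₂ (by intro t; simp [e₂, e₃, Fin.ext_iff]; omega) v
      change P (Fin.cons (Q (fun t => Function.update x _ v (e₁ t)) (Function.update x _ v e₂))
        fun t => Function.update x _ v (e₃ t)) = _
      rw [k1, k3, hC, Function.update_self]
      rfl
    · obtain ⟨a, rfl⟩ : ∃ a, i = e₃ a :=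
        ⟨⟨i - (q + 1), by omega⟩, by simp only [e₃, Fin.ext_iff]; omega⟩
      refine ⟨P.toMultilinearMap.toLinearMap
        (Fin.cons (Q (fun t => x (e₁ t)) (x e₂)) fun t => x (e₃ t)) a.succ, fun v => ?_⟩
      have k1 := update_comp_other x e₁ (e₃ a) (by intro t; simp [e₁, e₃, Fin.ext_iff]; omega) v
      have k2 : Function.update x (e₃ a) v e₂ = x e₂ :=
        Function.update_of_ne (by simp [e₃, e₂, Fin.ext_iff]; omega) _ _
      have k3 := update_comp_same x e₃ he₃ a v
      change P (Fin.cons (Q (fun t => Function.update x _ v (e₁ t)) (Function.update x _ v e₂))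
        fun t => Function.update x _ v (e₃ t)) = _
      rw [k1, k2, k3, Fin.cons_update]
      rfl

/-- For `P` of degree `p + 1` and `Q` of degree `q`, the (not yet antisymmetrized) insertion
`(x₁, …, xₙ, w) ↦ P (Q (x₁, …, x_q, x_{q+1}), x_{q+2}, …, xₙ, w)`, where `n = q + 1 + p`. -/
def insertLeft {p q n : ℕ} (h : q + 1 + p = n) (P : Coch K W (p + 1)) (Q : Coch K W q) :
    MultilinearMap K (fun _ : Fin n => W) ((W →ₗ[K] W)) where
  toFun x := P (Fin.cons (Q (fun i : Fin q => x ⟨i, by omega⟩) (x ⟨q, by omega⟩))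
    fun j : Fin p => x ⟨q + 1 + j, by omega⟩)
  map_update_add' := by
    intro _ x i v v'
    obtain ⟨T, hT⟩ := insertLeft_linear h P Q x i
    simp only [hT, map_add]
  map_update_smul' := by
    intro _ x i c v
    obtain ⟨T, hT⟩ := insertLeft_linear h P Q x i
    simp only [hT, map_smul]

theorem insertRight_linear {p q n : ℕ} (h : p + q = n) (P : Coch K W p) (Q : Coch K W q)
    [DecidableEq (Fin n)] (x : Fin n → W) (i : Fin n) :
    ∃ T : W →ₗ[K] (W →ₗ[K] W), ∀ v : W,
      P (fun t : Fin p => Function.update x i v ⟨t, by omega⟩) ∘ₗ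
        Q (fun t : Fin q => Function.update x i v ⟨p + t, by omega⟩) = T v := by
  subst h
  let e₁ : Fin p → Fin (p + q) := fun t => ⟨t, by omega⟩
  let e₂ : Fin q → Fin (p + q) := fun t => ⟨p + t, by omega⟩
  have he₁ : Function.Injective e₁ := fun a b hab => by
    simpa [e₁, Fin.ext_iff] using hab
  have he₂ : Function.Injective e₂ := fun a b hab => by
    simpa [e₂, Fin.ext_iff] using hab
  by_cases h1 : (i : ℕ) < p
  · obtain ⟨a, rfl⟩ : ∃ a, i = e₁ a := ⟨⟨i, h1⟩, rfl⟩
    refine ⟨LinearMap.lcomp K W (Q fun t => x (e₂ t)) ∘ₗ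
      P.toMultilinearMap.toLinearMap (fun t => x (e₁ t)) a, fun v => ?_⟩
    have k1 := update_comp_same x e₁ he₁ a v
    have k2 := update_comp_other x e₂ (e₁ a) (by intro t; simp [e₁, e₂, Fin.ext_iff]; omega) v
    change P (fun t => Function.update x _ v (e₁ t)) ∘ₗ
      Q (fun t => Function.update x _ v (e₂ t)) = _
    rw [k1, k2]
    rfl
  · obtain ⟨a, rfl⟩ : ∃ a, i = e₂ a :=
      ⟨⟨i - p, by omega⟩, by simp only [e₂, Fin.ext_iff]; omega⟩
    refine ⟨LinearMap.llcomp K W W W (P fun t => x (e₁ t)) ∘ₗ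
      Q.toMultilinearMap.toLinearMap (fun t => x (e₂ t)) a, fun v => ?_⟩
    have k1 := update_comp_other x e₁ (e₂ a) (by intro t; simp [e₁, e₂, Fin.ext_iff]; omega) v
    have k2 := update_comp_same x e₂ he₂ a v
    change P (fun t => Function.update x _ v (e₁ t)) ∘ₗ
      Q (fun t => Function.update x _ v (e₂ t)) = _
    rw [k1, k2]
    rfl

/-- For `P` of degree `p` and `Q` of degree `q`, the (not yet antisymmetrized) insertion
`(x₁, …, xₙ, w) ↦ P (x₁, …, x_p, Q (x_{p+1}, …, xₙ, w))`, where `n = p + q`. -/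
def insertRight {p q n : ℕ} (h : p + q = n) (P : Coch K W p) (Q : Coch K W q) :
    MultilinearMap K (fun _ : Fin n => W) ((W →ₗ[K] W)) where
  toFun x := P (fun i : Fin p => x ⟨i, by omega⟩) ∘ₗ Q (fun j : Fin q => x ⟨p + j, by omega⟩)
  map_update_add' := by
    intro _ x i v v'
    obtain ⟨T, hT⟩ := insertRight_linear h P Q x i
    simp only [hT, map_add]
  map_update_smul' := by
    intro _ x i c v
    obtain ⟨T, hT⟩ := insertRight_linear h P Q x i
    simp only [hT, map_smul]

theorem insertLeft_swap {p q n : ℕ} (h : q + 1 + p = n) (P : Coch K W (p + 1)) (Q : Coch K W q)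
    (x : Fin n → W) (i j : Fin n) (hij : i ≠ j) (hb : blocks₃ n q i = blocks₃ n q j) :
    insertLeft h P Q (x ∘ Equiv.swap i j) = -insertLeft h P Q x := by
  subst h
  let e₁ : Fin q → Fin (q + 1 + p) := fun t => ⟨t, by omega⟩
  let e₂ : Fin (q + 1 + p) := ⟨q, by omega⟩
  let e₃ : Fin p → Fin (q + 1 + p) := fun t => ⟨q + 1 + t, by omega⟩
  have he₁ : Function.Injective e₁ := fun a b hab => by
    simpa [e₁, Fin.ext_iff] using hab
  have he₃ : Function.Injective e₃ := fun a b hab => by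
    simpa [e₃, Fin.ext_iff] using hab
  have hij' : (i : ℕ) ≠ j := fun k => hij (Fin.ext k)
  change P (Fin.cons (Q (fun t => x (Equiv.swap i j (e₁ t))) (x (Equiv.swap i j e₂)))
      fun t => x (Equiv.swap i j (e₃ t))) =
    -P (Fin.cons (Q (fun t => x (e₁ t)) (x e₂)) fun t => x (e₃ t))
  have hcase : ((i : ℕ) < q ∧ (j : ℕ) < q) ∨ (q < (i : ℕ) ∧ q < (j : ℕ)) := by
    unfold blocks₃ at hb
    split_ifs at hb <;> omega
  rcases hcase with ⟨hi, hj⟩ | ⟨hi, hj⟩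
  · obtain ⟨a, hi'⟩ : ∃ a, i = e₁ a := ⟨⟨i, hi⟩, rfl⟩
    obtain ⟨b, hj'⟩ : ∃ a, j = e₁ a := ⟨⟨j, hj⟩, rfl⟩
    have hab : a ≠ b := fun k => hij (by rw [hi', hj', k])
    rw [hi', hj']
    rw [swap_comp_same x e₁ he₁ a b,
      swap_comp_other x e₃ _ _ (by intro t; simp [e₁, e₃, Fin.ext_iff]; omega)
        (by intro t; simp [e₁, e₃, Fin.ext_iff]; omega),
      Equiv.swap_apply_of_ne_of_ne (a := e₁ a) (b := e₁ b) (x := e₂)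
        (by simp [e₁, e₂, Fin.ext_iff]; omega) (by simp [e₁, e₂, Fin.ext_iff]; omega),
      Q.map_swap _ hab]
    have := P.toMultilinearMap.map_update_smul
      (Fin.cons (Q (fun t => x (e₁ t)) (x e₂)) fun t => x (e₃ t)) 0 (-1 : K)
      (Q (fun t => x (e₁ t)) (x e₂))
    simpa using this
  · obtain ⟨a, hi'⟩ : ∃ a, i = e₃ a :=
      ⟨⟨i - (q + 1), by omega⟩, by simp only [e₃, Fin.ext_iff]; omega⟩
    obtain ⟨b, hj'⟩ : ∃ a, j = e₃ a :=
      ⟨⟨j - (q + 1), by omega⟩, by simp only [e₃, Fin.ext_iff]; omega⟩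
    have hab : a ≠ b := fun k => hij (by rw [hi', hj', k])
    rw [hi', hj']
    rw [swap_comp_same x e₃ he₃ a b,
      swap_comp_other x e₁ _ _ (by intro t; simp [e₁, e₃, Fin.ext_iff]; omega)
        (by intro t; simp [e₁, e₃, Fin.ext_iff]; omega),
      Equiv.swap_apply_of_ne_of_ne (a := e₃ a) (b := e₃ b) (x := e₂)
        (by simp [e₃, e₂, Fin.ext_iff]; omega) (by simp [e₃, e₂, Fin.ext_iff]; omega),
      ← P.map_swap _ (i := a.succ) (j := b.succ) (by simpa using hab)]
    congr 1
    funext t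
    refine Fin.cases ?_ (fun t => ?_) t
    · rw [Function.comp_apply, Equiv.swap_apply_of_ne_of_ne (Fin.succ_ne_zero _).symm
        (Fin.succ_ne_zero _).symm]
      rfl
    · simp only [Fin.cons_succ, Function.comp_apply, Equiv.swap_apply_def,
        Fin.succ_inj]
      split_ifs <;> rfl

theorem insertRight_swap {p q n : ℕ} (h : p + q = n) (P : Coch K W p) (Q : Coch K W q)
    (x : Fin n → W) (i j : Fin n) (hij : i ≠ j) (hb : blocks₂ n p i = blocks₂ n p j) :
    insertRight h P Q (x ∘ Equiv.swap i j) = -insertRight h P Q x := by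
  subst h
  let e₁ : Fin p → Fin (p + q) := fun t => ⟨t, by omega⟩
  let e₂ : Fin q → Fin (p + q) := fun t => ⟨p + t, by omega⟩
  have he₁ : Function.Injective e₁ := fun a b hab => by
    simpa [e₁, Fin.ext_iff] using hab
  have he₂ : Function.Injective e₂ := fun a b hab => by
    simpa [e₂, Fin.ext_iff] using hab
  change P (fun t => x (Equiv.swap i j (e₁ t))) ∘ₗ Q (fun t => x (Equiv.swap i j (e₂ t))) =
    -(P (fun t => x (e₁ t)) ∘ₗ Q (fun t => x (e₂ t)))
  have hcase : ((i : ℕ) < p ∧ (j : ℕ) < p) ∨ (p ≤ (i : ℕ) ∧ p ≤ (j : ℕ)) := by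
    unfold blocks₂ at hb
    split_ifs at hb <;> omega
  rcases hcase with ⟨hi, hj⟩ | ⟨hi, hj⟩
  · obtain ⟨a, hi'⟩ : ∃ a, i = e₁ a := ⟨⟨i, hi⟩, rfl⟩
    obtain ⟨b, hj'⟩ : ∃ a, j = e₁ a := ⟨⟨j, hj⟩, rfl⟩
    have hab : a ≠ b := fun k => hij (by rw [hi', hj', k])
    rw [hi', hj']
    rw [swap_comp_same x e₁ he₁ a b,
      swap_comp_other x e₂ _ _ (by intro t; simp [e₁, e₂, Fin.ext_iff]; omega)
        (by intro t; simp [e₁, e₂, Fin.ext_iff]; omega),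
      P.map_swap _ hab, LinearMap.neg_comp]
  · obtain ⟨a, hi'⟩ : ∃ a, i = e₂ a :=
      ⟨⟨i - p, by omega⟩, by simp only [e₂, Fin.ext_iff]; omega⟩
    obtain ⟨b, hj'⟩ : ∃ a, j = e₂ a :=
      ⟨⟨j - p, by omega⟩, by simp only [e₂, Fin.ext_iff]; omega⟩
    have hab : a ≠ b := fun k => hij (by rw [hi', hj', k])
    rw [hi', hj']
    rw [swap_comp_same x e₂ he₂ a b,
      swap_comp_other x e₁ _ _ (by intro t; simp [e₁, e₂, Fin.ext_iff]; omega)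
        (by intro t; simp [e₁, e₂, Fin.ext_iff]; omega),
      Q.map_swap _ hab, LinearMap.comp_neg]


/-- For linear maps `e`, `r` of `W`, the map `A ↦ r ∘ A ∘ e` of endomorphisms of `W`. -/
def conjEnd (e r : W →ₗ[K] W) : (W →ₗ[K] W) →ₗ[K] (W →ₗ[K] W) where
  toFun A := r ∘ₗ A ∘ₗ e
  map_add' _ _ := LinearMap.ext fun _ => map_add r _ _
  map_smul' _ _ := LinearMap.ext fun _ => map_smul r _ _

/-- For linear maps `e`, `r` of `W`, the map of cochains sending `F` to
`(x₁, …, x_p, w) ↦ r (F (e x₁, …, e x_p, e w))`. -/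
def conjCoch (e r : W →ₗ[K] W) (p : ℕ) : Coch K W p →ₗ[K] Coch K W p where
  toFun F := ((conjEnd e r).compAlternatingMap F).compLinearMap e
  map_add' _ _ := AlternatingMap.ext fun _ => map_add (conjEnd e r) _ _
  map_smul' _ _ := AlternatingMap.ext fun _ => map_smul (conjEnd e r) _ _

theorem conjCoch_apply (e r : W →ₗ[K] W) (p : ℕ) (F : Coch K W p) (x : Fin p → W) (w : W) :
    conjCoch e r p F x w = r (F (fun i => e (x i)) (e w)) := rfl

/-- The component of degree `p` of `L`: a copy of `Coch K W p`. -/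
def CochComp (K W : Type*) [Field K] [AddCommGroup W] [Module K W] (p : ℕ) : Type _ :=
  Coch K W p

instance cochCompAddCommGroup (p : ℕ) : AddCommGroup (CochComp K W p) :=
  inferInstanceAs (AddCommGroup (Coch K W p))

instance cochCompModule (p : ℕ) : Module K (CochComp K W p) :=
  inferInstanceAs (Module K (Coch K W p))

variable (K W) in
/-- The identity map from `Coch K W p` to its copy. -/
def toComp (p : ℕ) : Coch K W p ≃ₗ[K] CochComp K W p where
  toFun F := F
  invFun F := F
  map_add' _ _ := rfl
  map_smul' _ _ := rfl
  left_inv _ := rfl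
  right_inv _ := rfl

/-- The graded vector space `L = C^*(W; W) = ⊕_{n ≥ 1} C^n(W; W)`, an element of `C^{p+1}(W; W)`
having degree `p`. -/
abbrev CochSum (K W : Type*) [Field K] [AddCommGroup W] [Module K W] : Type _ :=
  ⨁ p : ℕ, CochComp K W p

/-- The inclusion of the cochains of degree `p` into `L`. -/
def inc (p : ℕ) : Coch K W p →ₗ[K] CochSum K W :=
  DirectSum.lof K ℕ (CochComp K W) p ∘ₗ (toComp K W p).toLinearMap

/-- The component of degree `p` of an element of `L`. -/
def coeff (p : ℕ) : CochSum K W →ₗ[K] Coch K W p :=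
  (toComp K W p).symm.toLinearMap ∘ₗ DirectSum.component K ℕ (CochComp K W) p

/-- The linear map on `L` with given restrictions to the components of `L`. -/
def liftSum {N : Type*} [AddCommGroup N] [Module K N] (φ : ∀ p : ℕ, Coch K W p →ₗ[K] N) :
    CochSum K W →ₗ[K] N :=
  DirectSum.toModule K ℕ N fun p => φ p ∘ₗ (toComp K W p).symm.toLinearMap

theorem liftSum_inc {N : Type*} [AddCommGroup N] [Module K N]
    (φ : ∀ p : ℕ, Coch K W p →ₗ[K] N) (p : ℕ) (F : Coch K W p) :
    liftSum φ (inc p F) = φ p F := by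
  unfold liftSum inc
  rw [LinearMap.comp_apply, DirectSum.toModule_lof]
  rfl

theorem coeff_inc_same (p : ℕ) (F : Coch K W p) : coeff p (inc p F) = F := by
  unfold coeff inc
  rw [LinearMap.comp_apply, LinearMap.comp_apply, DirectSum.component.lof_self]
  rfl

theorem coeff_inc_of_ne {p q : ℕ} (h : p ≠ q) (F : Coch K W p) : coeff q (inc p F) = 0 := by
  unfold coeff inc
  rw [LinearMap.comp_apply, LinearMap.comp_apply, DirectSum.component.of, dif_neg h]
  rfl

theorem sum_inc_coeff (F : CochSum K W) :
    ∃ s : Finset ℕ, F = ∑ p ∈ s, inc p (coeff p F) := by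
  classical
  exact ⟨_, (DirectSum.sum_support_of F).symm⟩

variable [CharZero K]

/-- The first sum of the composition `P ∘ Q` of cochains of degrees `p` and `q`:
`∑_{σ ∈ S(q, 1, p - 1)} sgn(σ) P (Q (x_{σ(1)}, …, x_{σ(q)}, x_{σ(q+1)}), x_{σ(q+2)}, …, w)`.
For `p = 0` there are no such unshuffles and the sum is empty. -/
def compLeft : {p q n : ℕ} → (h : p + q = n) → (P : Coch K W p) → (Q : Coch K W q) → Coch K W n
  | 0, _, _, _, _, _ => 0
  | p + 1, q, n, h, P, Q =>
    unshuffleSum (blocks₃ n q) (insertLeft (by omega) P Q) (insertLeft_swap (by omega) P Q)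

/-- The second sum of the composition `P ∘ Q`, without its sign `(-1)^{pq}`:
`∑_{σ ∈ S(p, q)} sgn(σ) P (x_{σ(1)}, …, x_{σ(p)}, Q (x_{σ(p+1)}, …, x_{σ(p+q)}, w))`. -/
def compRight {p q n : ℕ} (h : p + q = n) (P : Coch K W p) (Q : Coch K W q) : Coch K W n :=
  unshuffleSum (blocks₂ n p) (insertRight h P Q) (insertRight_swap h P Q)

/-- The composition `P ∘ Q` of cochains of degrees `p` and `q`; its degree is `n = p + q`. -/
def comp {p q n : ℕ} (h : p + q = n) (P : Coch K W p) (Q : Coch K W q) : Coch K W n :=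
  compLeft h P Q + (-1 : ℤ) ^ (p * q) • compRight h P Q

/-- The Matsushima–Nijenhuis bracket `[P, Q] = P ∘ Q - (-1)^{pq} Q ∘ P` of cochains of degrees
`p` and `q`. -/
def mnBracket {p q n : ℕ} (h : p + q = n) (P : Coch K W p) (Q : Coch K W q) : Coch K W n :=
  comp h P Q - (-1 : ℤ) ^ (p * q) • comp ((Nat.add_comm q p).trans h) Q P

theorem compLeft_apply {p q n : ℕ} (h : p + 1 + q = n) (P : Coch K W (p + 1)) (Q : Coch K W q)
    (x : Fin n → W) :
    compLeft h P Q x = ∑ σ ∈ unshuffles (blocks₃ n q), Equiv.Perm.sign σ •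
      P (Fin.cons (Q (fun i : Fin q => x (σ ⟨i, by omega⟩)) (x (σ ⟨q, by omega⟩)))
        fun j : Fin p => x (σ ⟨q + 1 + j, by omega⟩)) :=
  unshuffleSum_apply (blocks₃ n q) (insertLeft (by omega) P Q) (insertLeft_swap (by omega) P Q) x

theorem compRight_apply {p q n : ℕ} (h : p + q = n) (P : Coch K W p) (Q : Coch K W q)
    (x : Fin n → W) :
    compRight h P Q x = ∑ σ ∈ unshuffles (blocks₂ n p), Equiv.Perm.sign σ •
      (P (fun i : Fin p => x (σ ⟨i, by omega⟩)) ∘ₗ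
        Q (fun j : Fin q => x (σ ⟨p + j, by omega⟩))) :=
  unshuffleSum_apply _ _ _ _

theorem compLeft_linear {p q n : ℕ} (h : p + q = n) :
    (∀ (P P' : Coch K W p) (Q : Coch K W q),
      compLeft h (P + P') Q = compLeft h P Q + compLeft h P' Q) ∧
    (∀ (c : K) (P : Coch K W p) (Q : Coch K W q), compLeft h (c • P) Q = c • compLeft h P Q) ∧
    (∀ (P : Coch K W p) (Q Q' : Coch K W q),
      compLeft h P (Q + Q') = compLeft h P Q + compLeft h P Q') ∧
    (∀ (c : K) (P : Coch K W p) (Q : Coch K W q), compLeft h P (c • Q) = c • compLeft h P Q) := by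
  cases p with
  | zero => simp [compLeft]
  | succ p =>
    refine ⟨fun P P' Q => ?_, fun c P Q => ?_, fun P Q Q' => ?_, fun c P Q => ?_⟩ <;>
      refine AlternatingMap.ext fun x => ?_
    · simp only [compLeft_apply, AlternatingMap.add_apply, smul_add, Finset.sum_add_distrib]
    · simp only [compLeft_apply, AlternatingMap.smul_apply, Finset.smul_sum, smul_comm c]
    · simp only [compLeft_apply, AlternatingMap.add_apply, LinearMap.add_apply,
        ← smul_add, ← Finset.sum_add_distrib]
      refine Finset.sum_congr rfl fun σ _ => congrArg _ ?_
      exact P.toMultilinearMap.cons_add _ _ _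
    · simp only [compLeft_apply, AlternatingMap.smul_apply, LinearMap.smul_apply,
        Finset.smul_sum, smul_comm c]
      refine Finset.sum_congr rfl fun σ _ => congrArg _ ?_
      exact P.toMultilinearMap.cons_smul _ _ _

theorem compRight_linear {p q n : ℕ} (h : p + q = n) :
    (∀ (P P' : Coch K W p) (Q : Coch K W q),
      compRight h (P + P') Q = compRight h P Q + compRight h P' Q) ∧
    (∀ (c : K) (P : Coch K W p) (Q : Coch K W q), compRight h (c • P) Q = c • compRight h P Q) ∧
    (∀ (P : Coch K W p) (Q Q' : Coch K W q),
      compRight h P (Q + Q') = compRight h P Q + compRight h P Q') ∧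
    (∀ (c : K) (P : Coch K W p) (Q : Coch K W q), compRight h P (c • Q) = c • compRight h P Q) := by
  refine ⟨fun P P' Q => ?_, fun c P Q => ?_, fun P Q Q' => ?_, fun c P Q => ?_⟩ <;>
    refine AlternatingMap.ext fun x => ?_
  · simp only [compRight_apply, AlternatingMap.add_apply, LinearMap.add_comp, smul_add,
      Finset.sum_add_distrib]
  · simp only [compRight_apply, AlternatingMap.smul_apply, LinearMap.smul_comp, Finset.smul_sum,
      smul_comm c]
  · simp only [compRight_apply, AlternatingMap.add_apply, LinearMap.comp_add, smul_add,
      Finset.sum_add_distrib]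
  · simp only [compRight_apply, AlternatingMap.smul_apply, LinearMap.comp_smul, Finset.smul_sum,
      smul_comm c]

/-- The Matsushima–Nijenhuis bracket as a bilinear map. -/
def mnBracketₗ (p q : ℕ) : Coch K W p →ₗ[K] Coch K W q →ₗ[K] Coch K W (p + q) :=
  LinearMap.mk₂ K (mnBracket (rfl : p + q = p + q))
    (by
      intro P P' Q
      simp only [mnBracket, comp, (compLeft_linear _).1, (compLeft_linear _).2.2.1,
        (compRight_linear _).1, (compRight_linear _).2.2.1, smul_add]
      abel)
    (by
      intro c P Q
      simp only [mnBracket, comp, (compLeft_linear _).2.1, (compLeft_linear _).2.2.2,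
        (compRight_linear _).2.1, (compRight_linear _).2.2.2, smul_add, smul_sub, smul_comm c])
    (by
      intro P Q Q'
      simp only [mnBracket, comp, (compLeft_linear _).1, (compLeft_linear _).2.2.1,
        (compRight_linear _).1, (compRight_linear _).2.2.1, smul_add]
      abel)
    (by
      intro c P Q
      simp only [mnBracket, comp, (compLeft_linear _).2.1, (compLeft_linear _).2.2.2,
        (compRight_linear _).2.1, (compRight_linear _).2.2.2, smul_add, smul_sub, smul_comm c])

/-- The bilinear map `L × L → L` which sends homogeneous elements `f`, `g` of degrees `p`, `q` to
`s p q • [f, g]`. For `s = 1` it is the Matsushima–Nijenhuis bracket of `L`. -/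
def signedBracket (s : ℕ → ℕ → ℤ) : CochSum K W →ₗ[K] CochSum K W →ₗ[K] CochSum K W :=
  liftSum fun p => (liftSum fun q => s p q • ((mnBracketₗ p q).compr₂ (inc (p + q))).flip).flip

theorem signedBracket_inc (s : ℕ → ℕ → ℤ) (p q : ℕ) (f : Coch K W p) (g : Coch K W q) :
    signedBracket s (inc p f) (inc q g) = s p q • inc (p + q) (mnBracket rfl f g) := by
  unfold signedBracket
  rw [liftSum_inc, LinearMap.flip_apply, liftSum_inc]
  rfl

end Bracket

/-! ### Bidegrees, and the graded spaces `L'` and `h` -/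

section Bidegree

variable {K g V : Type*} [Field K] [AddCommGroup g] [Module K g] [AddCommGroup V] [Module K V]

variable (K g V) in
/-- The part of `W = g ⊕ V` containing `d` factors from `V`: it is `g` for `d = 0`, `V` for
`d = 1`, and zero for all other `d`. -/
def part (d : ℤ) : Submodule K (g × V) :=
  if d = 0 then LinearMap.ker (LinearMap.snd K g V) else if d = 1 then LinearMap.ker (LinearMap.fst K g V) else ⊥

variable (K g V) in
/-- The space `C^{p-l|l}(g ⊕ V, g ⊕ V)` of cochains of degree `p` and bidegree `p-l|l`: a value
of the cochain on arguments taken from `g` and from `V`, exactly `m` of them from `V`, lies in `g`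
if `m = l`, lies in `V` if `m = l + 1`, and is zero otherwise. -/
def bidegree (p : ℕ) (l : ℤ) : Submodule K (Coch K (g × V) p) where
  carrier := {F | ∀ (d : Fin p → ℤ) (e : ℤ) (x : Fin p → g × V) (w : g × V),
    (∀ i, x i ∈ part K g V (d i)) → w ∈ part K g V e →
      F x w ∈ part K g V ((∑ i, d i) + e - l)}
  add_mem' hF hG d e x w hx hw := add_mem (hF d e x w hx hw) (hG d e x w hx hw)
  zero_mem' _ _ _ _ _ _ := zero_mem _
  smul_mem' c _ hF d e x w hx hw := Submodule.smul_mem _ c (hF d e x w hx hw)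

variable (K g V) in
/-- The subspace `⊕_p C^{p-l|l}(g ⊕ V, g ⊕ V)` of `L`. -/
def totalBidegree (l : ℤ) : Submodule K (CochSum K (g × V)) where
  carrier := {F | ∀ p : ℕ, coeff p F ∈ bidegree K g V p l}
  add_mem' hF hG p := by rw [map_add]; exact add_mem (hF p) (hG p)
  zero_mem' p := by rw [map_zero]; exact zero_mem _
  smul_mem' c _ hF p := by rw [map_smul]; exact Submodule.smul_mem _ c (hF p)

variable (K g V) in
/-- `L' = ⊕_{n ≥ 0} C^{n|0}(g ⊕ V, g ⊕ V)`. -/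
abbrev LPrime : Submodule K (CochSum K (g × V)) := totalBidegree K g V 0

variable (K g V) in
/-- `h = ⊕_{n ≥ 0} C^{n|-1}(g ⊕ V, g ⊕ V)`. -/
abbrev HSub : Submodule K (CochSum K (g × V)) := totalBidegree K g V (-1)

theorem inc_mem_totalBidegree {l : ℤ} {p : ℕ} {F : Coch K (g × V) p}
    (hF : F ∈ bidegree K g V p l) : inc p F ∈ totalBidegree K g V l := by
  intro q
  by_cases h : p = q
  · subst h
    rw [coeff_inc_same]
    exact hF
  · rw [coeff_inc_of_ne h]
    exact zero_mem _

/-- On cochains of one degree, the projection onto `C^{n|-1}` along all other bidegrees: restrict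
the cochain to arguments from `g` and take the component in `V` of the values. -/
def projCoch (p : ℕ) : Coch K (g × V) p →ₗ[K] Coch K (g × V) p :=
  conjCoch (LinearMap.inl K g V ∘ₗ LinearMap.fst K g V)
    (LinearMap.inr K g V ∘ₗ LinearMap.snd K g V) p

theorem projCoch_apply (p : ℕ) (F : Coch K (g × V) p) (x : Fin p → g × V) (w : g × V) :
    projCoch p F x w = LinearMap.inr K g V (LinearMap.snd K g V
      (F (fun i => LinearMap.inl K g V (LinearMap.fst K g V (x i)))
        (LinearMap.inl K g V (LinearMap.fst K g V w)))) := rfl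

theorem fst_eq_zero_of_mem_part {d : ℤ} {y : g × V} (hy : y ∈ part K g V d) (hd : d ≠ 0) :
    LinearMap.fst K g V y = 0 := by
  unfold part at hy
  rw [if_neg hd] at hy
  split_ifs at hy
  · exact hy
  · rw [(Submodule.mem_bot K).1 hy, map_zero]

theorem projCoch_mem (p : ℕ) (F : Coch K (g × V) p) :
    projCoch p F ∈ bidegree K g V p (-1) := by
  intro d e x w hx hw
  rw [projCoch_apply]
  by_cases h : (∀ i, d i = 0) ∧ e = 0
  · simp [part, h.1, h.2]
  · have : F (fun i => LinearMap.inl K g V (LinearMap.fst K g V (x i))) (LinearMap.inl K g V (LinearMap.fst K g V w)) = 0 := by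
      by_cases he : e = 0
      · obtain ⟨i, hi⟩ : ∃ i, d i ≠ 0 := by
          by_contra hcon
          exact h ⟨fun i => by_contra fun hi => hcon ⟨i, hi⟩, he⟩
        rw [F.map_coord_zero i (by rw [fst_eq_zero_of_mem_part (hx i) hi, map_zero]),
          LinearMap.zero_apply]
      · rw [fst_eq_zero_of_mem_part hw he, map_zero, map_zero]
    rw [this, map_zero, map_zero]
    exact zero_mem _

variable (K g V) in
/-- The map `P : L → L` which is `projCoch p` on cochains of degree `p`. -/
def projSum : CochSum K (g × V) →ₗ[K] CochSum K (g × V) :=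
  liftSum fun p => inc p ∘ₗ projCoch p

theorem projSum_inc (p : ℕ) (F : Coch K (g × V) p) :
    projSum K g V (inc p F) = inc p (projCoch p F) :=
  liftSum_inc _ _ _

theorem projSum_mem (F : CochSum K (g × V)) : projSum K g V F ∈ HSub K g V := by
  obtain ⟨s, hs⟩ := sum_inc_coeff F
  rw [hs, map_sum]
  refine sum_mem fun p _ => ?_
  rw [projSum_inc]
  exact inc_mem_totalBidegree (projCoch_mem p _)

variable (K g V) in
/-- The projection `P : L → h`. -/
def projH : CochSum K (g × V) →ₗ[K] HSub K g V :=
  (projSum K g V).codRestrict (HSub K g V) projSum_mem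

theorem compLeft_mem_bidegree [CharZero K] {p q n : ℕ} (h : p + q = n) {l m : ℤ}
    {P : Coch K (g × V) p} {Q : Coch K (g × V) q} (hP : P ∈ bidegree K g V p l)
    (hQ : Q ∈ bidegree K g V q m) : compLeft h P Q ∈ bidegree K g V n (l + m) := by
  cases p with
  | zero => exact zero_mem _
  | succ p =>
    intro d e x w hx hw
    rw [compLeft_apply, LinearMap.sum_apply]
    refine sum_mem fun σ _ => ?_
    rw [← Equiv.sum_comp σ d]
    obtain rfl : n = q + 1 + p := by omega
    rw [Fin.sum_univ_add, Fin.sum_univ_castSucc]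
    rw [LinearMap.smul_apply]
    refine Submodule.smul_of_tower_mem _ (Equiv.Perm.sign σ) ?_
    have h1 := hQ (fun i : Fin q => d (σ (Fin.castAdd p i.castSucc)))
      (d (σ (Fin.castAdd p (Fin.last q)))) (fun i : Fin q => x (σ (Fin.castAdd p i.castSucc)))
      (x (σ (Fin.castAdd p (Fin.last q)))) (fun i => hx _) (hx _)
    have h2 := hP
      (Fin.cons ((∑ i : Fin q, d (σ (Fin.castAdd p i.castSucc))) +
        d (σ (Fin.castAdd p (Fin.last q))) - m) fun j : Fin p => d (σ (Fin.natAdd (q + 1) j))) e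
      (Fin.cons (Q (fun i : Fin q => x (σ (Fin.castAdd p i.castSucc)))
        (x (σ (Fin.castAdd p (Fin.last q))))) fun j : Fin p => x (σ (Fin.natAdd (q + 1) j))) w
      (fun i => by
        refine Fin.cases ?_ (fun j => ?_) i
        · simpa using h1
        · simpa using hx _) hw
    rw [Fin.sum_cons] at h2
    refine (congrArg (fun t : ℤ => _ ∈ part K g V t) ?_).mp h2
    ring

theorem compRight_mem_bidegree [CharZero K] {p q n : ℕ} (h : p + q = n) {l m : ℤ}
    {P : Coch K (g × V) p} {Q : Coch K (g × V) q} (hP : P ∈ bidegree K g V p l)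
    (hQ : Q ∈ bidegree K g V q m) : compRight h P Q ∈ bidegree K g V n (l + m) := by
  intro d e x w hx hw
  rw [compRight_apply, LinearMap.sum_apply]
  refine sum_mem fun σ _ => ?_
  rw [← Equiv.sum_comp σ d]
  subst h
  rw [Fin.sum_univ_add, LinearMap.smul_apply]
  refine Submodule.smul_of_tower_mem _ (Equiv.Perm.sign σ) ?_
  have h1 := hQ (fun i : Fin q => d (σ (Fin.natAdd p i))) e
    (fun i : Fin q => x (σ (Fin.natAdd p i))) w (fun i => hx _) hw
  have h2 := hP (fun i : Fin p => d (σ (Fin.castAdd q i))) _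
    (fun i : Fin p => x (σ (Fin.castAdd q i))) _ (fun i => hx _) h1
  refine (congrArg (fun t : ℤ => _ ∈ part K g V t) ?_).mp h2
  ring

theorem zsmul_mem_bidegree {p : ℕ} {l : ℤ} (z : ℤ) {F : Coch K (g × V) p}
    (hF : F ∈ bidegree K g V p l) : z • F ∈ bidegree K g V p l := by
  intro d e x w hx hw
  exact zsmul_mem (hF d e x w hx hw) z

/-- The bracket of cochains adds bidegrees. -/
theorem mnBracket_mem_bidegree [CharZero K] {p q n : ℕ} (h : p + q = n) {l m : ℤ}
    {P : Coch K (g × V) p} {Q : Coch K (g × V) q} (hP : P ∈ bidegree K g V p l)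
    (hQ : Q ∈ bidegree K g V q m) : mnBracket h P Q ∈ bidegree K g V n (l + m) := by
  have hc : ∀ {p q n : ℕ} (h : p + q = n) {l m : ℤ} {P : Coch K (g × V) p}
      {Q : Coch K (g × V) q}, P ∈ bidegree K g V p l → Q ∈ bidegree K g V q m →
      comp h P Q ∈ bidegree K g V n (l + m) := fun h _ _ _ _ hP hQ =>
    add_mem (compLeft_mem_bidegree h hP hQ) (zsmul_mem_bidegree _ (compRight_mem_bidegree h hP hQ))
  have h1 := hc h hP hQ
  have h2 := zsmul_mem_bidegree ((-1) ^ (p * q)) (hc ((Nat.add_comm q p).trans h) hQ hP)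
  rw [add_comm m l] at h2
  intro d e x w hx hw
  exact sub_mem (h1 d e x w hx hw) (h2 d e x w hx hw)

theorem signedBracket_mem [CharZero K] (s : ℕ → ℕ → ℤ) {l m : ℤ} {F G : CochSum K (g × V)}
    (hF : F ∈ totalBidegree K g V l) (hG : G ∈ totalBidegree K g V m) :
    signedBracket s F G ∈ totalBidegree K g V (l + m) := by
  obtain ⟨S, hS⟩ := sum_inc_coeff F
  obtain ⟨T, hT⟩ := sum_inc_coeff G
  rw [hS, hT, map_sum]
  refine sum_mem fun q _ => ?_
  rw [map_sum, LinearMap.sum_apply]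
  refine sum_mem fun p _ => ?_
  rw [signedBracket_inc]
  exact zsmul_mem (inc_mem_totalBidegree (mnBracket_mem_bidegree rfl (hF p) (hG q))) _

end Bidegree

/-! ### The controlling `L∞`-algebra -/

section Controlling

variable {K g V : Type*} [Field K] [AddCommGroup g] [Module K g] [AddCommGroup V] [Module K V]

/-- A bilinear map as a multilinear map of two arguments. -/
def bilinToMultilinear {E : Type*} [AddCommGroup E] [Module K E] (B : E →ₗ[K] E →ₗ[K] E) :
    MultilinearMap K (fun _ : Fin 2 => E) E :=
  LinearMap.uncurryLeft
    (((MultilinearMap.ofSubsingletonₗ K K E E (0 : Fin 1)).toLinearMap) ∘ₗ B)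

theorem bilinToMultilinear_apply {E : Type*} [AddCommGroup E] [Module K E]
    (B : E →ₗ[K] E →ₗ[K] E) (x : Fin 2 → E) : bilinToMultilinear B x = B (x 0) (x 1) := rfl

variable (K g V) in
/-- The underlying vector space of `s⁻¹L' ⊕ h`; the pair `(f, θ)` stands for `(s⁻¹ f, θ)`. -/
def Ctrl : Type _ := LPrime K g V × HSub K g V

instance ctrlAddCommGroup : AddCommGroup (Ctrl K g V) :=
  inferInstanceAs (AddCommGroup (LPrime K g V × HSub K g V))

instance ctrlModule : Module K (Ctrl K g V) :=
  inferInstanceAs (Module K (LPrime K g V × HSub K g V))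

/-- The component `f` of `(s⁻¹ f, θ)`, as an element of `L`. -/
def ctrlF : Ctrl K g V →ₗ[K] CochSum K (g × V) :=
  (LPrime K g V).subtype ∘ₗ LinearMap.fst K (LPrime K g V) (HSub K g V)

/-- The component `θ` of `(s⁻¹ f, θ)`, as an element of `L`. -/
def ctrlT : Ctrl K g V →ₗ[K] CochSum K (g × V) :=
  (HSub K g V).subtype ∘ₗ LinearMap.snd K (LPrime K g V) (HSub K g V)

theorem ctrlF_mem (a : Ctrl K g V) : ctrlF a ∈ LPrime K g V := a.1.2

theorem ctrlT_mem (a : Ctrl K g V) : ctrlT a ∈ HSub K g V := a.2.2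

/-- The element `(s⁻¹ f, θ)` of `s⁻¹L' ⊕ h`. -/
def ctrlMk (f : CochSum K (g × V)) (hf : f ∈ LPrime K g V) (θ : HSub K g V) : Ctrl K g V :=
  (⟨f, hf⟩, θ)

@[simp] theorem ctrlF_mk (f : CochSum K (g × V)) (hf : f ∈ LPrime K g V) (θ : HSub K g V) :
    ctrlF (ctrlMk f hf θ) = f := rfl

@[simp] theorem ctrlT_mk (f : CochSum K (g × V)) (hf : f ∈ LPrime K g V) (θ : HSub K g V) :
    ctrlT (ctrlMk f hf θ) = (θ : CochSum K (g × V)) := rfl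

theorem ctrlMk_congr {f f' : CochSum K (g × V)} {θ θ' : HSub K g V} (h : f = f')
    (hf : f ∈ LPrime K g V) (hf' : f' ∈ LPrime K g V) (hθ : θ = θ') :
    ctrlMk f hf θ = ctrlMk f' hf' θ' := by
  subst h hθ
  rfl

theorem ctrlMk_add (f f' : CochSum K (g × V)) (hf : f ∈ LPrime K g V) (hf' : f' ∈ LPrime K g V)
    (θ θ' : HSub K g V) : ctrlMk (f + f') (add_mem hf hf') (θ + θ') =
      ctrlMk f hf θ + ctrlMk f' hf' θ' := rfl

theorem ctrlMk_smul (c : K) (f : CochSum K (g × V)) (hf : f ∈ LPrime K g V) (θ : HSub K g V) :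
    ctrlMk (c • f) (Submodule.smul_mem _ c hf) (c • θ) = c • ctrlMk f hf θ := rfl

theorem ctrl_ext {a b : Ctrl K g V} (h₁ : ctrlF a = ctrlF b) (h₂ : ctrlT a = ctrlT b) : a = b :=
  Prod.ext (Subtype.ext h₁) (Subtype.ext h₂)

variable (K g V) in
/-- The grading of `s⁻¹L' ⊕ h`: the component of degree `i` is `(L')^{i+1} ⊕ h^i`. -/
def ctrlGrading (i : ℤ) : Submodule K (Ctrl K g V) where
  carrier := {a | (∀ p : ℕ, (p : ℤ) ≠ i + 1 → coeff p (ctrlF a) = 0) ∧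
    ∀ p : ℕ, (p : ℤ) ≠ i → coeff p (ctrlT a) = 0}
  add_mem' {a b} ha hb := by
    refine ⟨fun p hp => ?_, fun p hp => ?_⟩
    · rw [map_add, map_add, ha.1 p hp, hb.1 p hp, add_zero]
    · rw [map_add, map_add, ha.2 p hp, hb.2 p hp, add_zero]
  zero_mem' := ⟨fun _ _ => rfl, fun _ _ => rfl⟩
  smul_mem' c a ha := by
    refine ⟨fun p hp => ?_, fun p hp => ?_⟩
    · rw [map_smul, map_smul, ha.1 p hp, smul_zero]
    · rw [map_smul, map_smul, ha.2 p hp, smul_zero]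

/-- The cochain `π + ρ + μ` of degree `1` on `g ⊕ V`:
`(x + u, y + v) ↦ π(x, y) + ρ(x) v + μ(y) u`. -/
def strCoch (π : g →ₗ[K] g →ₗ[K] g) (ρ μ : g →ₗ[K] (V →ₗ[K] V)) : Coch K (g × V) 1 :=
  AlternatingMap.ofSubsingleton K (g × V) ((g × V) →ₗ[K] (g × V)) (0 : Fin 1)
    (LinearMap.mk₂ K (fun a b : g × V => (π a.1 b.1, ρ a.1 b.2 + μ b.1 a.2))
      (fun a a' b => by ext <;> simp; abel) (fun c a b => by ext <;> simp)
      (fun a b b' => by ext <;> simp; abel) (fun c a b => by ext <;> simp))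

theorem strCoch_apply (π : g →ₗ[K] g →ₗ[K] g) (ρ μ : g →ₗ[K] (V →ₗ[K] V)) (x : Fin 1 → g × V)
    (w : g × V) : strCoch π ρ μ x w =
      (π (x 0).1 w.1, ρ (x 0).1 w.2 + μ w.1 (x 0).2) := rfl

/-- The cochain of degree `0` on `g ⊕ V` given by `D : g → V`, that is, `x + u ↦ D x`. -/
def derCoch (D : g →ₗ[K] V) : Coch K (g × V) 0 :=
  AlternatingMap.constOfIsEmpty K (g × V) (Fin 0)
    (LinearMap.inr K g V ∘ₗ D ∘ₗ LinearMap.fst K g V)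

theorem derCoch_apply (D : g →ₗ[K] V) (x : Fin 0 → g × V) (w : g × V) :
    derCoch D x w = (0, D w.1) := rfl

theorem mem_part_iff {d : ℤ} {a : g × V} :
    a ∈ part K g V d ↔ (d ≠ 0 → a.1 = 0) ∧ (d ≠ 1 → a.2 = 0) := by
  unfold part
  split_ifs with h₀ h₁
  · subst h₀; simp
  · subst h₁; simp
  · simp [h₀, h₁, Prod.ext_iff]

theorem strCoch_mem (π : g →ₗ[K] g →ₗ[K] g) (ρ μ : g →ₗ[K] (V →ₗ[K] V)) :
    strCoch π ρ μ ∈ bidegree K g V 1 0 := by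
  intro d e x w hx hw
  have hx₀ := mem_part_iff.1 (hx 0)
  have hw₀ := mem_part_iff.1 hw
  rw [strCoch_apply, mem_part_iff, Fin.sum_univ_one]
  refine ⟨fun h => ?_, fun h => ?_⟩
  · change π (x 0).1 w.1 = 0
    by_cases h₁ : d 0 = 0
    · rw [hw₀.1 (by omega), map_zero]
    · rw [hx₀.1 h₁, map_zero, LinearMap.zero_apply]
  · change ρ (x 0).1 w.2 + μ w.1 (x 0).2 = 0
    have h₁ : ρ (x 0).1 w.2 = 0 := by
      by_cases h₁ : d 0 = 0
      · rw [hw₀.2 (by omega), map_zero]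
      · rw [hx₀.1 h₁, map_zero, LinearMap.zero_apply]
    have h₂ : μ w.1 (x 0).2 = 0 := by
      by_cases h₁ : d 0 = 1
      · rw [hw₀.1 (by omega), map_zero, LinearMap.zero_apply]
      · rw [hx₀.2 h₁, map_zero]
    rw [h₁, h₂, add_zero]

theorem derCoch_mem (D : g →ₗ[K] V) : derCoch D ∈ bidegree K g V 0 (-1) := by
  intro d e x w hx hw
  have hw₀ := mem_part_iff.1 hw
  rw [derCoch_apply, mem_part_iff, Fin.sum_univ_zero]
  refine ⟨fun _ => rfl, fun h => ?_⟩
  change D w.1 = 0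
  rw [hw₀.1 (by omega), map_zero]

/-- The element `(s⁻¹(π + ρ + μ), D)` of `s⁻¹L' ⊕ h`. -/
def strElement (π : g →ₗ[K] g →ₗ[K] g) (D : g →ₗ[K] V) (ρ μ : g →ₗ[K] (V →ₗ[K] V)) :
    Ctrl K g V :=
  ctrlMk (inc 1 (strCoch π ρ μ)) (inc_mem_totalBidegree (strCoch_mem π ρ μ))
    ⟨inc 0 (derCoch D), inc_mem_totalBidegree (derCoch_mem D)⟩

variable [CharZero K]

/-- The component in `L` (lying in `L'`) of `l₂ ((s⁻¹f₁, θ₁), (s⁻¹f₂, θ₂))`: it is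
`(-1)^{|f₁|} [f₁, f₂]` for homogeneous `f₁`. -/
def ctrlBilinF : Ctrl K g V →ₗ[K] Ctrl K g V →ₗ[K] CochSum K (g × V) :=
  (signedBracket fun p _ => (-1) ^ p).compl₁₂ ctrlF ctrlF

/-- The component in `h` of `l₂ ((s⁻¹f₁, θ₁), (s⁻¹f₂, θ₂))`: for homogeneous elements it is
`P [f₁, θ₂] + (-1)^{|θ₁| (|f₂| - 1)} P [f₂, θ₁]`, the second term being determined by graded
symmetry. (The exponent is written as `|θ₁| (|f₂| + 1)`, which has the same parity.) -/
def ctrlBilinT : Ctrl K g V →ₗ[K] Ctrl K g V →ₗ[K] HSub K g V :=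
  ((signedBracket fun _ _ => 1).compl₁₂ ctrlF ctrlT).compr₂ (projH K g V) +
    (((signedBracket fun p q => (-1) ^ (q * (p + 1))).compl₁₂ ctrlF ctrlT).compr₂
      (projH K g V)).flip

theorem ctrlBilinF_mem (a b : Ctrl K g V) : ctrlBilinF a b ∈ LPrime K g V := by
  have := signedBracket_mem (fun p _ => (-1) ^ p) (ctrlF_mem a) (ctrlF_mem b)
  rw [add_zero] at this
  exact this

/-- The bilinear map `l₂` of `s⁻¹L' ⊕ h`, given on homogeneous elements by
`l₂ (s⁻¹f, s⁻¹g) = (-1)^{|f|} s⁻¹[f, g]`, `l₂ (s⁻¹f, θ) = P [f, θ]`,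
`l₂ (θ, s⁻¹f) = (-1)^{|θ| (|f| - 1)} l₂ (s⁻¹f, θ)` and `l₂ (θ, θ') = 0`. -/
def ctrlBilin : Ctrl K g V →ₗ[K] Ctrl K g V →ₗ[K] Ctrl K g V :=
  LinearMap.mk₂ K
    (fun a b => ctrlMk (ctrlBilinF a b) (ctrlBilinF_mem a b) (ctrlBilinT a b))
    (fun a a' b => (ctrlMk_congr (LinearMap.map_add₂ ctrlBilinF a a' b) _
      (add_mem (ctrlBilinF_mem a b) (ctrlBilinF_mem a' b))
      (LinearMap.map_add₂ ctrlBilinT a a' b)).trans (ctrlMk_add _ _ _ _ _ _))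
    (fun c a b => (ctrlMk_congr (LinearMap.map_smul₂ ctrlBilinF c a b) _
      (Submodule.smul_mem _ c (ctrlBilinF_mem a b))
      (LinearMap.map_smul₂ ctrlBilinT c a b)).trans (ctrlMk_smul _ _ _ _))
    (fun a b b' => (ctrlMk_congr (map_add (ctrlBilinF a) b b') _
      (add_mem (ctrlBilinF_mem a b) (ctrlBilinF_mem a b'))
      (map_add (ctrlBilinT a) b b')).trans (ctrlMk_add _ _ _ _ _ _))
    (fun c a b => (ctrlMk_congr (map_smul (ctrlBilinF a) c b) _
      (Submodule.smul_mem _ c (ctrlBilinF_mem a b))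
      (map_smul (ctrlBilinT a) c b)).trans (ctrlMk_smul _ _ _ _))

variable (K g V) in
/-- The brackets `l_k` of `s⁻¹L' ⊕ h`: only `l₂` is nonzero. -/
def ctrlBracket : (k : ℕ) → MultilinearMap K (fun _ : Fin k => Ctrl K g V) (Ctrl K g V)
  | 2 => bilinToMultilinear ctrlBilin
  | _ => 0

end Controlling

end PreLieDer

/-!
The proof has two parts, the second resting on the first.

*The Matsushima–Nijenhuis bracket satisfies the graded Jacobi identity.* It is the commutator of the
composition `P ∘ Q`, so it is enough that the composition is a graded pre-Lie product. To avoid sums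
over unshuffles and degree bookkeeping, a cochain is replaced by a function of lists of vectors
(`hat`) with values in the endomorphisms of `W`. On such forms `P ∘ Q` is
`ins (antisymm Q) P ± wedge P Q`: the first sum of unshuffles inserts into `P` the vector-valued form
`antisymm Q` obtained by antisymmetrizing `Q` over all its arguments, the second one is the wedge
product of operator-valued forms. The operations `ins`, `wedge` and `antisymm` are characterized by how
they commute with the contraction with a vector, and all their identities follow by induction on the
list of arguments: `wedge` is associative (`wedge_assoc`), `ins` acts by derivations of it
(`ins_wedge`), the associator of `ins` is graded symmetric (`ins_ins`), and `antisymm` carries the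
composition to the insertion (`antisymm_circ`). Together they give `circ_preLie` and `bracket_jacobi`.
The comparison with unshuffles (`hat_compLeft`, `hat_compRight`) rests on expanding a sum over
unshuffles along the position of the first argument (`sum_unshuffles_succ`), which is the same
recursion.

*The algebra `s⁻¹L' ⊕ h`.* Bidegrees add under the bracket, so `[L', h] ⊆ h` and the projection `P` is the
identity there (`projH_eq_self`). Hence the Jacobi identity of `l₂` (`ctrlBilin_jacobi`) follows from
that of `L`. As `l₂` is the only bracket, the twisted brackets are `l₂(α, ·)` and `l₂`
(`IsQuadratic.twist`), and the axioms for them come from the Jacobi identity with arguments equal to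
`α` (`isLInfinity_twist`). An element `(s⁻¹(π + ρ + μ), D)` is Maurer–Cartan exactly if its `l₂`-square
vanishes, which says that `π + ρ + μ` is a pre-Lie product on `g ⊕ V` and `D` a derivation of it, that is,
that there is a pre-LieDer pair (`ctrlBilin_strElement_self_eq_zero_iff`). Finally
`l₂(α + β, α + β) = 2 (l₂(α, β) + ½ l₂(β, β))` when `l₂(α, α) = 0`, so `β` is Maurer–Cartan for the twisted
brackets exactly if `α + β` is for the original ones.
-/

namespace PreLieDer

/-! ### The calculus of forms on lists of vectors -/

section ListForms

set_option linter.unusedSectionVars false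

variable {W M N : Type*} [AddCommGroup W] [AddCommGroup M] [AddCommGroup N]

/-- Contraction of a form with a vector, put in its first argument. Forms are arbitrary functions of
a list of vectors, the component of degree `n` being the restriction to lists of length `n`. -/
def contr (w : W) (F : List W → M) : List W → M := fun l => F (w :: l)

/-- The form `F` with its component of degree `n` multiplied by `(-1)^{kn}`. -/
def tw (k : ℕ) (F : List W → M) : List W → M := fun l => (-1 : ℤ) ^ (k * l.length) • F l

/-- The form `F` lives, up to `2`-torsion, in degrees of the parity of `a`. The signs of the calculus
depend on degrees only modulo `2`, so that `a` need not be the degree of `F`. -/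
def HasParity (a : ℕ) (F : List W → M) : Prop := tw 1 F = (-1 : ℤ) ^ a • F

/-- The form `F` is additive in each of its arguments. -/
def MultiAdd (F : List W → M) : Prop :=
  ∀ (u v : List W) (a b : W), F (u ++ (a + b) :: v) = F (u ++ a :: v) + F (u ++ b :: v)

/-- The form `F` changes sign when two adjacent arguments are exchanged. -/
def AdjSwap (F : List W → M) : Prop :=
  ∀ (u v : List W) (a b : W), F (u ++ a :: b :: v) = -F (u ++ b :: a :: v)

/-- The sum of `± F u v` over all ways of splitting a list into two complementary sublists `u`
and `v`, the sign being that of the corresponding unshuffle. -/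
def splitSum (F : List W → List W → M) : List W → M
  | [] => F [] []
  | w :: l => splitSum (fun u v => F (w :: u) v) l +
      splitSum (fun u v => (-1 : ℤ) ^ u.length • F u (w :: v)) l

/-- The wedge product of a form with values in a ring and a form with values in a module. -/
def wedge {R : Type*} [Ring R] [Module R M] (F : List W → R) (G : List W → M) : List W → M :=
  splitSum fun u v => F u • G v

/-- The insertion of a vector-valued form `A` into `F`: for alternating `F`, the sum of
`± F (A u, v)` over the splittings of the arguments into `u` and `v`. The recursion is the rule for
contracting the insertion with a vector, and makes sense for all `A` and `F`. -/
def ins : (List W → W) → (List W → M) → List W → M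
  | A, F, [] => F [A []]
  | A, F, w :: l => ins (contr w A) F l - ins (tw 1 A) (contr w F) l

/-- The vector-valued form obtained from an operator-valued form `Q` by antisymmetrizing
`Q (x₁, …, x_q) x_{q+1}` over all arguments. -/
def antisymm {R : Type*} [Ring R] [Module R W] : (List W → R) → List W → W
  | _, [] => 0
  | Q, w :: l => antisymm (contr w Q) l + (-1 : ℤ) ^ l.length • Q l • w

/-! ### Contraction, sign twist and wedge product -/

theorem contr_apply (w : W) (F : List W → M) (l : List W) : contr w F l = F (w :: l) := rfl

theorem tw_apply (k : ℕ) (F : List W → M) (l : List W) :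
    tw k F l = (-1 : ℤ) ^ (k * l.length) • F l := rfl

theorem contr_add (w : W) (F G : List W → M) : contr w (F + G) = contr w F + contr w G := rfl

theorem contr_smul (w : W) (z : ℤ) (F : List W → M) : contr w (z • F) = z • contr w F := rfl

theorem tw_add (k : ℕ) (F G : List W → M) : tw k (F + G) = tw k F + tw k G := by
  funext l; simp [tw]

theorem tw_smul (k : ℕ) (z : ℤ) (F : List W → M) : tw k (z • F) = z • tw k F := by
  funext l; simp [tw, smul_comm z]

theorem tw_tw (j k : ℕ) (F : List W → M) : tw j (tw k F) = tw (j + k) F := by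
  funext l; simp [tw, smul_smul, add_mul, pow_add]

theorem tw_add_two (k : ℕ) (F : List W → M) : tw (k + 2) F = tw k F := by
  funext l; simp [tw, add_mul, pow_add, pow_mul]

theorem contr_tw (w : W) (k : ℕ) (F : List W → M) :
    contr w (tw k F) = (-1 : ℤ) ^ k • tw k (contr w F) := by
  funext l; simp [tw, contr, smul_smul, mul_add, pow_add, mul_comm]

theorem HasParity.contr {a : ℕ} {F : List W → M} (h : HasParity a F) (w : W) :
    HasParity (a + 1) (contr w F) := by
  have := congrArg (PreLieDer.contr w) h
  rw [contr_tw, contr_smul] at this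
  unfold HasParity
  rw [pow_succ, mul_smul, smul_comm, ← this, smul_smul]
  simp

theorem HasParity.tw {a : ℕ} {F : List W → M} (h : HasParity a F) (k : ℕ) :
    HasParity a (tw k F) := by
  unfold HasParity at *
  rw [tw_tw, add_comm, ← tw_tw, h, tw_smul]

theorem HasParity.tw_eq {a : ℕ} {F : List W → M} (h : HasParity a F) (k : ℕ) :
    PreLieDer.tw k F = (-1 : ℤ) ^ (k * a) • F := by
  induction k with
  | zero => funext l; simp [PreLieDer.tw]
  | succ k ih =>
    rw [add_comm k 1, ← tw_tw, ih, tw_smul, h, smul_smul, ← pow_add]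
    congr 2; ring

theorem MultiAdd.contr {F : List W → M} (h : MultiAdd F) (w : W) : MultiAdd (contr w F) :=
  fun u v a b => h (w :: u) v a b

theorem MultiAdd.tw {F : List W → M} (h : MultiAdd F) (k : ℕ) : MultiAdd (tw k F) := by
  intro u v a b
  simp [PreLieDer.tw, h u v a b]

/-- Fixing the first arguments of a multiadditive form. -/
theorem MultiAdd.shift {F : List W → M} (h : MultiAdd F) (u : List W) :
    MultiAdd fun v => F (u ++ v) := fun s v a b => by
  simpa using h (u ++ s) v a b

theorem MultiAdd.contr_add {F : List W → M} (h : MultiAdd F) (a b : W) :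
    PreLieDer.contr (a + b) F = PreLieDer.contr a F + PreLieDer.contr b F :=
  funext fun v => h [] v a b

theorem MultiAdd.contr_zsmul {F : List W → M} (h : MultiAdd F) (z : ℤ) (a : W) :
    PreLieDer.contr (z • a) F = z • PreLieDer.contr a F :=
  map_zsmul (AddMonoidHom.mk' (fun a => PreLieDer.contr a F) h.contr_add) z a

theorem AdjSwap.contr {F : List W → M} (h : AdjSwap F) (w : W) : AdjSwap (contr w F) :=
  fun u v a b => h (w :: u) v a b

theorem splitSum_add (F G : List W → List W → M) (l : List W) :
    splitSum (fun u v => F u v + G u v) l = splitSum F l + splitSum G l := by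
  induction l generalizing F G with
  | nil => rfl
  | cons w l ih => simp only [splitSum, smul_add, ih]; abel

theorem splitSum_map (φ : M →+ N) (F : List W → List W → M) (l : List W) :
    splitSum (fun u v => φ (F u v)) l = φ (splitSum F l) := by
  induction l generalizing F with
  | nil => rfl
  | cons w l ih => simp only [splitSum, ← map_zsmul, ih, map_add]

theorem splitSum_smul (z : ℤ) (F : List W → List W → M) (l : List W) :
    splitSum (fun u v => z • F u v) l = z • splitSum F l :=
  splitSum_map (zsmulAddGroupHom z : M →+ M) F l

theorem splitSum_zero (l : List W) : splitSum (fun _ _ => (0 : M)) l = 0 := by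
  induction l with
  | nil => rfl
  | cons w l ih => simp only [splitSum, smul_zero, ih, add_zero]

section Wedge

variable {R : Type*} [Ring R] [Module R M]

theorem wedge_add_left (F F' : List W → R) (G : List W → M) :
    wedge (F + F') G = wedge F G + wedge F' G := by
  funext l; simp only [wedge, Pi.add_apply, add_smul, splitSum_add]

theorem wedge_add_right (F : List W → R) (G G' : List W → M) :
    wedge F (G + G') = wedge F G + wedge F G' := by
  funext l; simp only [wedge, Pi.add_apply, smul_add, splitSum_add]

theorem wedge_smul_left (z : ℤ) (F : List W → R) (G : List W → M) :
    wedge (z • F) G = z • wedge F G := by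
  funext l; simp only [wedge, Pi.smul_apply, smul_assoc, splitSum_smul]

theorem wedge_smul_right (z : ℤ) (F : List W → R) (G : List W → M) :
    wedge F (z • G) = z • wedge F G := by
  funext l; simp only [wedge, Pi.smul_apply, smul_comm _ z, splitSum_smul]

theorem wedge_neg_left (F : List W → R) (G : List W → M) : wedge (-F) G = -wedge F G := by
  rw [← neg_one_zsmul, wedge_smul_left, neg_one_zsmul]

theorem wedge_sub_left (F F' : List W → R) (G : List W → M) :
    wedge (F - F') G = wedge F G - wedge F' G := by
  rw [sub_eq_add_neg, wedge_add_left, wedge_neg_left, sub_eq_add_neg]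

theorem wedge_sub_right (F : List W → R) (G G' : List W → M) :
    wedge F (G - G') = wedge F G - wedge F G' := by
  rw [sub_eq_add_neg, wedge_add_right, ← neg_one_zsmul, wedge_smul_right, neg_one_zsmul,
    sub_eq_add_neg]

theorem wedge_nil (F : List W → R) (G : List W → M) : wedge F G [] = F [] • G [] := rfl

theorem contr_wedge (w : W) (F : List W → R) (G : List W → M) :
    contr w (wedge F G) = wedge (contr w F) G + wedge (tw 1 F) (contr w G) := by
  funext l
  simp only [contr, wedge, splitSum, Pi.add_apply, tw, one_mul, smul_assoc]

theorem tw_wedge (k : ℕ) (F : List W → R) (G : List W → M) :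
    tw k (wedge F G) = wedge (tw k F) (tw k G) := by
  funext l
  induction l generalizing F G with
  | nil => simp [tw, wedge_nil]
  | cons w l ih =>
    have h := congrFun (contr_wedge w F G) l
    have h' := congrFun (contr_wedge w (tw k F) (tw k G)) l
    rw [contr_apply] at h h'
    simp only [contr_tw, wedge_smul_left, wedge_smul_right, Pi.add_apply, Pi.smul_apply] at h h'
    rw [tw_tw, add_comm 1 k, ← tw_tw] at h'
    rw [← ih, ← ih] at h'
    rw [h', tw_apply, h, tw_apply, tw_apply, List.length_cons, mul_add, pow_add, mul_one, mul_comm,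
      mul_smul, smul_add, smul_add]

theorem wedge_assoc (F G : List W → R) (H : List W → M) :
    wedge (wedge F G) H = wedge F (wedge G H) := by
  funext l
  induction l generalizing F G H with
  | nil => simp [wedge_nil, mul_smul]
  | cons w l ih =>
    change contr w (wedge (wedge F G) H) l = contr w (wedge F (wedge G H)) l
    simp only [contr_wedge, tw_wedge, wedge_add_left, wedge_add_right, Pi.add_apply, ih, add_assoc]

end Wedge

/-! ### Insertion and antisymmetrization -/

theorem contr_ins (w : W) (A : List W → W) (F : List W → M) :
    contr w (ins A F) = ins (contr w A) F - ins (tw 1 A) (contr w F) := rfl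

theorem ins_cons (A : List W → W) (F : List W → M) (w : W) (l : List W) :
    ins A F (w :: l) = ins (contr w A) F l - ins (tw 1 A) (contr w F) l := rfl

theorem ins_map (φ : M →+ N) (A : List W → W) (F : List W → M) :
    ins A (fun l => φ (F l)) = fun l => φ (ins A F l) := by
  funext l
  induction l generalizing A F with
  | nil => rfl
  | cons w l ih =>
    rw [ins_cons, ih, ins_cons, map_sub, ← ih _ (contr w F)]; rfl

theorem ins_add_right (A : List W → W) (F G : List W → M) :
    ins A (F + G) = ins A F + ins A G := by
  funext l
  induction l generalizing A F G with
  | nil => rfl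
  | cons w l ih =>
    rw [Pi.add_apply, ins_cons, ins_cons, ins_cons, ih, contr_add, ih]
    simp only [Pi.add_apply]; abel

theorem ins_smul_right (z : ℤ) (A : List W → W) (F : List W → M) :
    ins A (z • F) = z • ins A F :=
  ins_map (zsmulAddGroupHom z : M →+ M) A F

theorem ins_neg_right (A : List W → W) (F : List W → M) : ins A (-F) = -ins A F :=
  ins_map (negAddMonoidHom : M →+ M) A F

theorem ins_sub_right (A : List W → W) (F G : List W → M) :
    ins A (F - G) = ins A F - ins A G := by
  rw [sub_eq_add_neg, ins_add_right, ins_neg_right, sub_eq_add_neg]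

theorem ins_add_left (A B : List W → W) {F : List W → M} (hF : MultiAdd F) :
    ins (A + B) F = ins A F + ins B F := by
  funext l
  induction l generalizing A B F with
  | nil => exact hF [] [] _ _
  | cons w l ih =>
    rw [Pi.add_apply, ins_cons, ins_cons, ins_cons, contr_add, ih _ _ hF, tw_add,
      ih _ _ (hF.contr w)]
    simp only [Pi.add_apply]; abel

theorem ins_smul_left (z : ℤ) (A : List W → W) {F : List W → M} (hF : MultiAdd F) :
    ins (z • A) F = z • ins A F :=
  map_zsmul (AddMonoidHom.mk' (fun A => ins A F) fun A B => ins_add_left A B hF) z A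

theorem ins_sub_left (A B : List W → W) {F : List W → M} (hF : MultiAdd F) :
    ins (A - B) F = ins A F - ins B F :=
  map_sub (AddMonoidHom.mk' (fun A => ins A F) fun A B => ins_add_left A B hF) A B

theorem ins_neg_left (A : List W → W) {F : List W → M} (hF : MultiAdd F) :
    ins (-A) F = -ins A F :=
  map_neg (AddMonoidHom.mk' (fun A => ins A F) fun A B => ins_add_left A B hF) A

theorem MultiAdd.ins {A : List W → W} {F : List W → M} (hA : MultiAdd A) (hF : MultiAdd F) :
    MultiAdd (ins A F) := by
  intro u
  induction u generalizing A F with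
  | nil =>
    intro v a b
    simp only [List.nil_append, ins_cons, hA.contr_add, hF.contr_add, ins_add_right,
      ins_add_left _ _ hF, Pi.add_apply]
    abel
  | cons w u ih =>
    intro v a b
    simp only [List.cons_append, ins_cons, ih (hA.contr w) hF, ih (hA.tw 1) (hF.contr w)]
    abel

theorem tw_ins (A : List W → W) {F : List W → M} (hF : MultiAdd F) :
    tw 1 (ins A F) = -ins (tw 1 A) (tw 1 F) := by
  funext l
  induction l generalizing A F with
  | nil => simp [tw, ins]
  | cons w l ih =>
    have h : tw 1 (ins A F) (w :: l) = -(tw 1 (contr w (ins A F)) l) := by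
      simp [tw, contr, pow_succ]
    have h₁ : contr w (tw 1 F) = -tw 1 (contr w F) := by rw [contr_tw]; simp
    have h₂ : contr w (tw 1 A) = -tw 1 (contr w A) := by rw [contr_tw]; simp
    rw [h, contr_ins, sub_eq_add_neg, tw_add, ← neg_one_zsmul (ins _ _), tw_smul, Pi.add_apply,
      Pi.smul_apply, ih _ hF, ih _ (hF.contr w), Pi.neg_apply, Pi.neg_apply, Pi.neg_apply, ins_cons,
      h₁, h₂, ins_neg_right, ins_neg_left _ (hF.tw 1)]
    simp only [Pi.neg_apply]
    module

theorem HasParity.ins {a b : ℕ} {A : List W → W} {F : List W → M} (hA : HasParity a A)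
    (hF : HasParity b F) (hF' : MultiAdd F) : HasParity (a + b + 1) (ins A F) := by
  unfold HasParity at *
  rw [tw_ins _ hF', hA, hF, ins_smul_right, ins_smul_left _ _ hF', smul_smul]
  simp [pow_succ, pow_add, mul_comm]

theorem HasParity.contr_ins {b : ℕ} {B : List W → W} (hB : HasParity b B) {X : List W → M}
    (hX : MultiAdd X) (w : W) :
    PreLieDer.contr w (PreLieDer.ins B X) =
      PreLieDer.ins (PreLieDer.contr w B) X -
        (-1 : ℤ) ^ b • PreLieDer.ins B (PreLieDer.contr w X) := by
  rw [PreLieDer.contr_ins, hB, ins_smul_left _ _ (hX.contr w)]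

/-- The insertion of forms with values in vectors is a graded pre-Lie action: the associator of
two insertions into an alternating form is graded symmetric. -/
theorem ins_ins {a b : ℕ} {A B : List W → W} {P : List W → M} (hA : HasParity a A)
    (hB : HasParity b B) (hA' : MultiAdd A) (hB' : MultiAdd B) (hP : MultiAdd P)
    (hP' : AdjSwap P) :
    ins B (ins A P) - ins (ins B A) P =
      (-1 : ℤ) ^ ((a + 1) * (b + 1)) • (ins A (ins B P) - ins (ins A B) P) := by
  funext l
  induction l generalizing a b A B P with
  | nil =>
    have key : ∀ A B : List W → W, ins B (ins A P) [] - ins (ins B A) P [] = -P [B [], A []] := by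
      intro A B
      simp [ins, contr, tw]
    -- a form of odd parity has no constant term, up to elements killed by `2`
    have odd : ∀ {a : ℕ} {A : List W → W}, HasParity a A → Odd a → ∀ u : List W,
        P (u ++ [A []]) = -P (u ++ [A []]) := by
      intro a A hA ha u
      have h₀ : A [] = (-1 : ℤ) • A [] := by
        have := congrFun hA []
        rw [ha.neg_one_pow] at this
        simpa [tw] using this
      have h₁ := congrArg (fun f : (List W → M) => f []) (hP.shift u |>.contr_zsmul (-1) (A []))
      simp only [contr_apply, Pi.smul_apply] at h₁
      rw [← h₀] at h₁
      simpa using h₁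
    rw [Pi.sub_apply, Pi.smul_apply, Pi.sub_apply, key, key]
    have sw : P [A [], B []] = -P [B [], A []] := hP' [] [] _ _
    rcases Nat.even_or_odd a with ha | ha
    · rcases Nat.even_or_odd b with hb | hb
      · rw [(ha.add_one.mul hb.add_one).neg_one_pow, sw]; simp
      · rw [(hb.add_one.mul_left _).neg_one_pow, one_smul]
        have : P [A [], B []] = -P [A [], B []] := odd hB hb [A []]
        rw [← sw, ← this]
    · rw [(ha.add_one.mul_right _).neg_one_pow, one_smul, sw]
      have : P [B [], A []] = -P [B [], A []] := odd hA ha [B []]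
      rw [neg_neg]
      exact this.symm
  | cons w l ih =>
    have e : ∀ {a b : ℕ} {A B : List W → W}, HasParity a A → HasParity b B → MultiAdd A →
        MultiAdd B → contr w (ins B (ins A P) - ins (ins B A) P) =
          (ins (contr w B) (ins A P) - ins (ins (contr w B) A) P) -
            (-1 : ℤ) ^ b • (ins B (ins (contr w A) P) - ins (ins B (contr w A)) P) +
            ((-1 : ℤ) ^ a * (-1 : ℤ) ^ b) •
              (ins B (ins A (contr w P)) - ins (ins B A) (contr w P)) := by
      intro a b A B hA hB hA' hB'
      rw [sub_eq_add_neg, contr_add, ← neg_one_zsmul (ins (ins B A) P), contr_smul, hB.contr_ins (hA'.ins hP),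
        (hB.ins hA hA').contr_ins hP, hA.contr_ins hP, hB.contr_ins hA', ins_sub_right,
        ins_sub_left _ _ hP, ins_smul_right, ins_smul_left _ _ hP]
      simp only [pow_add, pow_one]
      module
    have h₁ := ih hA (hB.contr w) hA' (hB'.contr w) hP hP'
    have h₂ := ih (hA.contr w) hB (hA'.contr w) hB' hP hP'
    have h₃ := ih hA hB hA' hB' (hP.contr w) (hP'.contr w)
    have e₁ := congrFun (e hA hB hA' hB') l
    have e₂ := congrFun (e hB hA hB' hA') l
    change contr w (ins B (ins A P) - ins (ins B A) P) l =
      (-1 : ℤ) ^ ((a + 1) * (b + 1)) • contr w (ins A (ins B P) - ins (ins A B) P) l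
    rw [e₁, e₂]
    simp only [Pi.add_apply, Pi.sub_apply, Pi.smul_apply] at h₁ h₂ h₃ ⊢
    rw [h₁, h₂, h₃]
    have sb : (-1 : ℤ) ^ b * (-1 : ℤ) ^ b = 1 := by rw [← pow_add]; exact Even.neg_one_pow ⟨b, rfl⟩
    have t₁ : (-1 : ℤ) ^ ((a + 1) * (b + 1 + 1)) = -((-1) ^ ((a + 1) * (b + 1)) * (-1) ^ a) := by
      rw [mul_add (a + 1) (b + 1), pow_add]; ring
    have t₂ : (-1 : ℤ) ^ ((a + 1 + 1) * (b + 1)) = -((-1) ^ ((a + 1) * (b + 1)) * (-1) ^ b) := by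
      rw [add_mul (a + 1) 1, pow_add]; ring
    rw [t₁, t₂]
    have hh : ∀ x : M, (-1 : ℤ) ^ b • (-1 : ℤ) ^ b • x = x := fun x => by
      rw [smul_smul, sb, one_smul]
    linear_combination (norm := module) (-1 : ℤ) ^ ((a + 1) * (b + 1)) •
      hh (ins (contr w A) (ins B P) l - ins (ins (contr w A) B) P l)

/-- Insertion of a form of parity `a` is a graded derivation of the wedge product. -/
theorem ins_wedge {R : Type*} [Ring R] [Module R M] {a : ℕ} {A : List W → W} (hA : HasParity a A)
    {F : List W → R} (hF : MultiAdd F) {G : List W → M} (hG : MultiAdd G) :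
    ins A (wedge F G) = wedge (ins A F) G + wedge (tw (a + 1) F) (ins A G) := by
  funext l
  induction l generalizing a A F G with
  | nil =>
    change wedge F G [A []] = _
    simp [wedge, splitSum, ins, tw]
  | cons w l ih =>
    change contr w (ins A (wedge F G)) l =
      contr w (wedge (ins A F) G + wedge (tw (a + 1) F) (ins A G)) l
    have h₁ := ih (hA.contr w) hF hG
    have h₂ := ih (hA.tw 1) (hF.contr w) hG
    have h₃ := ih (hA.tw 1) (hF.tw 1) (hG.contr w)
    rw [contr_ins, contr_wedge, ins_add_right, contr_add, contr_wedge, contr_wedge, tw_ins _ hF,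
      contr_ins, contr_ins, contr_tw, tw_tw, add_comm 1 (a + 1)]
    simp only [Pi.add_apply, Pi.sub_apply, h₁, h₂, h₃, tw_tw, tw_add_two]
    unfold HasParity at hA
    simp only [hA, ins_smul_left _ _ hG, ins_smul_left _ _ (hF.tw 1),
      ins_smul_left _ _ (hF.contr w), ins_smul_left _ _ (hG.contr w), wedge_sub_left,
      wedge_sub_right, wedge_neg_left, wedge_smul_left, wedge_smul_right,
      Pi.sub_apply, Pi.neg_apply, Pi.smul_apply, pow_succ]
    module

theorem antisymm_cons {R : Type*} [Ring R] [Module R W] (Q : List W → R) (w : W) :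
    contr w (antisymm Q) = antisymm (contr w Q) + tw 1 (fun l => Q l • w) := by
  funext l; simp [contr, antisymm, tw]

theorem antisymm_add {R : Type*} [Ring R] [Module R W] (Q Q' : List W → R) :
    antisymm (Q + Q') = antisymm Q + antisymm Q' := by
  funext l
  induction l generalizing Q Q' with
  | nil => simp [antisymm]
  | cons w l ih =>
    simp only [antisymm, Pi.add_apply, contr_add, ih, add_smul, smul_add]; abel

theorem antisymm_smul {R : Type*} [Ring R] [Module R W] (z : ℤ) (Q : List W → R) :
    antisymm (z • Q) = z • antisymm Q :=
  map_zsmul (AddMonoidHom.mk' (fun Q : List W → R => antisymm Q) antisymm_add) z Q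

theorem antisymm_sub {R : Type*} [Ring R] [Module R W] (Q Q' : List W → R) :
    antisymm (Q - Q') = antisymm Q - antisymm Q' :=
  map_sub (AddMonoidHom.mk' (fun Q : List W → R => antisymm Q) antisymm_add) Q Q'

theorem tw_antisymm {R : Type*} [Ring R] [Module R W] (Q : List W → R) :
    tw 1 (antisymm Q) = -antisymm (tw 1 Q) := by
  funext l
  induction l generalizing Q with
  | nil => simp [tw, antisymm]
  | cons w l ih =>
    have h : tw 1 (antisymm Q) (w :: l) = -(tw 1 (contr w (antisymm Q)) l) := by
      simp [tw, contr, pow_succ]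
    rw [h, antisymm_cons, tw_add, Pi.add_apply, ih, tw_tw, Pi.neg_apply, Pi.neg_apply, antisymm,
      contr_tw, antisymm_smul]
    have h₁ : ((-1 : ℤ) ^ l.length • (tw 1 Q l • w) : W) = tw (1 + 1) (fun l => Q l • w) l := by
      simp only [tw, one_mul, smul_assoc, smul_smul, two_mul, pow_add, Nat.reduceAdd]
    rw [h₁]
    simp

theorem HasParity.antisymm {R : Type*} [Ring R] [Module R W] {q : ℕ} {Q : List W → R}
    (hQ : HasParity q Q) : HasParity (q + 1) (antisymm Q) := by
  unfold HasParity at *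
  rw [tw_antisymm, hQ, antisymm_smul, pow_succ, mul_neg_one, neg_smul]

theorem MultiAdd.antisymm {R : Type*} [Ring R] [Module R W] {Q : List W → R} (hQ : MultiAdd Q) :
    MultiAdd (antisymm Q) := by
  intro u
  induction u generalizing Q with
  | nil =>
    intro v a b
    simp only [List.nil_append, PreLieDer.antisymm, hQ.contr_add, antisymm_add, smul_add,
      Pi.add_apply]
    abel
  | cons w u ih =>
    intro v a b
    have := hQ u v a b
    simp only [List.cons_append, PreLieDer.antisymm, ih (hQ.contr w), this, add_smul, smul_add,
      List.length_append, List.length_cons]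
    abel

theorem antisymm_wedge {R : Type*} [Ring R] [Module R W] (F G : List W → R) :
    antisymm (wedge F G) = wedge F (antisymm G) := by
  funext l
  induction l generalizing F G with
  | nil => simp [antisymm, wedge, splitSum]
  | cons w l ih =>
    change contr w (antisymm (wedge F G)) l = contr w (wedge F (antisymm G)) l
    have h : (fun l => wedge F G l • w) = wedge F fun l => G l • w := by
      funext l
      have := splitSum_map (AddMonoidHom.mk' (fun r : R => r • w) fun a b => add_smul a b w)
        (fun u v => F u • G v) l
      simp only [AddMonoidHom.mk'_apply, smul_eq_mul, mul_smul] at this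
      exact this.symm
    rw [antisymm_cons, contr_wedge, contr_wedge, antisymm_cons, antisymm_add, wedge_add_right, h,
      tw_wedge]
    simp only [Pi.add_apply, ih, add_assoc]

/-- Inserting `A` into the antisymmetrization of `Q` either inserts `A` among the form arguments of
`Q` or applies the operators `Q` to the values of `A`. -/
theorem ins_antisymm {R : Type*} [Ring R] [Module R W] {a : ℕ} {A : List W → W}
    (hA : HasParity a A) {Q : List W → R} (hQ : MultiAdd Q) :
    ins A (antisymm Q) = antisymm (ins A Q) + wedge (tw (a + 1) Q) A := by
  funext l
  induction l generalizing a A Q with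
  | nil => simp [antisymm, ins, wedge, splitSum, tw]
  | cons w l ih =>
    change contr w (ins A (antisymm Q)) l =
      contr w (antisymm (ins A Q) + wedge (tw (a + 1) Q) A) l
    have h₁ := ih (hA.contr w) hQ
    have h₂ := ih (hA.tw 1) (hQ.contr w)
    have h₃ : ins A (fun l => Q l • w) = fun l => ins A Q l • w :=
      ins_map (AddMonoidHom.mk' (fun r : R => r • w) fun a b => add_smul a b w) A Q
    have h₄ : MultiAdd fun l => Q l • w := fun u v a b =>
      (congrArg (· • w) (hQ u v a b)).trans (add_smul _ _ w)
    have h₅ := tw_ins A h₄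
    rw [contr_ins, antisymm_cons, ins_add_right, contr_add, contr_wedge, antisymm_cons, contr_ins,
      contr_tw, tw_tw, add_comm 1 (a + 1), ← h₃, h₅, antisymm_sub]
    simp only [Pi.add_apply, Pi.sub_apply, h₁, h₂, tw_add_two]
    unfold HasParity at hA
    simp only [hA, ins_smul_left _ _ (hQ.contr w),
      ins_smul_left _ _ (h₄.tw 1), antisymm_smul, wedge_smul_left,
      wedge_smul_right, Pi.neg_apply, Pi.smul_apply, pow_succ]
    module

/-! ### The graded pre-Lie product and its bracket -/

section Circ

variable {R : Type*} [Ring R] [Module R W]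

/-- The composition `P ∘ Q` of operator-valued forms, `Q` being of parity `q`: the insertion of the
antisymmetrization of `Q` into `P`, plus the signed wedge product. -/
def circ (q : ℕ) (P Q : List W → R) : List W → R := ins (antisymm Q) P + wedge (tw q P) Q

/-- The bracket `P ∘ Q - (-1)^{pq} Q ∘ P` of operator-valued forms of parities `p` and `q`. -/
def bracket (p q : ℕ) (P Q : List W → R) : List W → R :=
  circ q P Q - (-1 : ℤ) ^ (p * q) • circ p Q P

/-- Antisymmetrization turns the composition of operator-valued forms into the insertion of
vector-valued ones. -/
theorem antisymm_circ {r : ℕ} {Q S : List W → R} (hS : HasParity r S) (hQ : MultiAdd Q) :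
    antisymm (circ r Q S) = ins (antisymm S) (antisymm Q) := by
  rw [ins_antisymm hS.antisymm hQ, tw_add_two, circ, antisymm_add, antisymm_wedge]

/-- The composition of operator-valued forms is a graded pre-Lie product. The associator of `P`, `Q`,
`S` is the associator of the insertions of the antisymmetrizations of `Q` and `S`, plus terms pairing
the insertion of one of `Q`, `S` into `P` with the wedge product by the other one. -/
theorem circ_preLie {p q r : ℕ} {P Q S : List W → R} (hP : HasParity p P) (hQ : HasParity q Q)
    (hS : HasParity r S) (hPm : MultiAdd P) (hQm : MultiAdd Q) (hSm : MultiAdd S)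
    (hPs : AdjSwap P) :
    circ r (circ q P Q) S - circ (q + r) P (circ r Q S) =
      (-1 : ℤ) ^ (q * r) • (circ q (circ r P S) Q - circ (q + r) P (circ q S Q)) := by
  have key : ∀ {q r : ℕ} {Q S : List W → R}, HasParity q Q → HasParity r S → MultiAdd Q →
      circ r (circ q P Q) S - circ (q + r) P (circ r Q S) =
        (ins (antisymm S) (ins (antisymm Q) P) - ins (ins (antisymm S) (antisymm Q)) P) +
          ((-1 : ℤ) ^ (q * p) • wedge (ins (antisymm S) P) Q +
            (-1 : ℤ) ^ (r * (p + q)) • wedge (ins (antisymm Q) P) S) := by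
    intro q r Q S hQ hS hQm
    have h₁ : tw r (ins (antisymm Q) P) = (-1 : ℤ) ^ (r * (p + q)) • ins (antisymm Q) P := by
      have := (hQ.antisymm.ins hP hPm).tw_eq r
      rw [this]
      congr 1
      rw [show r * (q + 1 + p + 1) = r * (p + q) + 2 * r by ring, pow_add, pow_mul]
      simp
    have h₂ : tw q P = (-1 : ℤ) ^ (q * p) • P := hP.tw_eq q
    rw [circ.eq_1 (q + r), antisymm_circ hS hQm]
    simp only [circ, ins_add_right, tw_add, wedge_add_left, wedge_add_right, h₁,
      ins_wedge hS.antisymm (hPm.tw q) hQm, tw_wedge, tw_tw, wedge_assoc, wedge_smul_left,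
      tw_add_two, add_comm r q]
    rw [h₂, ins_smul_right, wedge_smul_left]
    abel
  rw [key hQ hS hQm, add_comm q r, key hS hQ hSm,
    ins_ins hQ.antisymm hS.antisymm hQm.antisymm hSm.antisymm hPm hPs, smul_add, smul_add]
  congr 1
  · congr 1
    rw [show (q + 1 + 1) * (r + 1 + 1) = q * r + 2 * (q + r + 2) by ring, pow_add,
      pow_mul _ 2]
    simp
  · rw [add_comm, smul_smul, smul_smul, ← pow_add, ← pow_add]
    congr 2
    · congr 1; ring
    · rw [show q * r + q * (p + r) = q * p + 2 * (q * r) by ring, pow_add, pow_mul _ 2]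
      simp

theorem circ_add_left (q : ℕ) (P P' Q : List W → R) :
    circ q (P + P') Q = circ q P Q + circ q P' Q := by
  simp only [circ, ins_add_right, tw_add, wedge_add_left]; abel

theorem circ_smul_left (q : ℕ) (z : ℤ) (P Q : List W → R) :
    circ q (z • P) Q = z • circ q P Q := by
  simp only [circ, ins_smul_right, tw_smul, wedge_smul_left, smul_add]

theorem circ_add_right (q : ℕ) {P : List W → R} (hP : MultiAdd P) (Q Q' : List W → R) :
    circ q P (Q + Q') = circ q P Q + circ q P Q' := by
  simp only [circ, antisymm_add, ins_add_left _ _ hP, wedge_add_right]; abel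

theorem circ_smul_right (q : ℕ) (z : ℤ) {P : List W → R} (hP : MultiAdd P) (Q : List W → R) :
    circ q P (z • Q) = z • circ q P Q := by
  simp only [circ, antisymm_smul, ins_smul_left _ _ hP, wedge_smul_right, smul_add]

theorem circ_sub_left (q : ℕ) (P P' Q : List W → R) :
    circ q (P - P') Q = circ q P Q - circ q P' Q :=
  map_sub (AddMonoidHom.mk' (fun P => circ q P Q) fun P P' => circ_add_left q P P' Q) P P'

theorem circ_sub_right (q : ℕ) {P : List W → R} (hP : MultiAdd P) (Q Q' : List W → R) :
    circ q P (Q - Q') = circ q P Q - circ q P Q' :=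
  map_sub (AddMonoidHom.mk' (fun Q => circ q P Q) (circ_add_right q hP)) Q Q'

theorem bracket_symm (p q : ℕ) (P Q : List W → R) :
    bracket q p Q P = -((-1 : ℤ) ^ (p * q) • bracket p q P Q) := by
  rw [bracket, bracket, smul_sub, smul_smul, ← pow_add, ← two_mul, pow_mul _ 2, mul_comm q p]
  simp

/-- The graded Jacobi identity, a consequence of the pre-Lie identity for each of the three forms in
the leftmost position. -/
theorem bracket_jacobi {p q r : ℕ} {P Q S : List W → R} (hP : HasParity p P) (hQ : HasParity q Q)
    (hS : HasParity r S) (hPm : MultiAdd P) (hQm : MultiAdd Q) (hSm : MultiAdd S)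
    (hPs : AdjSwap P) (hQs : AdjSwap Q) (hSs : AdjSwap S) :
    bracket p (q + r) P (bracket q r Q S) =
      bracket (p + q) r (bracket p q P Q) S +
        (-1 : ℤ) ^ (p * q) • bracket q (p + r) Q (bracket p r P S) := by
  have h₁ := circ_preLie hP hQ hS hPm hQm hSm hPs
  have h₂ := circ_preLie hQ hP hS hQm hPm hSm hQs
  have h₃ := circ_preLie hS hP hQ hSm hPm hQm hSs
  have hpq : (-1 : ℤ) ^ (p * q) * (-1 : ℤ) ^ (p * q) = 1 := by
    rw [← pow_add]; exact Even.neg_one_pow ⟨_, rfl⟩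
  simp only [bracket, circ_sub_left, circ_smul_left, circ_sub_right _ hPm, circ_sub_right _ hQm,
    circ_sub_right _ hSm, circ_smul_right _ _ hPm, circ_smul_right _ _ hQm, circ_smul_right _ _ hSm,
    mul_add, add_mul, pow_add, mul_comm q p]
  generalize (-1 : ℤ) ^ (p * q) = a at *
  generalize (-1 : ℤ) ^ (q * r) = b at *
  generalize (-1 : ℤ) ^ (p * r) = c at *
  have hh : ∀ x : List W → R, a • a • x = x := fun x => by rw [smul_smul, hpq, one_smul]
  linear_combination (norm := module) -h₁ + a • h₂ - (b * c) • h₃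
    + b • hh (circ q (circ r P S) Q) - (b * c) • hh (circ q (circ p S P) Q)

end Circ

end ListForms

/-! ### Expansion of sums over unshuffles -/

section Expansion

/-- The permutation of `Fin (n + 1)` sending `k` to `0` which is `τ` on the remaining positions. -/
def extendPerm {n : ℕ} (k : Fin (n + 1)) (τ : Equiv.Perm (Fin n)) : Equiv.Perm (Fin (n + 1)) :=
  Equiv.Perm.decomposeFin.symm (0, τ) * k.cycleRange

theorem extendPerm_self {n : ℕ} (k : Fin (n + 1)) (τ : Equiv.Perm (Fin n)) :
    extendPerm k τ k = 0 := by
  simp [extendPerm]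

theorem extendPerm_succAbove {n : ℕ} (k : Fin (n + 1)) (τ : Equiv.Perm (Fin n)) (i : Fin n) :
    extendPerm k τ (k.succAbove i) = (τ i).succ := by
  simp [extendPerm]

theorem extendPerm_of_lt {n : ℕ} {k : Fin (n + 1)} (τ : Equiv.Perm (Fin n)) {a : Fin (n + 1)}
    {b : Fin n} (hab : (a : ℕ) = b) (h : (b : ℕ) < k) : extendPerm k τ a = (τ b).succ := by
  rw [← extendPerm_succAbove k, Fin.succAbove_of_castSucc_lt _ _ (by simpa [Fin.lt_def] using h)]
  congr 1
  exact Fin.ext hab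

theorem extendPerm_of_le {n : ℕ} {k : Fin (n + 1)} (τ : Equiv.Perm (Fin n)) {a : Fin (n + 1)}
    {b : Fin n} (hab : (a : ℕ) = b + 1) (h : (k : ℕ) ≤ b) : extendPerm k τ a = (τ b).succ := by
  rw [← extendPerm_succAbove k, Fin.succAbove_of_le_castSucc _ _ (by simpa [Fin.le_def] using h)]
  congr 1
  exact Fin.ext hab

theorem sign_extendPerm {n : ℕ} (k : Fin (n + 1)) (τ : Equiv.Perm (Fin n)) :
    Equiv.Perm.sign (extendPerm k τ) = (-1) ^ (k : ℕ) * Equiv.Perm.sign τ := by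
  rw [extendPerm, Equiv.Perm.sign_mul, Fin.sign_cycleRange, Equiv.Perm.decomposeFin.symm_sign,
    if_pos rfl, one_mul, mul_comm]

theorem extendPerm_bijective (n : ℕ) : Function.Bijective
    fun a : Fin (n + 1) × Equiv.Perm (Fin n) => extendPerm a.1 a.2 := by
  rw [Fintype.bijective_iff_injective_and_card]
  refine ⟨?_, by simp [Fintype.card_perm, Nat.factorial_succ]⟩
  rintro ⟨k, τ⟩ ⟨k', τ'⟩ h
  dsimp only at h
  have hk : k = k' := by
    apply (extendPerm k τ).injective
    rw [extendPerm_self, h, extendPerm_self]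
  subst hk
  refine Prod.ext rfl (Equiv.ext fun i => Fin.succ_injective _ ?_)
  rw [← extendPerm_succAbove, h, extendPerm_succAbove]

theorem extendPerm_mem_unshuffles {n : ℕ} (b : Fin (n + 1) → ℕ) (k : Fin (n + 1))
    (τ : Equiv.Perm (Fin n)) : extendPerm k τ ∈ unshuffles b ↔
      (∀ j < k, b j ≠ b k) ∧ τ ∈ unshuffles (b ∘ k.succAbove) := by
  simp only [unshuffles, Finset.mem_filter, Finset.mem_univ, true_and, Function.comp_apply]
  constructor
  · intro h
    refine ⟨fun j hj hb => ?_, fun i j hij hb => ?_⟩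
    · have := h j k hj hb
      rw [extendPerm_self] at this
      exact absurd this (Fin.not_lt_zero _)
    · have := h _ _ (Fin.succAbove_lt_succAbove_iff.2 hij) hb
      rw [extendPerm_succAbove, extendPerm_succAbove] at this
      exact Fin.succ_lt_succ_iff.1 this
  · rintro ⟨h₁, h₂⟩ i j hij hb
    rcases Fin.eq_self_or_eq_succAbove k j with rfl | ⟨j, rfl⟩
    · exact absurd hb (h₁ i hij)
    · rcases Fin.eq_self_or_eq_succAbove k i with rfl | ⟨i, rfl⟩
      · rw [extendPerm_self, extendPerm_succAbove]
        exact Fin.succ_pos _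
      · rw [extendPerm_succAbove, extendPerm_succAbove]
        exact Fin.succ_lt_succ_iff.2 (h₂ i j (Fin.succAbove_lt_succAbove_iff.1 hij) hb)

/-- Expansion of a sum over unshuffles along the position `k` of the first argument, which has to be
the first position of a block. -/
theorem sum_unshuffles_succ {M : Type*} [AddCommGroup M] {n : ℕ} (b : Fin (n + 1) → ℕ)
    (f : Equiv.Perm (Fin (n + 1)) → M) :
    ∑ σ ∈ unshuffles b, Equiv.Perm.sign σ • f σ =
      ∑ k : Fin (n + 1), if ∀ j < k, b j ≠ b k then
        (-1 : ℤ) ^ (k : ℕ) • ∑ τ ∈ unshuffles (b ∘ k.succAbove),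
          Equiv.Perm.sign τ • f (extendPerm k τ) else 0 := by
  classical
  have h₁ : ∑ σ ∈ unshuffles b, Equiv.Perm.sign σ • f σ =
      ∑ σ, if σ ∈ unshuffles b then Equiv.Perm.sign σ • f σ else 0 := by
    rw [← Finset.sum_filter]; congr 1; ext; simp
  rw [h₁, ← (extendPerm_bijective n).sum_comp, Fintype.sum_prod_type]
  refine Finset.sum_congr rfl fun k _ => ?_
  split_ifs with hk
  · rw [Finset.smul_sum, ← Finset.sum_filter]
    refine Finset.sum_congr ?_ fun τ _ => ?_
    · ext τ
      have := extendPerm_mem_unshuffles b k τ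
      rw [Finset.mem_filter, this]
      exact iff_of_eq (by simp only [Finset.mem_univ, true_and, eq_true hk]) |>.symm
    · rw [sign_extendPerm, mul_smul]
      simp [Units.smul_def]
  · refine Finset.sum_eq_zero fun τ _ => if_neg fun h => hk ?_
    exact ((extendPerm_mem_unshuffles b k τ).1 h).1

theorem unshuffles_congr {n : ℕ} {b b' : Fin n → ℕ} (h : ∀ i j, b i = b j ↔ b' i = b' j) :
    unshuffles b = unshuffles b' := by
  simp only [unshuffles, h]

end Expansion

/-! ### Signed sums over splittings of lists -/

section SplitSums

set_option linter.unusedSectionVars false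

variable {W M : Type*} [AddCommGroup W] [AddCommGroup M]

theorem splitSum_congr {F G : List W → List W → M} (l : List W)
    (h : ∀ u v, u.length + v.length = l.length → F u v = G u v) : splitSum F l = splitSum G l := by
  induction l generalizing F G with
  | nil => exact h [] [] rfl
  | cons w l ih =>
    simp only [splitSum]
    congr 1
    · exact ih fun u v huv => h _ _ (by simp [← huv]; omega)
    · exact ih fun u v huv => by rw [h _ _ (by simp [← huv]; omega)]

/-- The sum of `± F u m v` over all ways of splitting a list into complementary sublists `u`, `[m]`
and `v`, the sign being that of the corresponding unshuffle. -/
def splitSum₃ (F : List W → W → List W → M) : List W → M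
  | [] => 0
  | w :: l => splitSum₃ (fun u m v => F (w :: u) m v) l +
      splitSum (fun u v => (-1 : ℤ) ^ u.length • F u w v) l +
      splitSum₃ (fun u m v => (-1 : ℤ) ^ (u.length + 1) • F u m (w :: v)) l

theorem splitSum₃_congr {F G : List W → W → List W → M} (l : List W)
    (h : ∀ u m v, u.length + 1 + v.length = l.length → F u m v = G u m v) :
    splitSum₃ F l = splitSum₃ G l := by
  induction l generalizing F G with
  | nil => rfl
  | cons w l ih =>
    simp only [splitSum₃]
    congr 1
    · congr 1
      · exact ih fun u m v huv => h _ _ _ (by simp [← huv]; omega)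
      · exact splitSum_congr l fun u v huv => by rw [h _ _ _ (by simp [← huv]; omega)]
    · exact ih fun u m v huv => by rw [h _ _ _ (by simp [← huv]; omega)]

theorem splitSum₃_zero (l : List W) : splitSum₃ (fun _ _ _ => (0 : M)) l = 0 := by
  induction l with
  | nil => rfl
  | cons w l ih => simp only [splitSum₃, smul_zero, ih, splitSum_zero, add_zero]

theorem splitSum₃_smul (z : ℤ) (F : List W → W → List W → M) (l : List W) :
    splitSum₃ (fun u m v => z • F u m v) l = z • splitSum₃ F l := by
  induction l generalizing F with
  | nil => simp [splitSum₃]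
  | cons w l ih => simp only [splitSum₃, smul_comm _ z, ih, splitSum_smul, smul_add]

theorem sum_ite_split {n : ℕ} {P Q R : Fin n → Prop} [DecidablePred P] [DecidablePred Q]
    [DecidablePred R] (T : Fin n → M) (h : ∀ k, P k ↔ Q k ∨ R k) (h' : ∀ k, Q k → ¬ R k) :
    (∑ k, if P k then T k else 0) = (∑ k, if Q k then T k else 0) + ∑ k, if R k then T k else 0 := by
  rw [← Finset.sum_add_distrib]
  refine Finset.sum_congr rfl fun k _ => ?_
  by_cases hQ : Q k
  · simp [h, hQ, h' k hQ]
  · simp [h, hQ]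

theorem sum_ite_val_eq {n i : ℕ} (hi : i < n) {Q : Fin n → Prop} [DecidablePred Q]
    (hQ : ∀ k, Q k ↔ (k : ℕ) = i) (T : Fin n → M) :
    (∑ k, if Q k then T k else 0) = T ⟨i, hi⟩ := by
  rw [Finset.sum_eq_single ⟨i, hi⟩]
  · simp [hQ]
  · intro k _ hk
    rw [if_neg fun h => hk (Fin.ext ((hQ k).1 h))]
  · simp

theorem val_succAbove {n : ℕ} (k : Fin (n + 1)) (a : Fin n) :
    (k.succAbove a : ℕ) = if (a : ℕ) < k then (a : ℕ) else a + 1 := by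
  simp only [Fin.succAbove, Fin.lt_def, Fin.val_castSucc]
  split_ifs <;> rfl

theorem blocks₂_succAbove_zero {n i : ℕ} :
    blocks₂ (n + 1) (i + 1) ∘ Fin.succAbove 0 = blocks₂ n i := by
  funext a
  simp only [blocks₂, Function.comp_apply, val_succAbove, Fin.val_zero, Nat.not_lt_zero, if_false]
  split_ifs <;> omega

theorem blocks₂_succAbove_self {n i : ℕ} (hi : i < n + 1) :
    blocks₂ (n + 1) i ∘ Fin.succAbove ⟨i, hi⟩ = blocks₂ n i := by
  funext a
  simp only [blocks₂, Function.comp_apply, val_succAbove]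
  split_ifs <;> omega

theorem blocks₃_succAbove_zero {n q : ℕ} :
    blocks₃ (n + 1) (q + 1) ∘ Fin.succAbove 0 = blocks₃ n q := by
  funext a
  simp only [blocks₃, Function.comp_apply, val_succAbove, Fin.val_zero, Nat.not_lt_zero, if_false]
  split_ifs <;> omega

/-- Without its middle position, a triple of blocks is a pair of blocks, up to renaming. -/
theorem blocks₃_succAbove_self {n q : ℕ} (hq : q < n + 1) (a : Fin n) :
    (blocks₃ (n + 1) q ∘ Fin.succAbove ⟨q, hq⟩) a = 2 * blocks₂ n q a := by
  simp only [blocks₂, blocks₃, Function.comp_apply, val_succAbove]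
  split_ifs <;> omega

theorem blocks₃_succAbove_succ {n q : ℕ} (hq : q + 1 < n + 1) :
    blocks₃ (n + 1) q ∘ Fin.succAbove ⟨q + 1, hq⟩ = blocks₃ n q := by
  funext a
  simp only [blocks₃, Function.comp_apply, val_succAbove]
  split_ifs <;> omega

/-- The first positions of the blocks of lengths `i`, `n - i`. -/
theorem blocks₂_first_iff {n i : ℕ} (k : Fin n) :
    (∀ l < k, blocks₂ n i l ≠ blocks₂ n i k) ↔ ((k : ℕ) = 0 ∧ 0 < i) ∨ (k : ℕ) = i := by
  simp only [blocks₂]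
  constructor
  · intro h
    by_contra hk
    by_cases hki : (k : ℕ) < i
    · refine h ⟨0, by omega⟩ (by rw [Fin.lt_def]; dsimp only; omega) ?_
      dsimp only
      rw [if_pos (by omega), if_pos hki]
    · refine h ⟨i, by omega⟩ (by rw [Fin.lt_def]; dsimp only; omega) ?_
      dsimp only
      rw [if_neg (by omega), if_neg hki]
  · rintro h l hl
    rw [Fin.lt_def] at hl
    split_ifs <;> omega

/-- The first positions of the blocks of lengths `q`, `1`, `n - q - 1`. -/
theorem blocks₃_first_iff {n q : ℕ} (k : Fin n) :
    (∀ l < k, blocks₃ n q l ≠ blocks₃ n q k) ↔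
      (((k : ℕ) = 0 ∧ 0 < q) ∨ (k : ℕ) = q) ∨ (k : ℕ) = q + 1 := by
  simp only [blocks₃]
  constructor
  · intro h
    by_contra hk
    by_cases hkq : (k : ℕ) < q
    · refine h ⟨0, by omega⟩ (by rw [Fin.lt_def]; dsimp only; omega) ?_
      dsimp only
      rw [if_pos (by omega), if_pos hkq]
    · refine h ⟨q + 1, by omega⟩ (by rw [Fin.lt_def]; dsimp only; omega) ?_
      dsimp only
      rw [if_neg (by omega), if_neg (by omega), if_neg hkq, if_neg (by omega)]
  · rintro h l hl
    rw [Fin.lt_def] at hl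
    split_ifs <;> omega

/-- The sum over the unshuffles of two blocks as a signed sum over splittings. -/
theorem sum_unshuffles_blocks₂ {n i j : ℕ} (h : i + j = n) (F : List W → List W → M)
    (x : Fin n → W) :
    ∑ σ ∈ unshuffles (blocks₂ n i), Equiv.Perm.sign σ •
      F (List.ofFn fun t : Fin i => x (σ ⟨t, by omega⟩))
        (List.ofFn fun t : Fin j => x (σ ⟨i + t, by omega⟩)) =
      splitSum (fun u v => if u.length = i then F u v else 0) (List.ofFn x) := by
  induction n generalizing i j F with
  | zero =>
    obtain rfl : i = 0 := by omega
    obtain rfl : j = 0 := by omega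
    have : unshuffles (blocks₂ 0 0) = {1} := by decide
    simp [this, splitSum]
  | succ n ih =>
    rw [sum_unshuffles_succ, sum_ite_split _ blocks₂_first_iff (by intros; omega), List.ofFn_succ,
      splitSum]
    congr 1
    · cases i with
      | zero => simp [splitSum_zero]
      | succ i =>
        rw [sum_ite_val_eq (Nat.succ_pos n) (by simp)]
        simp only [List.length_cons, add_left_inj]
        rw [← ih (j := j) (by omega) (fun u v => F (x 0 :: u) v)]
        simp only [pow_zero, one_smul]
        refine Finset.sum_congr ?_ fun τ _ => ?_
        · exact congrArg unshuffles blocks₂_succAbove_zero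
        · refine congrArg _ (congr (congrArg F ?_) ?_)
          · rw [List.ofFn_succ]
            refine congrArg₂ List.cons (congrArg x (extendPerm_self 0 τ))
              (congrArg List.ofFn (funext fun t => ?_))
            exact congrArg x (extendPerm_of_le τ (by simp) (by simp))
          · congr 1
            funext t
            exact congrArg x (extendPerm_of_le τ (by simp; omega) (by simp))
    · cases j with
      | zero =>
        rw [splitSum_congr (G := fun _ _ => 0), splitSum_zero]
        · exact Finset.sum_eq_zero fun k _ => if_neg (by omega)
        · intro u v huv
          rw [List.length_ofFn] at huv
          rw [if_neg (by omega), smul_zero]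
      | succ j =>
        rw [sum_ite_val_eq (by omega : i < n + 1) (by simp)]
        have hs : (fun u v : List W => (-1 : ℤ) ^ u.length •
            if u.length = i then F u (x 0 :: v) else 0) = fun u v => (-1 : ℤ) ^ i •
              if u.length = i then F u (x 0 :: v) else 0 := by
          funext u v
          split_ifs with hu
          · rw [hu]
          · simp
        rw [hs, splitSum_smul, ← ih (j := j) (by omega) (fun u v => F u (x 0 :: v))]
        dsimp only
        congr 1
        refine Finset.sum_congr ?_ fun τ _ => ?_
        · exact congrArg unshuffles (blocks₂_succAbove_self _)
        · refine congrArg _ (congr (congrArg F ?_) ?_)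
          · congr 1
            funext t
            exact congrArg x (extendPerm_of_lt τ (by simp) (by simp))
          · rw [List.ofFn_succ]
            congr 1
            · exact congrArg x (extendPerm_self _ τ)
            · congr 1
              funext t
              exact congrArg x (extendPerm_of_le τ (by simp; omega) (by simp))

/-- The sum over the unshuffles of three blocks, the middle one of length `1`, as a signed sum over
splittings. -/
theorem sum_unshuffles_blocks₃ {n q p : ℕ} (h : q + 1 + p = n) (F : List W → W → List W → M)
    (x : Fin n → W) :
    ∑ σ ∈ unshuffles (blocks₃ n q), Equiv.Perm.sign σ •
      F (List.ofFn fun t : Fin q => x (σ ⟨t, by omega⟩)) (x (σ ⟨q, by omega⟩))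
        (List.ofFn fun t : Fin p => x (σ ⟨q + 1 + t, by omega⟩)) =
      splitSum₃ (fun u m v => if u.length = q then F u m v else 0) (List.ofFn x) := by
  induction n generalizing q p F with
  | zero => omega
  | succ n ih =>
    have hs : ∀ (k : ℕ) (G : List W → M), (fun u : List W => (-1 : ℤ) ^ (u.length + k) •
        if u.length = q then G u else 0) = fun u => (-1 : ℤ) ^ (q + k) •
          if u.length = q then G u else 0 := by
      intro k G
      funext u
      split_ifs with hu
      · rw [hu]
      · simp
    rw [sum_unshuffles_succ, sum_ite_split _ blocks₃_first_iff (by intros; omega),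
      sum_ite_split _ (fun _ => Iff.rfl) (by intros; omega), List.ofFn_succ, splitSum₃]
    congr 1
    · congr 1
      · cases q with
        | zero => simp [splitSum₃_zero]
        | succ q =>
          rw [sum_ite_val_eq (Nat.succ_pos n) (by simp)]
          simp only [List.length_cons, add_left_inj]
          rw [← ih (p := p) (by omega) (fun u m v => F (x 0 :: u) m v)]
          simp only [pow_zero, one_smul]
          refine Finset.sum_congr ?_ fun τ _ => ?_
          · exact congrArg unshuffles blocks₃_succAbove_zero
          · refine congrArg _ (congr (congr (congrArg F ?_) ?_) ?_)
            · rw [List.ofFn_succ]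
              refine congrArg₂ List.cons (congrArg x (extendPerm_self 0 τ))
                (congrArg List.ofFn (funext fun t => ?_))
              exact congrArg x (extendPerm_of_le τ (by simp) (by simp))
            · exact congrArg x (extendPerm_of_le τ (by simp) (by simp))
            · congr 1
              funext t
              exact congrArg x (extendPerm_of_le τ (by simp; omega) (by simp))
      · rw [sum_ite_val_eq (by omega : q < n + 1) (by simp)]
        have hs' := fun v : List W => congrFun (hs 0 fun u => F u (x 0) v)
        simp only [add_zero] at hs'
        simp only [hs']
        rw [splitSum_smul, ← sum_unshuffles_blocks₂ (j := p) (by omega) (fun u v => F u (x 0) v)]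
        congr 1
        refine Finset.sum_congr ?_ fun τ _ => ?_
        · refine unshuffles_congr fun a b => ?_
          rw [blocks₃_succAbove_self, blocks₃_succAbove_self]
          omega
        · refine congrArg _ (congr (congr (congrArg F ?_) ?_) ?_)
          · congr 1
            funext t
            exact congrArg x (extendPerm_of_lt τ (by simp) (by simp))
          · exact congrArg x (extendPerm_self _ τ)
          · congr 1
            funext t
            exact congrArg x (extendPerm_of_le τ (by simp; omega) (by simp))
    · cases p with
      | zero =>
        rw [splitSum₃_congr (G := fun _ _ _ => 0), splitSum₃_zero]
        · exact Finset.sum_eq_zero fun k _ => if_neg (by omega)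
        · intro u m v huv
          rw [List.length_ofFn] at huv
          rw [if_neg (by omega), smul_zero]
      | succ p =>
        rw [sum_ite_val_eq (by omega : q + 1 < n + 1) (by simp)]
        have hs' := fun (m : W) (v : List W) => congrFun (hs 1 fun u => F u m (x 0 :: v))
        simp only [hs']
        rw [splitSum₃_smul, ← ih (p := p) (by omega) (fun u m v => F u m (x 0 :: v))]
        congr 1
        refine Finset.sum_congr ?_ fun τ _ => ?_
        · exact congrArg unshuffles (blocks₃_succAbove_succ _)
        · refine congrArg _ (congr (congr (congrArg F ?_) ?_) ?_)
          · congr 1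
            funext t
            exact congrArg x (extendPerm_of_lt τ (by simp) (by simp))
          · exact congrArg x (extendPerm_of_lt τ (by simp) (by simp))
          · rw [List.ofFn_succ]
            congr 1
            · exact congrArg x (extendPerm_self _ τ)
            · congr 1
              funext t
              exact congrArg x (extendPerm_of_le τ (by simp; omega) (by simp))

/-- For alternating `P`, inserting `A` into `P` is the sum of `± P (A u, v)` over the splittings of
the arguments into `u` and `v`. -/
theorem ins_eq_splitSum (A : List W → W) {P : List W → M} (hP : MultiAdd P) (hP' : AdjSwap P)
    (l : List W) : ins A P l = splitSum (fun u v => P (A u :: v)) l := by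
  induction l generalizing A P with
  | nil => rfl
  | cons w l ih =>
    rw [ins_cons, ih _ hP hP', ih _ (hP.contr w) (hP'.contr w), splitSum, sub_eq_add_neg,
      ← neg_one_zsmul, ← splitSum_smul]
    congr 2
    funext u v
    have hs : P (A u :: w :: v) = -P (w :: A u :: v) := hP' [] v _ _
    have hz : P (w :: ((-1 : ℤ) ^ u.length • A u) :: v) =
      (-1 : ℤ) ^ u.length • P (w :: A u :: v) := congrFun ((hP.contr w).contr_zsmul _ _) v
    rw [hs, smul_neg, ← hz, contr_apply, tw_apply, one_mul, neg_one_zsmul]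

/-- For alternating `P`, inserting the antisymmetrization of `Q` into `P` is the sum of
`± P (Q u m, v)` over the splittings of the arguments into `u`, `[m]` and `v`. -/
theorem ins_antisymm_eq_splitSum₃ {R : Type*} [Ring R] [Module R W] (Q : List W → R)
    {P : List W → M} (hP : MultiAdd P) (hP' : AdjSwap P) (l : List W) :
    ins (antisymm Q) P l = splitSum₃ (fun u m v => P ((Q u • m) :: v)) l := by
  have hz : ∀ (z : ℤ) (a : W) (v : List W), P ((z • a) :: v) = z • P (a :: v) := fun z a v =>
    congrFun (hP.contr_zsmul z a) v
  induction l generalizing Q P with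
  | nil =>
    have := hz 0 0 []
    simpa [ins, antisymm, splitSum₃] using this
  | cons w l ih =>
    have hB : ins (tw 1 fun l => Q l • w) P l =
        splitSum (fun u v => (-1 : ℤ) ^ u.length • P ((Q u • w) :: v)) l := by
      rw [ins_eq_splitSum _ hP hP']
      simp only [tw, one_mul, hz]
    have hC := ih (tw 1 Q) (hP.contr w) (hP'.contr w) fun z a v =>
      congrFun ((hP.contr w).contr_zsmul z a) v
    rw [ins_cons, antisymm_cons, ins_add_left _ _ hP, Pi.add_apply, hB, ih _ hP hP' hz,
      tw_antisymm, ins_neg_left _ (hP.contr w), Pi.neg_apply, sub_neg_eq_add, hC, splitSum₃]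
    congr 2
    funext u m v
    have hs : P ((Q u • m) :: w :: v) = -P (w :: (Q u • m) :: v) := hP' [] v _ _
    have hz' : P (w :: ((-1 : ℤ) ^ u.length • (Q u • m)) :: v) =
      (-1 : ℤ) ^ u.length • P (w :: (Q u • m) :: v) :=
        congrFun ((hP.contr w).contr_zsmul _ _) v
    rw [hs, pow_succ, mul_neg_one, neg_smul, smul_neg, neg_neg, ← hz', contr_apply, tw_apply,
      one_mul, smul_assoc]

end SplitSums

/-! ### Cochains as forms on lists -/

section Hat

variable {K W : Type*} [Field K] [AddCommGroup W] [Module K W]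

/-- The form on lists attached to an element of `L`: its value on a list of length `n` is that of
the component of degree `n`. The entries are read off by `getD`, so that no cast between `Fin l.length` and
`Fin n` is needed. -/
def hat : CochSum K W →ₗ[K] (List W → Module.End K W) where
  toFun F l := coeff l.length F fun i => l.getD i 0
  map_add' F G := by funext l; rw [map_add]; rfl
  map_smul' c F := by funext l; rw [map_smul]; rfl

theorem hat_apply_of_length {n : ℕ} (F : CochSum K W) {l : List W} (h : l.length = n) :
    hat F l = coeff n F fun i => l.getD i 0 := by
  subst h; rfl

theorem hat_ofFn {n : ℕ} (F : CochSum K W) (x : Fin n → W) : hat F (List.ofFn x) = coeff n F x := by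
  rw [hat_apply_of_length F (List.length_ofFn)]
  congr 1
  funext i
  simp [List.getD]

theorem hat_inc_ofFn {n : ℕ} (F : Coch K W n) (x : Fin n → W) : hat (inc n F) (List.ofFn x) = F x := by
  rw [hat_ofFn, coeff_inc_same]

theorem hat_inc_of_length_ne {n : ℕ} (F : Coch K W n) {l : List W} (h : l.length ≠ n) :
    hat (inc n F) l = 0 := by
  rw [hat_apply_of_length _ rfl, coeff_inc_of_ne h.symm]
  rfl

theorem cochSum_ext {F G : CochSum K W} (h : ∀ p, coeff p F = coeff p G) : F = G :=
  DirectSum.ext_component K h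

theorem hat_injective : Function.Injective (hat : CochSum K W →ₗ[K] _) := by
  intro F G h
  refine cochSum_ext fun p => AlternatingMap.ext fun x => ?_
  rw [← hat_ofFn, h, hat_ofFn]

theorem exists_ofFn {T : Type*} {n : ℕ} {l : List T} (h : l.length = n) :
    ∃ x : Fin n → T, l = List.ofFn x := by
  subst h
  exact ⟨l.get, (List.ofFn_get l).symm⟩

theorem multiAdd_hat (F : CochSum K W) : MultiAdd (hat F) := by
  intro u v a b
  have e : ∀ c : W, hat F (u ++ c :: v) = coeff (u.length + 1 + v.length) F
      (Function.update (fun i => (u ++ 0 :: v).getD i 0) ⟨u.length, by omega⟩ c) := by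
    intro c
    rw [hat_apply_of_length (n := u.length + 1 + v.length) F (by simp; omega)]
    congr 1
    funext i
    by_cases hi : i = ⟨u.length, by omega⟩
    · subst hi; simp [List.getD]
    · rw [Function.update_of_ne hi]
      have hi' : (i : ℕ) ≠ u.length := fun h => hi (Fin.ext h)
      rcases lt_or_gt_of_ne hi' with h | h
      · simp [List.getD, List.getElem?_append_left h]
      · obtain ⟨k, hk⟩ : ∃ k, (i : ℕ) = u.length + (k + 1) := ⟨i - u.length - 1, by omega⟩
        simp [List.getD, hk, List.getElem?_append_right]
  rw [e, e, e, AlternatingMap.map_update_add]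

theorem adjSwap_hat (F : CochSum K W) : AdjSwap (hat F) := by
  intro u v a b
  have hl : ∀ c d : W, (u ++ c :: d :: v).length = u.length + 2 + v.length := by
    intro c d; simp; omega
  rw [hat_apply_of_length F (hl a b), hat_apply_of_length F (hl b a)]
  rw [← AlternatingMap.map_swap (coeff (u.length + 2 + v.length) F) _
    (i := ⟨u.length, by omega⟩) (j := ⟨u.length + 1, by omega⟩) (by simp)]
  congr 1
  funext i
  rw [Function.comp_apply, Equiv.swap_apply_def]
  split_ifs with h₁ h₂
  · subst h₁; simp [List.getD]
  · subst h₂; simp [List.getD]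
  · have h₁' : (i : ℕ) ≠ u.length := fun h => h₁ (Fin.ext h)
    have h₂' : (i : ℕ) ≠ u.length + 1 := fun h => h₂ (Fin.ext h)
    rcases lt_or_gt_of_ne h₁' with h | h
    · simp [List.getD, List.getElem?_append_left h]
    · obtain ⟨k, hk⟩ : ∃ k, (i : ℕ) = u.length + (k + 2) := ⟨i - u.length - 2, by omega⟩
      simp [List.getD, hk, List.getElem?_append_right]

theorem hasParity_hat_inc {p : ℕ} (F : Coch K W p) : HasParity p (hat (inc p F)) := by
  funext l
  by_cases h : l.length = p
  · simp [tw, h]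
  · simp [tw, hat_inc_of_length_ne F h]

variable [CharZero K]

theorem hat_compRight {p q n : ℕ} (h : p + q = n) (P : Coch K W p) (Q : Coch K W q) :
    hat (inc n (compRight h P Q)) = wedge (hat (inc p P)) (hat (inc q Q)) := by
  funext l
  by_cases hl : l.length = n
  · obtain ⟨x, rfl⟩ := exists_ofFn hl
    rw [hat_inc_ofFn, compRight_apply]
    have := sum_unshuffles_blocks₂ h (fun u v => hat (inc p P) u • hat (inc q Q) v) x
    simp only [hat_inc_ofFn] at this
    refine Eq.trans this ?_
    refine splitSum_congr _ fun u v _ => ?_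
    split_ifs with hu
    · rfl
    · rw [hat_inc_of_length_ne P hu, zero_smul]
  · rw [hat_inc_of_length_ne _ hl, wedge, splitSum_congr (G := fun _ _ => 0), splitSum_zero]
    intro u v huv
    by_cases hu : u.length = p
    · rw [hat_inc_of_length_ne Q (by omega), smul_zero]
    · rw [hat_inc_of_length_ne P hu, zero_smul]

theorem hat_compLeft {p q n : ℕ} (h : p + q = n) (P : Coch K W p) (Q : Coch K W q) :
    hat (inc n (compLeft h P Q)) = ins (antisymm (hat (inc q Q))) (hat (inc p P)) := by
  funext l
  rw [ins_antisymm_eq_splitSum₃ _ (multiAdd_hat _) (adjSwap_hat _)]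
  cases p with
  | zero =>
    rw [compLeft, map_zero, map_zero, splitSum₃_congr (G := fun _ _ _ => 0), splitSum₃_zero]
    · rfl
    · intro u m v _
      exact hat_inc_of_length_ne P (by simp)
  | succ p =>
    by_cases hl : l.length = n
    · obtain ⟨x, rfl⟩ := exists_ofFn hl
      rw [hat_inc_ofFn, compLeft_apply]
      have := sum_unshuffles_blocks₃ (p := p) (q := q) (by omega)
        (fun u m v => hat (inc (p + 1) P) ((hat (inc q Q) u • m) :: v)) x
      have hc : ∀ (a : W) (y : Fin p → W), hat (inc (p + 1) P) (a :: List.ofFn y) =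
          P (Fin.cons a y) := by
        intro a y
        rw [← hat_inc_ofFn, List.ofFn_succ]
        simp
      simp only [hat_inc_ofFn, hc] at this
      refine Eq.trans this ?_
      refine splitSum₃_congr _ fun u m v huv => ?_
      split_ifs with hu
      · rfl
      · rw [List.length_ofFn] at huv
        rw [hat_inc_of_length_ne P (by rw [List.length_cons]; omega)]
    · rw [hat_inc_of_length_ne _ hl, splitSum₃_congr (G := fun _ _ _ => 0), splitSum₃_zero]
      intro u m v huv
      by_cases hu : u.length = q
      · rw [hat_inc_of_length_ne P (by rw [List.length_cons]; omega)]
      · rw [hat_inc_of_length_ne Q hu, zero_smul]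
        simpa [contr] using congrFun ((multiAdd_hat (inc (p + 1) P)).contr_zsmul 0 0) v

theorem hat_comp {p q n : ℕ} (h : p + q = n) (P : Coch K W p) (Q : Coch K W q) :
    hat (inc n (comp h P Q)) = circ q (hat (inc p P)) (hat (inc q Q)) := by
  rw [comp, map_add, map_add, map_zsmul, map_zsmul, hat_compLeft, hat_compRight, circ,
    (hasParity_hat_inc P).tw_eq, wedge_smul_left, mul_comm]

theorem hat_mnBracket {p q n : ℕ} (h : p + q = n) (P : Coch K W p) (Q : Coch K W q) :
    hat (inc n (mnBracket h P Q)) = bracket p q (hat (inc p P)) (hat (inc q Q)) := by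
  rw [mnBracket, map_sub, map_sub, map_zsmul, map_zsmul, hat_comp, hat_comp, bracket]

end Hat

/-! ### `L∞`-algebras with at most quadratic brackets -/

section Quadratic

variable {K E : Type*} [Field K] [AddCommGroup E] [Module K E]

/-- The brackets `l k` vanish for `k ≥ 3`, and `l 1 = d`, `l 2 = B`. -/
structure IsQuadratic (l : (k : ℕ) → MultilinearMap K (fun _ : Fin k => E) E) (d : E →ₗ[K] E)
    (B : E →ₗ[K] E →ₗ[K] E) : Prop where
  one : ∀ x, l 1 x = d (x 0)
  two : ∀ x, l 2 x = B (x 0) (x 1)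
  three : ∀ k, 3 ≤ k → l k = 0

theorem koszulSign_one {n : ℕ} (d : Fin n → ℤ) : koszulSign d 1 = 1 := by
  unfold koszulSign
  refine Finset.prod_eq_one fun i _ => Finset.prod_eq_one fun j _ => if_neg ?_
  rintro ⟨h₁, h₂⟩
  exact absurd h₁ (not_lt_of_gt h₂)

theorem koszulSign_swap (d : Fin 2 → ℤ) :
    koszulSign d (Equiv.swap 0 1) = Int.negOnePow (d 0 * d 1) := by
  simp [koszulSign, Fin.prod_univ_two, mul_comm]

theorem koszulSign_swap_one_two (d : Fin 3 → ℤ) :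
    koszulSign d (Equiv.swap 1 2) = Int.negOnePow (d 1 * d 2) := by
  have h0 : (Equiv.swap 1 2 : Equiv.Perm (Fin 3)) 0 = 0 := by decide
  have h1 : (Equiv.swap 1 2 : Equiv.Perm (Fin 3)) 1 = 2 := by decide
  have h2 : (Equiv.swap 1 2 : Equiv.Perm (Fin 3)) 2 = 1 := by decide
  simp [koszulSign, Fin.prod_univ_three, h0, h1, h2, mul_comm]

theorem koszulSign_finRotate (d : Fin 3 → ℤ) :
    koszulSign d (finRotate 3) = Int.negOnePow (d 0 * (d 1 + d 2)) := by
  simp [koszulSign, Fin.prod_univ_three, mul_add, Int.negOnePow_add, mul_comm]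

variable {l : (k : ℕ) → MultilinearMap K (fun _ : Fin k => E) E} {d : E →ₗ[K] E}
  {B : E →ₗ[K] E →ₗ[K] E}

/-- A differential and a graded symmetric bracket of degree `1` satisfying the Leibniz rule and the
Jacobi identity form an `L∞`-algebra. -/
theorem IsQuadratic.isLInfinity (hl : IsQuadratic l d B) {𝒜 : ℤ → Submodule K E}
    (hgr : DirectSum.IsInternal 𝒜)
    (hd : ∀ {i x}, x ∈ 𝒜 i → d x ∈ 𝒜 (i + 1))
    (hB : ∀ {i j x y}, x ∈ 𝒜 i → y ∈ 𝒜 j → B x y ∈ 𝒜 (i + j + 1))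
    (hsymm : ∀ {i j x y}, x ∈ 𝒜 i → y ∈ 𝒜 j → B y x = Int.negOnePow (i * j) • B x y)
    (hdd : ∀ {i x}, x ∈ 𝒜 i → d (d x) = 0)
    (hdB : ∀ {i j x y}, x ∈ 𝒜 i → y ∈ 𝒜 j →
      B (d x) y + Int.negOnePow (i * j) • B (d y) x + d (B x y) = 0)
    (hJ : ∀ {i j k x y z}, x ∈ 𝒜 i → y ∈ 𝒜 j → z ∈ 𝒜 k →
      B (B x y) z + Int.negOnePow (j * k) • B (B x z) y +
        Int.negOnePow (i * (j + k)) • B (B y z) x = 0) :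
    IsLInfinity 𝒜 l where
  graded := hgr
  degree_one k hk e x hx := by
    match k, hk, e, x, hx with
    | 1, _, e, x, hx => rw [hl.one, Fin.sum_univ_one]; exact hd (hx 0)
    | 2, _, e, x, hx => rw [hl.two, Fin.sum_univ_two]; exact hB (hx 0) (hx 1)
    | k + 3, _, e, x, hx => rw [hl.three _ (by omega)]; exact zero_mem _
  symm n hn e x hx σ := by
    match n, hn, e, x, hx, σ with
    | 1, _, e, x, hx, σ => rw [Subsingleton.elim σ 1, koszulSign_one, one_smul]; rfl
    | 2, _, e, x, hx, σ =>
      have : σ = 1 ∨ σ = Equiv.swap 0 1 := by revert σ; decide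
      rcases this with rfl | rfl
      · rw [koszulSign_one, one_smul]; rfl
      · rw [koszulSign_swap, hl.two, hl.two]
        exact hsymm (hx 0) (hx 1)
    | n + 3, _, e, x, hx, σ => rw [hl.three _ (by omega)]; simp
  jacobi n hn e x hx := by
    have hzero : ∀ (i : Fin n), 2 ≤ (i : ℕ) ∨ (i : ℕ) + 3 ≤ n → ∀ σ : Equiv.Perm (Fin n),
        l (n - (i + 1) + 1)
          (Fin.cons (l (i + 1) fun a : Fin (i + 1) => x (σ ⟨a, by omega⟩))
            fun c : Fin (n - (i + 1)) => x (σ ⟨i + 1 + c, by omega⟩)) = 0 := by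
      intro i hi σ
      rcases hi with hi | hi
      · rw [hl.three (i + 1) (by omega)]
        exact MultilinearMap.map_coord_zero _ 0 rfl
      · rw [hl.three (n - (i + 1) + 1) (by omega)]; rfl
    match n, hn, e, x, hx, hzero with
    | 1, _, e, x, hx, hzero =>
      have hu : unshuffles (blocks₂ 1 ((0 : Fin 1) + 1)) = {1} := by decide
      rw [Fin.sum_univ_one, hu, Finset.sum_singleton, koszulSign_one, one_smul]
      refine (hl.one _).trans ((congrArg d (hl.one _)).trans (hdd (hx 0)))
    | 2, _, e, x, hx, hzero =>
      have h0 : unshuffles (blocks₂ 2 ((0 : Fin 2) + 1)) = {1, Equiv.swap 0 1} := by decide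
      have h1 : unshuffles (blocks₂ 2 ((1 : Fin 2) + 1)) = {1} := by decide
      rw [Fin.sum_univ_two, h0, h1, Finset.sum_pair (by decide), Finset.sum_singleton,
        koszulSign_one, koszulSign_swap, one_smul, one_smul]
      refine Eq.trans (congrArg₂ _ (congrArg₂ _ ?_ (congrArg _ ?_)) ?_) (hdB (hx 0) (hx 1))
      · exact (hl.two _).trans (congrArg (fun t => B t (x 1)) (hl.one _))
      · exact (hl.two _).trans (congrArg (fun t => B t (x 0)) (hl.one _))
      · exact (hl.one _).trans (congrArg d (hl.two _))
    | 3, _, e, x, hx, hzero =>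
      have h1 : unshuffles (blocks₂ 3 ((1 : Fin 3) + 1)) =
          {1, Equiv.swap 1 2, finRotate 3} := by decide
      rw [Fin.sum_univ_three, h1, Finset.sum_eq_zero (fun σ _ => by rw [hzero _ (by simp), smul_zero]),
        Finset.sum_eq_zero (s := unshuffles (blocks₂ 3 ((2 : Fin 3) + 1)))
          (fun σ _ => by rw [hzero _ (by simp), smul_zero]), zero_add, add_zero,
        Finset.sum_insert (by decide), Finset.sum_pair (by decide),
        koszulSign_one, koszulSign_swap_one_two, koszulSign_finRotate, one_smul, ← add_assoc]
      refine Eq.trans (congrArg₂ _ (congrArg₂ _ ?_ (congrArg _ ?_)) (congrArg _ ?_))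
        (hJ (hx 0) (hx 1) (hx 2))
      · exact (hl.two _).trans (congrArg (fun t => B t (x 2)) (hl.two _))
      · exact (hl.two _).trans (congrArg (fun t => B t (x 1)) (hl.two _))
      · exact (hl.two _).trans (congrArg (fun t => B t (x 0)) (hl.two _))
    | n + 4, _, e, x, hx, hzero =>
      refine Finset.sum_eq_zero fun i _ => Finset.sum_eq_zero fun σ _ => ?_
      rw [hzero i (by omega), smul_zero]

theorem IsQuadratic.isMaurerCartan_iff (hl : IsQuadratic l d B) (𝒜 : ℤ → Submodule K E) (α : E) :
    IsMaurerCartan 𝒜 l α ↔ α ∈ 𝒜 0 ∧ d α + (2 : K)⁻¹ • B α α = 0 := by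
  have hs : ∀ k, k ∉ Finset.range 2 → l (k + 1) (fun _ => α) = 0 := by
    intro k hk
    rw [Finset.mem_range] at hk
    rw [hl.three _ (by omega)]; rfl
  have hfin : {k : ℕ | l (k + 1) (fun _ => α) ≠ 0}.Finite :=
    (Finset.finite_toSet (Finset.range 2)).subset fun k hk => by
      by_contra h
      exact hk (hs k h)
  have hsum : ∑ᶠ k : ℕ, (((k + 1).factorial : K)⁻¹) • l (k + 1) (fun _ => α) =
      d α + (2 : K)⁻¹ • B α α := by
    rw [finsum_eq_sum_of_support_subset (s := Finset.range 2)]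
    · rw [Finset.sum_range_succ, Finset.sum_range_one, hl.one, hl.two]
      simp
    · intro k hk
      by_contra h
      exact hk (by dsimp only; rw [hs k h, smul_zero])
  rw [IsMaurerCartan, hsum]
  exact ⟨fun h => ⟨h.1, h.2.2⟩, fun h => ⟨h.1, hfin, h.2⟩⟩

theorem plug_zero (α : E) {k : ℕ} (n : ℕ) :
    plug α n (0 : MultilinearMap K (fun _ : Fin (k + n) => E) E) = 0 := by
  induction n with
  | zero => rfl
  | succ n ih => exact ih

/-- Twisting an `L∞`-structure consisting of the binary bracket `B` only. -/
theorem IsQuadratic.twist (hl : IsQuadratic l 0 B) (α : E) :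
    IsQuadratic (twist l α) (B α) B := by
  have h0 : ∀ k, k ≠ 2 → 1 ≤ k → l k = 0 := by
    intro k hk hk'
    obtain rfl | hk : k = 1 ∨ 3 ≤ k := by omega
    · exact MultilinearMap.ext hl.one
    · exact hl.three k hk
  refine ⟨fun x => ?_, fun x => ?_, fun k hk => ?_⟩
  · rw [PreLieDer.twist, finsum_eq_single _ 1]
    · simp only [Nat.factorial_one, Nat.cast_one, inv_one, one_smul]
      exact hl.two _
    · intro n hn
      rw [h0 _ (by omega) (by omega), plug_zero, smul_zero]
  · rw [PreLieDer.twist, finsum_eq_single _ 0]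
    · simp only [Nat.factorial_zero, Nat.cast_one, inv_one, one_smul]
      exact hl.two _
    · intro n hn
      rw [h0 _ (by omega) (by omega), plug_zero, smul_zero]
  · rw [PreLieDer.twist, finsum_eq_zero_of_forall_eq_zero]
    intro n
    rw [h0 _ (by omega) (by omega), plug_zero, smul_zero]

end Quadratic

/-! ### The controlling algebra -/

section ControllingAlgebra

variable {K g V : Type*} [Field K] [AddCommGroup g] [Module K g] [AddCommGroup V] [Module K V]

theorem part_of_one_lt {d : ℤ} (hd : 1 < d) {a : g × V} (h : a ∈ part K g V d) : a = 0 := by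
  rw [mem_part_iff] at h
  exact Prod.ext (h.1 (by omega)) (h.2 (by omega))

/-- The projection `P` is the identity on cochains of bidegree `n|-1`. -/
theorem projCoch_eq_self {p : ℕ} {F : Coch K (g × V) p} (hF : F ∈ bidegree K g V p (-1)) :
    projCoch p F = F := by
  classical
  refine AlternatingMap.ext fun x => LinearMap.ext fun w => ?_
  set xg : Fin p → g × V := fun i => ((x i).1, 0) with hxg
  set xV : Fin p → g × V := fun i => (0, (x i).2) with hxV
  have hg : ∀ i, xg i ∈ part K g V 0 := fun i => by rw [mem_part_iff]; simp [xg]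
  have hV : ∀ i, xV i ∈ part K g V 1 := fun i => by rw [mem_part_iff]; simp [xV]
  have hwg : ((w.1, 0) : g × V) ∈ part K g V 0 := by rw [mem_part_iff]; simp
  have hwV : ((0, w.2) : g × V) ∈ part K g V 1 := by rw [mem_part_iff]; simp
  have hx : x = xg + xV := by funext i; simp [xg, xV]
  have hw : w = (w.1, 0) + (0, w.2) := by simp
  -- a single argument from `V` forces the value to be zero
  have h₁ : ∀ s : Finset (Fin p), F (s.piecewise xg xV) (0, w.2) = 0 := by
    intro s
    refine part_of_one_lt ?_ (hF (fun i => if i ∈ s then 0 else 1) 1 _ _ (fun i => ?_) hwV)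
    · have : 0 ≤ ∑ i : Fin p, (if i ∈ s then (0 : ℤ) else 1) :=
        Finset.sum_nonneg fun i _ => by split_ifs <;> simp
      omega
    · by_cases h : i ∈ s <;> simp [h, hg, hV]
  have h₂ : ∀ s : Finset (Fin p), s ≠ Finset.univ → F (s.piecewise xg xV) (w.1, 0) = 0 := by
    intro s hs
    refine part_of_one_lt ?_ (hF (fun i => if i ∈ s then 0 else 1) 0 _ _ (fun i => ?_) hwg)
    · obtain ⟨j, hj⟩ : ∃ j, j ∉ s := by
        by_contra h
        push Not at h
        exact hs (Finset.eq_univ_iff_forall.2 h)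
      have : (if j ∈ s then (0 : ℤ) else 1) ≤ ∑ i : Fin p, (if i ∈ s then (0 : ℤ) else 1) :=
        Finset.single_le_sum (f := fun i => if i ∈ s then (0 : ℤ) else 1)
          (fun i _ => by split_ifs <;> simp) (Finset.mem_univ j)
      rw [if_neg hj] at this
      omega
    · by_cases h : i ∈ s <;> simp [h, hg, hV]
  have h₃ : F x w = F xg (w.1, 0) := by
    have := F.toMultilinearMap.map_add_univ xg xV
    rw [← hx] at this
    change F x = ∑ s : Finset (Fin p), F (s.piecewise xg xV) at this
    rw [this, LinearMap.sum_apply, Finset.sum_eq_single Finset.univ]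
    · conv_lhs => rw [hw, map_add, h₁, add_zero]
      rw [Finset.piecewise_univ]
    · intro s _ hs
      rw [hw, map_add, h₁, h₂ s hs, add_zero]
    · simp
  have h₄ : F xg (w.1, 0) ∈ part K g V 1 := by
    simpa using hF (fun _ => 0) 0 xg (w.1, 0) hg hwg
  rw [h₃, projCoch_apply]
  rw [mem_part_iff] at h₄
  exact Prod.ext (h₄.1 (by simp)).symm rfl

theorem projH_eq_self {F : CochSum K (g × V)} (hF : F ∈ HSub K g V) :
    (projH K g V F : CochSum K (g × V)) = F := by
  change projSum K g V F = F
  obtain ⟨s, hs⟩ := sum_inc_coeff F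
  rw [hs, map_sum]
  exact Finset.sum_congr rfl fun p _ => by rw [projSum_inc, projCoch_eq_self (hF p)]

theorem eq_inc_coeff {W : Type*} [AddCommGroup W] [Module K W] {q : ℕ} {F : CochSum K W}
    (h : ∀ p, p ≠ q → coeff p F = 0) : F = inc q (coeff q F) := by
  refine cochSum_ext fun p => ?_
  by_cases hp : p = q
  · subst hp; rw [coeff_inc_same]
  · rw [h p hp, coeff_inc_of_ne (Ne.symm hp)]

theorem coeff_inc_of_cast_ne {i : ℤ} {q : ℕ} (hq : (q : ℤ) = i) {W : Type*} [AddCommGroup W]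
    [Module K W] (F : Coch K W q) (p : ℕ) (hp : (p : ℤ) ≠ i) : coeff p (inc q F) = 0 :=
  coeff_inc_of_ne (by rintro rfl; exact hp hq) F

/-- An element of degree `p - 1` is `(s⁻¹f, θ)` with `f` of degree `p` and `θ` of degree `p - 1`. -/
theorem ctrlF_eq_inc {p : ℕ} {a : Ctrl K g V} (ha : a ∈ ctrlGrading K g V ((p : ℤ) - 1)) :
    ctrlF a = inc p (coeff p (ctrlF a)) :=
  eq_inc_coeff fun q hq => ha.1 q (by omega)

theorem ctrlT_eq_inc {p : ℕ} {a : Ctrl K g V} (ha : a ∈ ctrlGrading K g V (((p + 1 : ℕ) : ℤ) - 1)) :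
    ctrlT a = inc p (coeff p (ctrlT a)) :=
  eq_inc_coeff fun q hq => ha.2 q (by omega)

theorem ctrlT_eq_zero {a : Ctrl K g V} (ha : a ∈ ctrlGrading K g V (((0 : ℕ) : ℤ) - 1)) :
    ctrlT a = 0 :=
  cochSum_ext fun p => by rw [ha.2 p (by omega), map_zero]

/-- The components of degree below `-1` are zero; the other degrees are `p - 1` with `p : ℕ`. -/
theorem ctrlGrading_cases {i : ℤ} {a : Ctrl K g V} (ha : a ∈ ctrlGrading K g V i) :
    a = 0 ∨ ∃ p : ℕ, i = (p : ℤ) - 1 := by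
  by_cases hi : -1 ≤ i
  · exact Or.inr ⟨(i + 1).toNat, by omega⟩
  · refine Or.inl (ctrl_ext ?_ ?_)
    · exact cochSum_ext fun p => by rw [ha.1 p (by omega), map_zero, map_zero]
    · exact cochSum_ext fun p => by rw [ha.2 p (by omega), map_zero, map_zero]

theorem ctrlGrading_isInternal : DirectSum.IsInternal (ctrlGrading K g V) := by
  rw [DirectSum.isInternal_submodule_iff_iSupIndep_and_iSup_eq_top]
  constructor
  · intro i
    -- the elements without component of degree `i` form a complement of the part of degree `i`
    let C : Submodule K (Ctrl K g V) :=
      { carrier := {a | (∀ p : ℕ, (p : ℤ) = i + 1 → coeff p (ctrlF a) = 0) ∧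
          ∀ p : ℕ, (p : ℤ) = i → coeff p (ctrlT a) = 0}
        add_mem' := fun {a b} ha hb =>
          ⟨fun p hp => by rw [map_add, map_add, ha.1 p hp, hb.1 p hp, add_zero],
            fun p hp => by rw [map_add, map_add, ha.2 p hp, hb.2 p hp, add_zero]⟩
        zero_mem' := ⟨fun _ _ => rfl, fun _ _ => rfl⟩
        smul_mem' := fun c a ha =>
          ⟨fun p hp => by rw [map_smul, map_smul, ha.1 p hp, smul_zero],
            fun p hp => by rw [map_smul, map_smul, ha.2 p hp, smul_zero]⟩ }
    have hC : ⨆ j, ⨆ (_ : j ≠ i), ctrlGrading K g V j ≤ C :=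
      iSup_le fun j => iSup_le fun hj a ha =>
        ⟨fun p hp => ha.1 p (by omega), fun p hp => ha.2 p (by omega)⟩
    refine Disjoint.mono_right hC ?_
    rw [Submodule.disjoint_def]
    intro a ha ha'
    refine ctrl_ext (cochSum_ext fun p => ?_) (cochSum_ext fun p => ?_)
    · by_cases hp : (p : ℤ) = i + 1
      · rw [ha'.1 p hp, map_zero, map_zero]
      · rw [ha.1 p hp, map_zero, map_zero]
    · by_cases hp : (p : ℤ) = i
      · rw [ha'.2 p hp, map_zero, map_zero]
      · rw [ha.2 p hp, map_zero, map_zero]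
  · rw [eq_top_iff]
    intro a _
    obtain ⟨s, hs⟩ := sum_inc_coeff (ctrlF a)
    obtain ⟨t, ht⟩ := sum_inc_coeff (ctrlT a)
    have ha : a = (∑ p ∈ s, ctrlMk (inc p (coeff p (ctrlF a)))
        (inc_mem_totalBidegree (ctrlF_mem a p)) 0) +
        ∑ p ∈ t, ctrlMk 0 (zero_mem _)
          ⟨inc p (coeff p (ctrlT a)), inc_mem_totalBidegree (ctrlT_mem a p)⟩ := by
      refine ctrl_ext ?_ ?_
      · rw [map_add, map_sum, map_sum]
        simpa using hs
      · rw [map_add, map_sum, map_sum]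
        simpa using ht
    rw [ha]
    refine add_mem (sum_mem fun p _ => ?_) (sum_mem fun p _ => ?_)
    · refine Submodule.mem_iSup_of_mem ((p : ℤ) - 1) ⟨fun q hq => ?_, fun q _ => ?_⟩
      · rw [ctrlF_mk]; exact coeff_inc_of_cast_ne (by omega) _ _ hq
      · rw [ctrlT_mk, Submodule.coe_zero, map_zero]
    · refine Submodule.mem_iSup_of_mem (p : ℤ) ⟨fun q _ => ?_, fun q hq => ?_⟩
      · rw [ctrlF_mk, map_zero]
      · rw [ctrlT_mk]; exact coeff_inc_of_cast_ne rfl _ _ hq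

theorem hasParity_ctrlF {p : ℕ} {a : Ctrl K g V} (ha : a ∈ ctrlGrading K g V ((p : ℤ) - 1)) :
    HasParity p (hat (ctrlF a)) := by
  rw [ctrlF_eq_inc ha]; exact hasParity_hat_inc _

/-- The component `θ` of an element of degree `p - 1` has degree `p - 1`, of the parity of `p + 1`. -/
theorem hasParity_ctrlT {p : ℕ} {a : Ctrl K g V} (ha : a ∈ ctrlGrading K g V ((p : ℤ) - 1)) :
    HasParity (p + 1) (hat (ctrlT a)) := by
  cases p with
  | zero => rw [ctrlT_eq_zero ha, map_zero]; funext l; simp [tw]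
  | succ p =>
    rw [ctrlT_eq_inc ha]
    have := hasParity_hat_inc (coeff p (ctrlT a))
    unfold HasParity at *
    rw [this, pow_succ, pow_succ]
    simp

theorem ctrl_hat_ext {a b : Ctrl K g V} (h₁ : hat (ctrlF a) = hat (ctrlF b))
    (h₂ : hat (ctrlT a) = hat (ctrlT b)) : a = b :=
  ctrl_ext (hat_injective h₁) (hat_injective h₂)

theorem neg_one_pow_congr {m n : ℕ} (h : Even (m + n)) : (-1 : ℤ) ^ m = (-1) ^ n := by
  have h' := Nat.even_add.1 h
  rcases Nat.even_or_odd m with hm | hm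
  · rw [hm.neg_one_pow, (h'.1 hm).neg_one_pow]
  · rw [hm.neg_one_pow, Odd.neg_one_pow]
    rw [← Nat.not_even_iff_odd] at hm ⊢
    exact fun hn => hm (h'.2 hn)

theorem negOnePow_smul {M : Type*} [AddCommGroup M] {z : ℤ} {n : ℕ} (h : Even (z - n)) (x : M) :
    Int.negOnePow z • x = (-1 : ℤ) ^ n • x := by
  rw [(Int.negOnePow_eq_iff _ _).2 h, Units.smul_def, Int.negOnePow_def, zpow_natCast]
  simp

theorem negOnePow_degree_smul {M : Type*} [AddCommGroup M] (p q : ℕ) (x : M) :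
    Int.negOnePow (((p : ℤ) - 1) * ((q : ℤ) - 1)) • x = (-1 : ℤ) ^ ((p + 1) * (q + 1)) • x :=
  negOnePow_smul ⟨-(p + q : ℤ), by push_cast; ring⟩ x

theorem negOnePow_degree_add_smul {M : Type*} [AddCommGroup M] (p q r : ℕ) (x : M) :
    Int.negOnePow (((p : ℤ) - 1) * ((q : ℤ) - 1 + ((r : ℤ) - 1))) • x =
      (-1 : ℤ) ^ ((p + 1) * (q + r)) • x :=
  negOnePow_smul ⟨-(p + q + r - 1 : ℤ), by push_cast; ring⟩ x

variable [CharZero K]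

theorem isQuadratic_ctrlBracket : IsQuadratic (ctrlBracket K g V) 0 ctrlBilin where
  one _ := rfl
  two _ := rfl
  three k hk := by
    match k, hk with
    | k + 3, _ => rfl

theorem ctrlF_bilin (a b : Ctrl K g V) :
    ctrlF (ctrlBilin a b) = signedBracket (fun p _ => (-1) ^ p) (ctrlF a) (ctrlF b) := rfl

/-- The projection `P` may be omitted from `l₂`, since the bracket of `L'` with `h` lies in `h`. -/
theorem ctrlT_bilin (a b : Ctrl K g V) :
    ctrlT (ctrlBilin a b) = signedBracket (fun _ _ => 1) (ctrlF a) (ctrlT b) +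
      signedBracket (fun p q => (-1) ^ (q * (p + 1))) (ctrlF b) (ctrlT a) := by
  have hm : ∀ (s : ℕ → ℕ → ℤ) (a b : Ctrl K g V),
      signedBracket s (ctrlF a) (ctrlT b) ∈ HSub K g V := by
    intro s a b
    have := signedBracket_mem s (ctrlF_mem a) (ctrlT_mem b)
    rwa [zero_add] at this
  rw [← projH_eq_self (hm _ a b), ← projH_eq_self (hm _ b a)]
  rfl

/-- The bracket depends only on the parities of its indices. -/
theorem bracket_add_two {W R : Type*} [AddCommGroup W] [Ring R] [Module R W] (p q : ℕ)
    (P Q : List W → R) : bracket p (q + 2) P Q = bracket p q P Q := by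
  simp only [bracket, circ, tw_add_two, mul_add, pow_add, pow_mul' _ p 2]
  simp

theorem bracket_smul_left {W R : Type*} [AddCommGroup W] [Ring R] [Module R W] (p q : ℕ) (z : ℤ)
    (P : List W → R) {Q : List W → R} (hQ : MultiAdd Q) :
    bracket p q (z • P) Q = z • bracket p q P Q := by
  rw [bracket, circ_smul_left, circ_smul_right _ _ hQ, smul_comm _ z, ← smul_sub, bracket]

theorem bracket_smul_right {W R : Type*} [AddCommGroup W] [Ring R] [Module R W] (p q : ℕ) (z : ℤ)
    {P : List W → R} (hP : MultiAdd P) (Q : List W → R) :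
    bracket p q P (z • Q) = z • bracket p q P Q := by
  rw [bracket, circ_smul_left, circ_smul_right _ _ hP, smul_comm _ z, ← smul_sub, bracket]

theorem bracket_add_right {W R : Type*} [AddCommGroup W] [Ring R] [Module R W] (p q : ℕ)
    {P : List W → R} (hP : MultiAdd P) (Q Q' : List W → R) :
    bracket p q P (Q + Q') = bracket p q P Q + bracket p q P Q' := by
  rw [bracket, circ_add_left, circ_add_right _ hP, smul_add, add_sub_add_comm, bracket, bracket]

theorem bracket_zero_right {W R : Type*} [AddCommGroup W] [Ring R] [Module R W] (p q : ℕ)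
    {P : List W → R} (hP : MultiAdd P) : bracket p q P 0 = 0 := by
  have h₁ := circ_smul_right q 0 hP 0
  have h₂ := circ_smul_left p 0 (0 : List W → R) P
  rw [zero_smul, zero_smul] at h₁ h₂
  rw [bracket, h₁, h₂, smul_zero, sub_zero]

theorem hat_ctrlF_bilin {p q : ℕ} {a b : Ctrl K g V} (ha : a ∈ ctrlGrading K g V ((p : ℤ) - 1))
    (hb : b ∈ ctrlGrading K g V ((q : ℤ) - 1)) :
    hat (ctrlF (ctrlBilin a b)) =
      (-1 : ℤ) ^ p • bracket p q (hat (ctrlF a)) (hat (ctrlF b)) := by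
  rw [ctrlF_bilin, ctrlF_eq_inc ha, ctrlF_eq_inc hb, signedBracket_inc, map_zsmul, hat_mnBracket]

/-- For `q = 0` both sides vanish, as `θ` does, so that the truncated difference `q - 1` is harmless;
for `q ≥ 1` the degree `q - 1` of `θ` has the parity of `q + 1`. -/
theorem hat_signedBracket_ctrlT (s : ℕ → ℕ → ℤ) {p q : ℕ} {a b : Ctrl K g V}
    (ha : a ∈ ctrlGrading K g V ((p : ℤ) - 1)) (hb : b ∈ ctrlGrading K g V ((q : ℤ) - 1)) :
    hat (signedBracket s (ctrlF a) (ctrlT b)) =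
      s p (q - 1) • bracket p (q + 1) (hat (ctrlF a)) (hat (ctrlT b)) := by
  cases q with
  | zero =>
    rw [ctrlT_eq_zero hb, map_zero, map_zero, bracket_zero_right _ _ (multiAdd_hat _), smul_zero]
  | succ q =>
    rw [ctrlF_eq_inc ha, ctrlT_eq_inc hb, signedBracket_inc, map_zsmul, hat_mnBracket,
      Nat.add_sub_cancel, bracket_add_two]

theorem hat_ctrlT_bilin {p q : ℕ} {a b : Ctrl K g V} (ha : a ∈ ctrlGrading K g V ((p : ℤ) - 1))
    (hb : b ∈ ctrlGrading K g V ((q : ℤ) - 1)) :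
    hat (ctrlT (ctrlBilin a b)) = bracket p (q + 1) (hat (ctrlF a)) (hat (ctrlT b)) +
      (-1 : ℤ) ^ ((p + 1) * (q + 1)) • bracket q (p + 1) (hat (ctrlF b)) (hat (ctrlT a)) := by
  rw [ctrlT_bilin, map_add, hat_signedBracket_ctrlT _ ha hb, hat_signedBracket_ctrlT _ hb ha,
    one_smul]
  congr 1
  cases p with
  | zero =>
    rw [ctrlT_eq_zero ha, map_zero, bracket_zero_right _ _ (multiAdd_hat _), smul_zero, smul_zero]
  | succ p =>
    congr 1
    rw [Nat.add_sub_cancel]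
    exact neg_one_pow_congr ⟨(p + 1) * (q + 1), by ring⟩

theorem ctrlBilin_mem {i j : ℤ} {a b : Ctrl K g V} (ha : a ∈ ctrlGrading K g V i)
    (hb : b ∈ ctrlGrading K g V j) : ctrlBilin a b ∈ ctrlGrading K g V (i + j + 1) := by
  rcases ctrlGrading_cases ha with rfl | ⟨p, rfl⟩
  · rw [map_zero, LinearMap.zero_apply]; exact zero_mem _
  rcases ctrlGrading_cases hb with rfl | ⟨q, rfl⟩
  · rw [map_zero]; exact zero_mem _
  have hT : ∀ (s : ℕ → ℕ → ℤ) {p q : ℕ} {a b : Ctrl K g V}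
      (ha : a ∈ ctrlGrading K g V ((p : ℤ) - 1)) (hb : b ∈ ctrlGrading K g V ((q : ℤ) - 1))
      (n : ℕ), (n : ℤ) ≠ p - 1 + (q - 1) + 1 →
        coeff n (signedBracket s (ctrlF a) (ctrlT b)) = 0 := by
    intro s p q a b ha hb n hn
    cases q with
    | zero => rw [ctrlT_eq_zero hb, map_zero, map_zero]
    | succ q =>
      rw [ctrlF_eq_inc ha, ctrlT_eq_inc hb, signedBracket_inc, map_zsmul,
        coeff_inc_of_ne (by push_cast at hn; omega), smul_zero]
  refine ⟨fun n hn => ?_, fun n hn => ?_⟩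
  · rw [ctrlF_bilin, ctrlF_eq_inc ha, ctrlF_eq_inc hb, signedBracket_inc, map_zsmul,
      coeff_inc_of_ne (by omega), smul_zero]
  · rw [ctrlT_bilin, map_add, hT _ ha hb n hn, hT _ hb ha n (by omega), add_zero]

theorem ctrlBilin_symm {i j : ℤ} {a b : Ctrl K g V} (ha : a ∈ ctrlGrading K g V i)
    (hb : b ∈ ctrlGrading K g V j) : ctrlBilin b a = Int.negOnePow (i * j) • ctrlBilin a b := by
  rcases ctrlGrading_cases ha with rfl | ⟨p, rfl⟩
  · simp
  rcases ctrlGrading_cases hb with rfl | ⟨q, rfl⟩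
  · simp
  rw [negOnePow_degree_smul]
  refine ctrl_hat_ext ?_ ?_
  · rw [map_zsmul, map_zsmul, hat_ctrlF_bilin ha hb, hat_ctrlF_bilin hb ha, bracket_symm p q,
      smul_neg, smul_smul, smul_smul, ← neg_smul, ← pow_add, ← pow_add,
      ← neg_one_mul ((-1 : ℤ) ^ _), ← pow_succ', neg_one_pow_congr]
    exact ⟨p * q + p + q + 1, by ring⟩
  · rw [map_zsmul, map_zsmul, hat_ctrlT_bilin ha hb, hat_ctrlT_bilin hb ha, smul_add, smul_smul,
      ← pow_add, add_comm, mul_comm (q + 1), ← two_mul, pow_mul]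
    simp

theorem hat_ctrlF_bilin_bilin {p q r : ℕ} {a b c : Ctrl K g V}
    (ha : a ∈ ctrlGrading K g V ((p : ℤ) - 1)) (hb : b ∈ ctrlGrading K g V ((q : ℤ) - 1))
    (hc : c ∈ ctrlGrading K g V ((r : ℤ) - 1)) :
    hat (ctrlF (ctrlBilin (ctrlBilin a b) c)) =
      (-1 : ℤ) ^ q • bracket (p + q) r (bracket p q (hat (ctrlF a)) (hat (ctrlF b)))
        (hat (ctrlF c)) := by
  have hab : ctrlBilin a b ∈ ctrlGrading K g V (((p + q : ℕ) : ℤ) - 1) := by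
    have := ctrlBilin_mem ha hb
    rwa [show (p : ℤ) - 1 + (q - 1) + 1 = ((p + q : ℕ) : ℤ) - 1 by push_cast; ring] at this
  rw [hat_ctrlF_bilin hab hc, hat_ctrlF_bilin ha hb, bracket_smul_left _ _ _ _ (multiAdd_hat _),
    smul_smul, ← pow_add]
  congr 1
  exact neg_one_pow_congr ⟨p + q, by ring⟩

/-- The `h`-component of `l₂ (l₂ (a, b), c)` as a combination of brackets `[f, [f', θ]]`, the Jacobi
identity having been used for the terms `[[f, f'], θ]`. -/
theorem hat_ctrlT_bilin_bilin {p q r : ℕ} {a b c : Ctrl K g V}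
    (ha : a ∈ ctrlGrading K g V ((p : ℤ) - 1)) (hb : b ∈ ctrlGrading K g V ((q : ℤ) - 1))
    (hc : c ∈ ctrlGrading K g V ((r : ℤ) - 1)) :
    hat (ctrlT (ctrlBilin (ctrlBilin a b) c)) =
      (-1 : ℤ) ^ p • bracket p (q + (r + 1)) (hat (ctrlF a))
          (bracket q (r + 1) (hat (ctrlF b)) (hat (ctrlT c))) +
        (-1 : ℤ) ^ (p + p * q + 1) • bracket q (p + (r + 1)) (hat (ctrlF b))
          (bracket p (r + 1) (hat (ctrlF a)) (hat (ctrlT c))) +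
        (-1 : ℤ) ^ ((p + q + 1) * (r + 1)) • bracket r (p + (q + 1)) (hat (ctrlF c))
          (bracket p (q + 1) (hat (ctrlF a)) (hat (ctrlT b))) +
        (-1 : ℤ) ^ ((p + q + 1) * (r + 1) + (p + 1) * (q + 1)) •
          bracket r (q + (p + 1)) (hat (ctrlF c))
            (bracket q (p + 1) (hat (ctrlF b)) (hat (ctrlT a))) := by
  have hab : ctrlBilin a b ∈ ctrlGrading K g V (((p + q : ℕ) : ℤ) - 1) := by
    have := ctrlBilin_mem ha hb
    rwa [show (p : ℤ) - 1 + (q - 1) + 1 = ((p + q : ℕ) : ℤ) - 1 by push_cast; ring] at this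
  have hj := bracket_jacobi (hasParity_ctrlF ha) (hasParity_ctrlF hb) (hasParity_ctrlT hc)
    (multiAdd_hat _) (multiAdd_hat _) (multiAdd_hat _) (adjSwap_hat _) (adjSwap_hat _)
    (adjSwap_hat _)
  rw [hat_ctrlT_bilin hab hc, hat_ctrlF_bilin ha hb, hat_ctrlT_bilin ha hb,
    bracket_smul_left _ _ _ _ (multiAdd_hat _), bracket_add_right _ _ (multiAdd_hat _),
    bracket_smul_right _ _ _ (multiAdd_hat _), eq_sub_of_add_eq hj.symm,
    show q + (p + 1) = p + q + 1 by ring, show p + (q + 1) = p + q + 1 by ring]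
  simp only [pow_add, pow_one]
  module

/-- The Jacobi identity of `l₂`. On the `L'`-component it is that of the bracket. On the
`h`-component, each of the six brackets `[f, [f', θ]]` occurs twice, with opposite signs. -/
theorem ctrlBilin_jacobi {i j k : ℤ} {a b c : Ctrl K g V} (ha : a ∈ ctrlGrading K g V i)
    (hb : b ∈ ctrlGrading K g V j) (hc : c ∈ ctrlGrading K g V k) :
    ctrlBilin (ctrlBilin a b) c + Int.negOnePow (j * k) • ctrlBilin (ctrlBilin a c) b +
      Int.negOnePow (i * (j + k)) • ctrlBilin (ctrlBilin b c) a = 0 := by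
  rcases ctrlGrading_cases ha with rfl | ⟨p, rfl⟩
  · simp
  rcases ctrlGrading_cases hb with rfl | ⟨q, rfl⟩
  · simp
  rcases ctrlGrading_cases hc with rfl | ⟨r, rfl⟩
  · simp
  rw [negOnePow_degree_smul, negOnePow_degree_add_smul]
  refine ctrl_hat_ext ?_ ?_
  · have hj := bracket_jacobi (hasParity_ctrlF ha) (hasParity_ctrlF hb) (hasParity_ctrlF hc)
      (multiAdd_hat _) (multiAdd_hat _) (multiAdd_hat _) (adjSwap_hat _) (adjSwap_hat _)
      (adjSwap_hat _)
    simp only [map_add, map_zsmul, map_zero]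
    rw [hat_ctrlF_bilin_bilin ha hb hc, hat_ctrlF_bilin_bilin ha hc hb,
      hat_ctrlF_bilin_bilin hb hc ha, eq_sub_of_add_eq hj.symm, bracket_symm q (p + r),
      bracket_symm p (q + r)]
    have e₁ : (-1 : ℤ) ^ ((q + 1) * (r + 1) + r + q * (p + r)) = (-1) ^ (q + p * q + 1) :=
      neg_one_pow_congr ⟨q * r + q + r + 1 + p * q, by ring⟩
    have e₂ : (-1 : ℤ) ^ ((p + 1) * (q + r) + r + p * (q + r)) = (-1) ^ q :=
      neg_one_pow_congr ⟨p * (q + r) + q + r, by ring⟩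
    rw [smul_sub, smul_neg, smul_neg, smul_neg, smul_neg, smul_smul, smul_smul, smul_smul,
      smul_smul, smul_smul, ← pow_add, ← pow_add, ← pow_add, ← pow_add, ← pow_add, e₁, e₂, pow_succ]
    module
  · simp only [map_add, map_zsmul, map_zero]
    rw [hat_ctrlT_bilin_bilin ha hb hc, hat_ctrlT_bilin_bilin ha hc hb,
      hat_ctrlT_bilin_bilin hb hc ha]
    have e₁ : (-1 : ℤ) ^ ((p + 1) * (q + r) + (q + r + 1) * (p + 1)) = (-1) ^ (p + 1) :=
      neg_one_pow_congr ⟨(p + 1) * (q + r + 1), by ring⟩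
    have e₂ : (-1 : ℤ) ^ ((q + 1) * (r + 1) + (p + r + 1) * (q + 1)) = (-1) ^ (p + p * q) :=
      neg_one_pow_congr ⟨(q + 1) * (r + 1) + p * q + p, by ring⟩
    have e₃ : (-1 : ℤ) ^ ((p + 1) * (q + r) + ((q + r + 1) * (p + 1) + (q + 1) * (r + 1))) =
        (-1) ^ (p + (q + 1) * (r + 1) + 1) :=
      neg_one_pow_congr ⟨(p + 1) * (q + r + 1) + (q + 1) * (r + 1), by ring⟩
    have e₄ : (-1 : ℤ) ^ ((q + 1) * (r + 1) + (p + p * r + 1)) =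
        (-1) ^ ((p + q + 1) * (r + 1) + 1) := by
      congr 1; ring
    have e₅ : (-1 : ℤ) ^ ((p + 1) * (q + r) + (q + q * r + 1)) =
        (-1) ^ ((p + q + 1) * (r + 1) + (p + 1) * (q + 1) + 1) :=
      neg_one_pow_congr ⟨p * r + p * q + p + q * r + 2 * q + r + 1 + 1, by ring⟩
    have e₆ : (-1 : ℤ) ^ ((q + 1) * (r + 1) + ((p + r + 1) * (q + 1) + (p + 1) * (r + 1))) =
        (-1) ^ ((p + 1) * (q + r) + q + 1) :=
      neg_one_pow_congr ⟨p * q + p * r + p + q * r + 2 * q + 2 * r + 2, by ring⟩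
    simp only [smul_add, smul_smul, ← pow_add]
    rw [e₁, e₂, e₃, e₄, e₅, e₆]
    simp only [pow_succ]
    module

end ControllingAlgebra

/-! ### Pre-LieDer pairs as Maurer–Cartan elements -/

section MaurerCartan

/-- The square of a form concentrated in degree `1`, that is, of a product: its vanishing is the
pre-Lie identity. -/
theorem circ_one_apply {W R : Type*} [AddCommGroup W] [Ring R] [Module R W] {A : List W → R}
    (hA : MultiAdd A) (hA₁ : ∀ l, l.length ≠ 1 → A l = 0) (x y : W) :
    circ 1 A A [x, y] = A [A [x] • y] - A [A [y] • x] - A [x] * A [y] + A [y] * A [x] := by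
  have hneg : ∀ a, A [-a] = -A [a] := fun a => by
    simpa [contr] using congrFun (hA.contr_zsmul (-1) a) []
  have hadd : ∀ a b, A [a + b] = A [a] + A [b] := fun a b => hA [] [] a b
  simp [circ, ins, wedge, splitSum, antisymm, contr, tw, hA₁, hadd, hneg]
  abel

/-- The bracket of a form concentrated in degree `1`, that is, a product, with a form of degree `0`,
that is, an operator: its vanishing means that the operator is a derivation of the product. -/
theorem bracket_one_zero_apply {W R : Type*} [AddCommGroup W] [Ring R] [Module R W]
    {A δ : List W → R} (hA : ∀ l, l.length ≠ 1 → A l = 0)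
    (hδ : ∀ l, l.length ≠ 0 → δ l = 0) (x : W) : bracket 1 0 A δ [x] = A [δ [] • x] + A [x] * δ [] - δ [] * A [x] := by
  simp [bracket, circ, ins, wedge, splitSum, antisymm, contr, tw, hA, hδ]

variable {K g V : Type*} [Field K] [AddCommGroup g] [Module K g] [AddCommGroup V] [Module K V]

theorem strElement_mem (π : g →ₗ[K] g →ₗ[K] g) (D : g →ₗ[K] V) (ρ μ : g →ₗ[K] (V →ₗ[K] V)) :
    strElement π D ρ μ ∈ ctrlGrading K g V 0 :=
  ⟨fun p hp => coeff_inc_of_cast_ne (i := 0 + 1) (by simp) _ p hp,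
    fun p hp => coeff_inc_of_cast_ne (i := 0) (by simp) _ p hp⟩

theorem strElement_add (π π' : g →ₗ[K] g →ₗ[K] g) (D D' : g →ₗ[K] V)
    (ρ μ ρ' μ' : g →ₗ[K] (V →ₗ[K] V)) :
    strElement (π + π') (D + D') (ρ + ρ') (μ + μ') =
      strElement π D ρ μ + strElement π' D' ρ' μ' := by
  refine ctrl_ext ?_ ?_
  · rw [map_add]
    refine Eq.trans (congrArg (inc 1) ?_) (map_add (inc 1) (strCoch π ρ μ) (strCoch π' ρ' μ'))
    refine AlternatingMap.ext fun x => LinearMap.ext fun w => ?_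
    rw [AlternatingMap.add_apply, LinearMap.add_apply, strCoch_apply, strCoch_apply, strCoch_apply]
    refine Prod.ext ?_ ?_
    · simp
    · simp; abel
  · rw [map_add]
    refine Eq.trans (congrArg (inc 0) ?_) (map_add (inc 0) (derCoch D) (derCoch D'))
    refine AlternatingMap.ext fun x => LinearMap.ext fun w => ?_
    rw [AlternatingMap.add_apply, LinearMap.add_apply, derCoch_apply, derCoch_apply, derCoch_apply]
    simp

/-- Every element of degree `0` comes from unique structure maps. -/
theorem existsUnique_strElement {β : Ctrl K g V} (hβ : β ∈ ctrlGrading K g V 0) :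
    ∃! t : (g →ₗ[K] g →ₗ[K] g) × (g →ₗ[K] V) × (g →ₗ[K] (V →ₗ[K] V)) × (g →ₗ[K] (V →ₗ[K] V)),
      strElement t.1 t.2.1 t.2.2.1 t.2.2.2 = β := by
  have hF : ctrlF β = inc 1 (coeff 1 (ctrlF β)) := eq_inc_coeff fun q hq => hβ.1 q (by omega)
  have hT : ctrlT β = inc 0 (coeff 0 (ctrlT β)) := eq_inc_coeff fun q hq => hβ.2 q (by omega)
  have hf := ctrlF_mem β 1
  have hθ := ctrlT_mem β 0
  set f := coeff 1 (ctrlF β) with hf_def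
  set θ := coeff 0 (ctrlT β) with hθ_def
  have hg : ∀ x : g, (x, (0 : V)) ∈ part K g V 0 := fun x => by rw [mem_part_iff]; simp
  have hV : ∀ v : V, ((0 : g), v) ∈ part K g V 1 := fun v => by rw [mem_part_iff]; simp
  let m : (g × V) →ₗ[K] (g × V) →ₗ[K] (g × V) :=
    (AlternatingMap.ofSubsingleton K (g × V) ((g × V) →ₗ[K] (g × V)) (0 : Fin 1)).symm f
  have hm : ∀ x : Fin 1 → g × V, f x = m (x 0) := by
    intro x
    have : x = fun _ => x 0 := by funext i; rw [Subsingleton.elim i 0]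
    rw [this]; rfl
  have hpart : ∀ {i j : ℤ} {a b : g × V}, a ∈ part K g V i → b ∈ part K g V j →
      m a b ∈ part K g V (i + j) := by
    intro i j a b ha hb
    have := hf (fun _ => i) j (fun _ => a) b (fun _ => ha) hb
    rw [hm] at this
    simpa using this
  refine ⟨⟨(m.compl₁₂ (LinearMap.inl K g V) (LinearMap.inl K g V)).compr₂ (LinearMap.fst K g V),
    LinearMap.snd K g V ∘ₗ θ ![] ∘ₗ LinearMap.inl K g V,
    (m.compl₁₂ (LinearMap.inl K g V) (LinearMap.inr K g V)).compr₂ (LinearMap.snd K g V),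
    ((m.compl₁₂ (LinearMap.inr K g V) (LinearMap.inl K g V)).compr₂ (LinearMap.snd K g V)).flip⟩,
    ?_, ?_⟩
  · refine ctrl_ext ?_ ?_
    · rw [hF]
      refine congrArg (inc 1) (AlternatingMap.ext fun x => LinearMap.ext fun w => ?_)
      rw [strCoch_apply, hm]
      obtain ⟨a, u⟩ := x 0
      obtain ⟨b, v⟩ := w
      have e : m (a, u) (b, v) = m (a, 0) (b, 0) + m (a, 0) (0, v) + (m (0, u) (b, 0) +
          m (0, u) (0, v)) := by
        rw [← map_add, ← map_add, ← LinearMap.add_apply, ← map_add]; simp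
      have h₀₀ := mem_part_iff.1 (hpart (hg a) (hg b))
      have h₀₁ := mem_part_iff.1 (hpart (hg a) (hV v))
      have h₁₀ := mem_part_iff.1 (hpart (hV u) (hg b))
      have h₁₁ := mem_part_iff.1 (hpart (hV u) (hV v))
      rw [e]
      refine Prod.ext ?_ ?_
      · simp [h₀₁.1, h₁₀.1, h₁₁.1]
      · simp [h₀₀.2, h₁₁.2]
    · rw [hT]
      refine congrArg (inc 0) (AlternatingMap.ext fun x => LinearMap.ext fun w => ?_)
      obtain rfl : x = ![] := Subsingleton.elim _ _
      obtain ⟨b, v⟩ := w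
      have h₀ := mem_part_iff.1 (hθ ![] 0 ![] (b, 0) (fun i => i.elim0) (hg b))
      have h₁ := mem_part_iff.1 (hθ ![] 1 ![] (0, v) (fun i => i.elim0) (hV v))
      have e : θ ![] (b, v) = θ ![] (b, 0) + θ ![] (0, v) := by rw [← map_add]; simp
      rw [derCoch_apply, e]
      refine Prod.ext ?_ ?_
      · simp [h₀.1, h₁.1]
      · simp [h₁.2]
  · rintro ⟨π, D, ρ, μ⟩ h
    dsimp only at h
    have h₁ : f = strCoch π ρ μ := by
      rw [hf_def, ← h]; exact coeff_inc_same 1 _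
    have h₂ : θ = derCoch D := by
      rw [hθ_def, ← h]; exact coeff_inc_same 0 _
    have hm' : ∀ a b, m a b = (π a.1 b.1, ρ a.1 b.2 + μ b.1 a.2) := by
      intro a b
      have := hm fun _ => a
      rw [← this, h₁]; rfl
    refine Prod.ext ?_ (Prod.ext ?_ (Prod.ext ?_ ?_))
    · refine LinearMap.ext fun a => LinearMap.ext fun b => ?_
      simp [hm']
    · refine LinearMap.ext fun a => ?_
      simp [h₂, derCoch_apply]
    · refine LinearMap.ext fun a => LinearMap.ext fun b => ?_
      simp [hm']
    · refine LinearMap.ext fun a => LinearMap.ext fun b => ?_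
      simp [hm']

variable [CharZero K]

variable (K) in
theorem two_smul_eq_zero_iff {M : Type*} [AddCommGroup M] [Module K M] {x : M} :
    (2 : ℤ) • x = 0 ↔ x = 0 := by
  rw [← Int.cast_smul_eq_zsmul K]
  simp

/-- The pre-LieDer pair axioms say that the graded bracket `l₂` of `(s⁻¹(π + ρ + μ), D)` with itself
vanishes. -/
theorem ctrlBilin_strElement_self_eq_zero_iff (π : g →ₗ[K] g →ₗ[K] g) (D : g →ₗ[K] V)
    (ρ μ : g →ₗ[K] (V →ₗ[K] V)) :
    ctrlBilin (strElement π D ρ μ) (strElement π D ρ μ) = 0 ↔ IsPreLieDerPair π D ρ μ := by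
  set α := strElement π D ρ μ with hα
  have hα' : α ∈ ctrlGrading K g V (((1 : ℕ) : ℤ) - 1) := by
    simpa using strElement_mem π D ρ μ
  set A := hat (inc 1 (strCoch π ρ μ)) with hA
  set δ := hat (inc 0 (derCoch D)) with hδ
  have hA₁ : ∀ x w : g × V, A [x] w = (π x.1 w.1, ρ x.1 w.2 + μ w.1 x.2) := fun x w =>
    congrArg (fun φ : (g × V) →ₗ[K] (g × V) => φ w) (hat_inc_ofFn (strCoch π ρ μ) fun _ => x)
  have hδ₀ : ∀ w : g × V, δ [] w = (0, D w.1) := fun w =>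
    congrArg (fun φ : (g × V) →ₗ[K] (g × V) => φ w) (hat_inc_ofFn (derCoch D) ![])
  have hAne : ∀ l : List (g × V), l.length ≠ 1 → A l = 0 := fun l => hat_inc_of_length_ne _
  have hδne : ∀ l : List (g × V), l.length ≠ 0 → δ l = 0 := fun l => hat_inc_of_length_ne _
  have hF : hat (ctrlF (ctrlBilin α α)) = -((2 : ℤ) • circ 1 A A) := by
    rw [hat_ctrlF_bilin hα' hα']
    change (-1 : ℤ) ^ 1 • bracket 1 1 A A = _
    rw [bracket]
    simp [two_smul]
  have hT : hat (ctrlT (ctrlBilin α α)) = (2 : ℤ) • bracket 1 0 A δ := by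
    rw [hat_ctrlT_bilin hα' hα']
    change bracket 1 (0 + 2) A δ + (-1 : ℤ) ^ ((1 + 1) * (1 + 1)) • bracket 1 (0 + 2) A δ = _
    rw [bracket_add_two]
    simp [two_smul]
  have h : ctrlBilin α α = 0 ↔ circ 1 A A = 0 ∧ bracket 1 0 A δ = 0 := by
    constructor
    · intro h
      rw [h, map_zero, map_zero] at hF hT
      exact ⟨(two_smul_eq_zero_iff K).1 (neg_eq_zero.1 hF.symm), (two_smul_eq_zero_iff K).1 hT.symm⟩
    · rintro ⟨h₁, h₂⟩
      refine ctrl_hat_ext ?_ ?_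
      · rw [hF, h₁, smul_zero, neg_zero, map_zero, map_zero]
      · rw [hT, h₂, smul_zero, map_zero, map_zero]
  have hcirc : ∀ l : List (g × V), l.length ≠ 2 → circ 1 A A l = 0 := by
    intro l hl
    have := hat_comp (rfl : 1 + 1 = 2) (strCoch π ρ μ) (strCoch π ρ μ)
    rw [← hA] at this
    rw [← this]
    exact hat_inc_of_length_ne _ hl
  have hbr : ∀ l : List (g × V), l.length ≠ 1 → bracket 1 0 A δ l = 0 := by
    intro l hl
    have := hat_mnBracket (rfl : 1 + 0 = 1) (strCoch π ρ μ) (derCoch D)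
    rw [← hA, ← hδ] at this
    rw [← this]
    exact hat_inc_of_length_ne _ hl
  have hc : ∀ x y z : g × V, circ 1 A A [x, y] z =
      A [A [x] y] z - A [A [y] x] z - A [x] (A [y] z) + A [y] (A [x] z) := by
    intro x y z
    rw [circ_one_apply (multiAdd_hat _) hAne]
    rfl
  have hb : ∀ x z : g × V, bracket 1 0 A δ [x] z = A [δ [] x] z + A [x] (δ [] z) - δ [] (A [x] z) := by
    intro x z
    rw [bracket_one_zero_apply hAne hδne]
    rfl
  rw [h]
  constructor
  -- evaluate the two identities on `g ⊕ V` on arguments taken from `g` and `V`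
  · rintro ⟨h₁, h₂⟩
    have h₁' : ∀ x y z : g × V, A [A [x] y] z - A [A [y] x] z - A [x] (A [y] z) +
        A [y] (A [x] z) = 0 := fun x y z => by rw [← hc, h₁]; rfl
    have h₂' : ∀ x z : g × V, A [δ [] x] z + A [x] (δ [] z) - δ [] (A [x] z) = 0 := fun x z => by
      rw [← hb, h₂]; rfl
    simp only [hA₁, hδ₀] at h₁' h₂'
    refine ⟨fun x y z => ?_, ⟨fun x y => LinearMap.ext fun v => ?_,
      fun x y => LinearMap.ext fun v => ?_⟩, fun x y => ?_⟩
    · have := congrArg Prod.fst (h₁' (x, 0) (y, 0) (z, 0))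
      simp at this
      linear_combination (norm := module) this
    · have := congrArg Prod.snd (h₁' (x, 0) (y, 0) (0, v))
      simp at this
      simp
      linear_combination (norm := module) this
    · have := congrArg Prod.snd (h₁' (x, 0) (0, v) (y, 0))
      simp at this
      simp
      linear_combination (norm := module) -this
    · have := congrArg Prod.snd (h₂' (x, 0) (y, 0))
      simp at this
      linear_combination (norm := module) -this
  · intro hp
    constructor
    · funext l
      by_cases hl : l.length = 2
      · obtain ⟨x, y, rfl⟩ := List.length_eq_two.1 hl
        refine LinearMap.ext fun z => ?_
        rw [hc]
        simp only [hA₁]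
        have r₁ := LinearMap.congr_fun (hp.rep.lie x.1 y.1) z.2
        have r₂ := LinearMap.congr_fun (hp.rep.right x.1 z.1) y.2
        have r₃ := LinearMap.congr_fun (hp.rep.right y.1 z.1) x.2
        simp at r₁ r₂ r₃
        refine Prod.ext ?_ ?_
        · simp
          linear_combination (norm := module) hp.preLie x.1 y.1 z.1
        · simp
          linear_combination (norm := module) r₁ - r₂ + r₃
      · exact hcirc l hl
    · funext l
      by_cases hl : l.length = 1
      · obtain ⟨x, rfl⟩ := List.length_eq_one_iff.1 hl
        refine LinearMap.ext fun z => ?_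
        rw [hb]
        simp only [hA₁, hδ₀]
        refine Prod.ext ?_ ?_
        · simp
        · simp
          linear_combination (norm := module) -hp.derivation x.1 z.1
      · exact hbr l hl

/-- Twisting by an element `α` of degree `0` with `l₂(α, α) = 0`: the differential `l₂(α, ·)` is
compatible with `l₂`. -/
theorem isLInfinity_twist {α : Ctrl K g V} (hα : α ∈ ctrlGrading K g V 0)
    (h : ctrlBilin α α = 0) : IsLInfinity (ctrlGrading K g V) (twist (ctrlBracket K g V) α) := by
  refine (isQuadratic_ctrlBracket.twist α).isLInfinity ctrlGrading_isInternal ?_ ctrlBilin_mem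
    ctrlBilin_symm ?_ ?_ ctrlBilin_jacobi
  · intro i x hx
    simpa using ctrlBilin_mem hα hx
  · intro i x hx
    have hJ := ctrlBilin_jacobi hα hα hx
    have hs := ctrlBilin_symm (ctrlBilin_mem hα hx) hα
    simp only [h, map_zero, LinearMap.zero_apply, zero_mul, mul_zero, zero_add, Int.negOnePow_zero,
      one_smul, ← two_zsmul] at hJ hs
    rw [hs]
    exact (two_smul_eq_zero_iff K).1 hJ
  · intro i j x y hx hy
    have hJ := ctrlBilin_jacobi hα hx hy
    have hs := ctrlBilin_symm (ctrlBilin_mem hx hy) hα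
    simp only [zero_mul, mul_zero, Int.negOnePow_zero, one_smul] at hJ hs
    rw [hs]
    exact hJ

end MaurerCartan

end PreLieDer

theorem mainTheorem2 {K : Type*} [Field K] [CharZero K] {g V : Type*}
    [AddCommGroup g] [Module K g] [AddCommGroup V] [Module K V]
    (π : g →ₗ[K] g →ₗ[K] g) (D : g →ₗ[K] V) (ρ μ : g →ₗ[K] (V →ₗ[K] V))
    (hpair : PreLieDer.IsPreLieDerPair π D ρ μ) :
    -- the element `α = (s⁻¹(π + ρ + μ), D)` is a Maurer–Cartan element of `s⁻¹L' ⊕ h`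
    PreLieDer.IsLInfinity (PreLieDer.ctrlGrading K g V) (PreLieDer.ctrlBracket K g V) ∧
    PreLieDer.IsMaurerCartan (PreLieDer.ctrlGrading K g V) (PreLieDer.ctrlBracket K g V)
      (PreLieDer.strElement π D ρ μ) ∧
    -- the brackets twisted by `α` form an `L∞`-algebra
    PreLieDer.IsLInfinity (PreLieDer.ctrlGrading K g V)
      (PreLieDer.twist (PreLieDer.ctrlBracket K g V) (PreLieDer.strElement π D ρ μ)) ∧
    -- formulas for the twisted brackets
    (∀ a : PreLieDer.Ctrl K g V,
      PreLieDer.twist (PreLieDer.ctrlBracket K g V) (PreLieDer.strElement π D ρ μ) 1 ![a] =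
        PreLieDer.ctrlBracket K g V 2 ![PreLieDer.strElement π D ρ μ, a]) ∧
    (∀ a₁ a₂ : PreLieDer.Ctrl K g V,
      PreLieDer.twist (PreLieDer.ctrlBracket K g V) (PreLieDer.strElement π D ρ μ) 2 ![a₁, a₂] =
        PreLieDer.ctrlBracket K g V 2 ![a₁, a₂]) ∧
    (∀ k : ℕ, 3 ≤ k → ∀ a : Fin k → PreLieDer.Ctrl K g V,
      PreLieDer.twist (PreLieDer.ctrlBracket K g V) (PreLieDer.strElement π D ρ μ) k a = 0) ∧
    -- every element of degree `0` is `(s⁻¹(π' + ρ' + μ'), D')` for unique `π', D', ρ', μ'`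
    (∀ β ∈ PreLieDer.ctrlGrading K g V 0,
      ∃! t : (g →ₗ[K] g →ₗ[K] g) × (g →ₗ[K] V) × (g →ₗ[K] (V →ₗ[K] V)) × (g →ₗ[K] (V →ₗ[K] V)),
        PreLieDer.strElement t.1 t.2.1 t.2.2.1 t.2.2.2 = β) ∧
    -- Maurer–Cartan elements of the twisted algebra are the deformations of the pair
    (∀ (π' : g →ₗ[K] g →ₗ[K] g) (D' : g →ₗ[K] V) (ρ' μ' : g →ₗ[K] (V →ₗ[K] V)),
      PreLieDer.IsPreLieDerPair (π + π') (D + D') (ρ + ρ') (μ + μ') ↔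
        PreLieDer.IsMaurerCartan (PreLieDer.ctrlGrading K g V)
          (PreLieDer.twist (PreLieDer.ctrlBracket K g V) (PreLieDer.strElement π D ρ μ))
          (PreLieDer.strElement π' D' ρ' μ')) := by
  have hquad := PreLieDer.isQuadratic_ctrlBracket (K := K) (g := g) (V := V)
  have hα := PreLieDer.strElement_mem π D ρ μ
  have hαα := (PreLieDer.ctrlBilin_strElement_self_eq_zero_iff π D ρ μ).2 hpair
  set α := PreLieDer.strElement π D ρ μ with hα_def
  have htw := hquad.twist α
  refine ⟨?_, ?_, PreLieDer.isLInfinity_twist hα hαα, fun a => ?_, fun a₁ a₂ => ?_,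
    fun k hk a => ?_, fun β hβ => PreLieDer.existsUnique_strElement hβ, fun π' D' ρ' μ' => ?_⟩
  · refine hquad.isLInfinity PreLieDer.ctrlGrading_isInternal (fun _ => zero_mem _)
      PreLieDer.ctrlBilin_mem PreLieDer.ctrlBilin_symm (fun _ => rfl) (fun _ _ => ?_)
      PreLieDer.ctrlBilin_jacobi
    simp
  · rw [hquad.isMaurerCartan_iff]
    exact ⟨hα, by rw [hαα]; simp⟩
  · rw [htw.one, hquad.two]; rfl
  · rw [htw.two, hquad.two]
  · rw [htw.three k hk]; rfl
  · rw [htw.isMaurerCartan_iff, ← PreLieDer.ctrlBilin_strElement_self_eq_zero_iff,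
      PreLieDer.strElement_add, ← hα_def]
    set β := PreLieDer.strElement π' D' ρ' μ' with hβ_def
    have hβ : β ∈ PreLieDer.ctrlGrading K g V 0 := PreLieDer.strElement_mem π' D' ρ' μ'
    have hs : PreLieDer.ctrlBilin β α = PreLieDer.ctrlBilin α β := by
      simpa using PreLieDer.ctrlBilin_symm hα hβ
    -- `l₂(α + β, α + β) = 2 (l₂(α, β) + ½ l₂(β, β))`, as `l₂(α, α) = 0`
    have he : PreLieDer.ctrlBilin (α + β) (α + β) =
        (2 : K) • (PreLieDer.ctrlBilin α β + (2 : K)⁻¹ • PreLieDer.ctrlBilin β β) := by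
      rw [map_add, LinearMap.map_add₂, LinearMap.map_add₂, hαα, hs, smul_add, smul_smul,
        mul_inv_cancel₀ two_ne_zero, one_smul, two_smul]
      abel
    rw [he, smul_eq_zero_iff_right two_ne_zero]
    exact ⟨fun h => ⟨hβ, h⟩, fun h => h.2⟩
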